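/- Let $K_0\subseteq K\subseteq L$ be number fields with $L/K_0$ Galois with group $\Gamma$, and let $\Gamma'\le\Gamma$ be a subgroup with $K=L^{\Gamma'}$. Notation. For a number field $F$ let $\mathrm{Cl}_F$ be its ideal class group, and let $\mathrm{Cl}_{K|K_0}\subseteq \mathrm{Cl}_K$ be the subgroup of ideal classes with trivial norm in $\mathrm{Cl}_{K_0}$. For an extension $F\subseteq F'$ let $i_*:\mathrm{Cl}_F\to\mathrm{Cl}_{F'}$ be the map induced by extension of ideals. For a set $S$ of primes let $\mathbb Z_S$ be the ring of rational numbers with denominator not divisible by any prime in $S$ (and $\mathbb Z_{(p)}=\mathbb Z_{\{p\}}$). For a finite abelian group $G$ let $G^S$ be the subgroup generated by the Sylow $p$-subgroups of $G$ with $p\in S$; it is a $\mathbb Z_S$-module, and $\mathrm{Cl}_L^S$ is a $\mathbb Z_S[\Gamma]$-module. Let $e_{\Gamma/\Gamma'}\in\mathbb Q[\Gamma]$ be the central idempotent associated to the character $\mathrm{Ind}_{\Gamma'}^{\Gamma}1-1$, that is, the smallest central idempotent acting as the identity on the augmentation submodule of $\mathbb Q[\Gamma/\Gamma']$. A prime $p$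 is good for a central idempotent $e$ if $e\in\mathbb Z_{(p)}[\Gamma]$ and $e\mathbb Z_{(p)}[\Gamma]$ is a maximal $\mathbb Z_{(p)}$-order in $e\mathbb Q[\Gamma]$. Theorem. Let $S$ be a (possibly infinite) set of primes, every element of which is good for $e_{\Gamma/\Gamma'}$. Then: (i) $p\nmid[K:K_0]$ for all $p\in S$, and the sequence $$1\longrightarrow \mathrm{Cl}_{K|K_0}^S\longrightarrow \mathrm{Cl}_K^S\xrightarrow{\ \mathrm{Nm}\ }\mathrm{Cl}_{K_0}^S\longrightarrow 1$$ is exact and splits. Moreover $i_*:\mathrm{Cl}_{K_0}^S\to\mathrm{Cl}_K^S$ is injective, and $\mathrm{Cl}_K^S$ is the internal direct product of $i_*(\mathrm{Cl}_{K_0}^S)$ and $\mathrm{Cl}_{K|K_0}^S$. (ii) $e_{\Gamma/\Gamma'}\in\mathbb Z_S[\Gamma]$, and $i_*:\mathrm{Cl}_K\to\mathrm{Cl}_L$ restricts to an isomorphism $$\mathrm{Cl}_{K|K_0}^S\xrightarrow{\ \sim\ }\big(e_{\Gamma/\Gamma'}\mathrm{Cl}_L^S\big)^{\Gamma'}\subseteq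 \mathrm{Cl}_L^S .$$ In particular, if $K_0=\mathbb Q$, then $i_*$ restricts to an isomorphism $\mathrm{Cl}_K^S\cong(e_{\Gamma/\Gamma'}\mathrm{Cl}_L^S)^{\Gamma'}$, and the order of the capitulation kernel $\ker(i_*:\mathrm{Cl}_K\to\mathrm{Cl}_L)$ is not divisible by any $p\in S$. -/

import Mathlib

open NumberField
open scoped nonZeroDivisors

noncomputable section

/-! ### The ring `ℤ_S` and the `S`-part of an abelian group -/

/-- `ℤ_S`: the rational numbers whose denominator is divisible by no prime of `S`. -/
def ZLoc (S : Set Nat.Primes) : Subring ℚ where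
  carrier := {q | ∀ p ∈ S, ¬ (p : ℕ) ∣ q.den}
  mul_mem' := by
    intro a b ha hb p hp h
    rcases (p.2.dvd_mul).1 (h.trans (Rat.mul_den_dvd a b)) with h | h
    · exact ha p hp h
    · exact hb p hp h
  one_mem' := by
    intro p _ h
    exact p.2.one_lt.ne' (Nat.dvd_one.1 (by simpa using h))
  add_mem' := by
    intro a b ha hb p hp h
    rcases (p.2.dvd_mul).1 (h.trans (Rat.add_den_dvd a b)) with h | h
    · exact ha p hp h
    · exact hb p hp h
  zero_mem' := by
    intro p _ h
    exact p.2.one_lt.ne' (Nat.dvd_one.1 (by simpa using h))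
  neg_mem' := by
    intro a ha p hp h
    exact ha p hp (by simpa using h)

/-- The `S`-part `G^S` of an abelian group `G`: the subgroup generated by all Sylow `p`-subgroups
with `p ∈ S`. -/
def sPart (S : Set Nat.Primes) (G : Type*) [CommGroup G] : Subgroup G :=
  ⨆ p ∈ S, ⨆ P : Sylow (p : ℕ) G, (P : Subgroup G)

theorem sPart_spec (S : Set Nat.Primes) {G : Type*} [CommGroup G] {x : G} (hx : x ∈ sPart S G) :
    IsOfFinOrder x ∧ ∀ q : Nat.Primes, (q : ℕ) ∣ orderOf x → q ∈ S := by
  let T : Subgroup G :=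
    { carrier := {x | IsOfFinOrder x ∧ ∀ q : Nat.Primes, (q : ℕ) ∣ orderOf x → q ∈ S}
      mul_mem' := by
        rintro a b ⟨ha, ha'⟩ ⟨hb, hb'⟩
        refine ⟨ha.mul hb, fun q hq => ?_⟩
        have h := hq.trans ((Commute.all a b).orderOf_mul_dvd_mul_orderOf)
        exact ((q.2.dvd_mul).1 h).elim (ha' q) (hb' q)
      one_mem' := by
        refine ⟨IsOfFinOrder.one, fun q hq => ?_⟩
        rw [orderOf_one] at hq
        exact absurd (Nat.dvd_one.1 hq) q.2.one_lt.ne'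
      inv_mem' := by
        rintro a ⟨ha, ha'⟩
        exact ⟨ha.inv, fun q hq => ha' q (by rwa [orderOf_inv] at hq)⟩ }
  have hT : sPart S G ≤ T := by
    refine iSup₂_le fun p hp => iSup_le fun P => ?_
    intro y hy
    obtain ⟨k, hk⟩ := P.isPGroup' ⟨y, hy⟩
    have hk' : y ^ (p : ℕ) ^ k = 1 := by simpa using congrArg Subtype.val hk
    refine ⟨isOfFinOrder_iff_pow_eq_one.2 ⟨_, pow_pos p.2.pos k, hk'⟩, fun q hq => ?_⟩
    have h := q.2.dvd_of_dvd_pow (hq.trans (orderOf_dvd_of_pow_eq_one hk'))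
    have h' := (Nat.prime_dvd_prime_iff_eq q.2 p.2).1 h
    rwa [Subtype.ext h']
  exact hT hx

/-- The `S`-part is stable under automorphisms. -/
theorem map_mem_sPart (S : Set Nat.Primes) {G : Type*} [CommGroup G] (φ : MulAut G) {x : G}
    (hx : x ∈ sPart S G) : φ x ∈ sPart S G := by
  have h : sPart S G ≤ (sPart S G).comap φ.toMonoidHom := by
    refine iSup₂_le fun p hp => iSup_le fun P => ?_
    intro y hy
    have h1 : φ y ∈ ((φ • P : Sylow (p : ℕ) G) : Subgroup G) :=
      Subgroup.smul_mem_pointwise_smul y φ (P : Subgroup G) hy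
    have h2 : ((φ • P : Sylow (p : ℕ) G) : Subgroup G) ≤ sPart S G :=
      le_trans (le_iSup (fun P : Sylow (p : ℕ) G => (P : Subgroup G)) (φ • P))
        (le_iSup₂ (f := fun (p : Nat.Primes) (_ : p ∈ S) =>
          ⨆ P : Sylow (p : ℕ) G, (P : Subgroup G)) p hp)
    exact h2 h1
  exact h hx

/-- The automorphism of `G^S` induced by an automorphism of `G`. -/
def sPartAut (S : Set Nat.Primes) {G : Type*} [CommGroup G] (φ : MulAut G) :
    sPart S G →* sPart S G :=
  (φ.toMonoidHom.domRestrict (sPart S G)).codRestrict (sPart S G) fun x => map_mem_sPart S φ x.2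

theorem sPart_nsmul_injective (S : Set Nat.Primes) {G : Type*} [CommGroup G] {n : ℕ}
    (hn : ∀ p ∈ S, ¬ (p : ℕ) ∣ n) {x y : Additive (sPart S G)} (h : n • x = n • y) : x = y := by
  rw [← sub_eq_zero] at h ⊢
  rw [← nsmul_sub] at h
  generalize x - y = z at h
  have h0 := sPart_spec S (z.toMul).2
  have h1 : ((z.toMul : sPart S G) : G) ^ n = 1 := by
    simpa using congrArg (fun w : Additive (sPart S G) => ((w.toMul : sPart S G) : G)) h
  have h2 : orderOf ((z.toMul : sPart S G) : G) = 1 := by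
    by_contra hne
    obtain ⟨q, hq, hq'⟩ := Nat.exists_prime_and_dvd hne
    exact hn ⟨q, hq⟩ (h0.2 ⟨q, hq⟩ hq') (hq'.trans (orderOf_dvd_of_pow_eq_one h1))
  rw [orderOf_eq_one_iff] at h2
  exact (Subtype.ext h2 : (z.toMul : sPart S G) = 1)

theorem sPart_exists_nsmul_eq (S : Set Nat.Primes) {G : Type*} [CommGroup G] {n : ℕ}
    (hn : ∀ p ∈ S, ¬ (p : ℕ) ∣ n) (x : Additive (sPart S G)) : ∃ y, n • y = x := by
  have h0 := sPart_spec S (x.toMul).2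
  have hc : n.Coprime (orderOf ((x.toMul : sPart S G) : G)) := by
    refine Nat.Coprime.symm (Nat.coprime_of_dvd fun q hq hq' hqn => ?_)
    exact hn ⟨q, hq⟩ (h0.2 ⟨q, hq⟩ hq') hqn
  obtain ⟨m, hm⟩ := exists_pow_eq_self_of_coprime hc
  refine ⟨m • x, ?_⟩
  have : ((x.toMul : sPart S G) ^ m) ^ n = x.toMul := by
    apply Subtype.ext
    rw [← pow_mul, mul_comm, pow_mul]
    simpa using hm
  exact this

/-- `ℤ_S` acts on `G^S`: for `q = a / b` in lowest terms, `q • x` is the unique `y` with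
`b • y = a • x`. -/
def sPartSMul (S : Set Nat.Primes) (G : Type*) [CommGroup G] (q : ZLoc S)
    (x : Additive (sPart S G)) : Additive (sPart S G) :=
  (sPart_exists_nsmul_eq S q.2 ((q : ℚ).num • x)).choose

theorem sPartSMul_spec (S : Set Nat.Primes) (G : Type*) [CommGroup G] (q : ZLoc S)
    (x : Additive (sPart S G)) : (q : ℚ).den • sPartSMul S G q x = (q : ℚ).num • x :=
  (sPart_exists_nsmul_eq S q.2 ((q : ℚ).num • x)).choose_spec

theorem sPartSMul_eq (S : Set Nat.Primes) (G : Type*) [CommGroup G] (q : ZLoc S)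
    (x y : Additive (sPart S G)) (n : ℕ) (a : ℤ) (hn : ∀ p ∈ S, ¬ (p : ℕ) ∣ n)
    (hq : (q : ℚ) * n = a) (h : n • y = a • x) : sPartSMul S G q x = y := by
  have hn' : ∀ p ∈ S, ¬ (p : ℕ) ∣ n * (q : ℚ).den := fun p hp hd =>
    ((p.2.dvd_mul).1 hd).elim (hn p hp) (q.2 p hp)
  apply sPart_nsmul_injective S hn'
  have hz : (n : ℤ) * (q : ℚ).num = ((q : ℚ).den : ℤ) * a := by
    have h1 : ((q : ℚ).num : ℚ) = q * (q : ℚ).den := (Rat.mul_den_eq_num _).symm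
    have : ((n : ℤ) * (q : ℚ).num : ℚ) = (((q : ℚ).den : ℤ) * a : ℚ) := by
      rw [h1, ← hq]; push_cast; ring
    exact_mod_cast this
  have e1 : (n * (q : ℚ).den) • sPartSMul S G q x = ((n : ℤ) * (q : ℚ).num) • x := by
    rw [mul_nsmul', sPartSMul_spec, mul_zsmul', natCast_zsmul]
    exact smul_comm _ _ _
  have e2 : (n * (q : ℚ).den) • y = (((q : ℚ).den : ℤ) * a) • x := by
    rw [mul_comm, mul_nsmul', h, mul_zsmul', natCast_zsmul]
    exact smul_comm _ _ _
  rw [e1, e2, hz]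

/-- The `ℤ_S`-module structure of `G^S` (written additively). -/
instance sPartModule (S : Set Nat.Primes) (G : Type*) [CommGroup G] :
    Module (ZLoc S) (Additive (sPart S G)) where
  smul := sPartSMul S G
  one_smul x := by
    refine sPartSMul_eq S G 1 x x 1 1 (fun p _ h => ?_) (by simp) (by simp)
    exact p.2.one_lt.ne' (Nat.dvd_one.1 h)
  mul_smul q r x := by
    refine sPartSMul_eq S G (q * r) x _ ((q : ℚ).den * (r : ℚ).den)
      ((q : ℚ).num * (r : ℚ).num) (fun p hp hd => ?_) ?_ ?_
    · exact ((p.2.dvd_mul).1 hd).elim (q.2 p hp) (r.2 p hp)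
    · push_cast
      rw [← Rat.mul_den_eq_num (q : ℚ), ← Rat.mul_den_eq_num (r : ℚ)]; ring
    · change ((q : ℚ).den * (r : ℚ).den) • sPartSMul S G q (sPartSMul S G r x) = _
      rw [mul_comm, mul_nsmul', sPartSMul_spec, smul_comm, sPartSMul_spec, ← mul_zsmul, mul_comm]
  smul_zero q := sPartSMul_eq S G q 0 0 _ _ q.2 (Rat.mul_den_eq_num _) (by simp)
  smul_add q x y := by
    refine sPartSMul_eq S G q _ _ _ _ q.2 (Rat.mul_den_eq_num _) ?_
    change (q : ℚ).den • (sPartSMul S G q x + sPartSMul S G q y) = _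
    rw [nsmul_add, sPartSMul_spec, sPartSMul_spec, zsmul_add]
  add_smul q r x := by
    refine sPartSMul_eq S G (q + r) x _ ((q : ℚ).den * (r : ℚ).den)
      ((q : ℚ).num * (r : ℚ).den + (r : ℚ).num * (q : ℚ).den) (fun p hp hd => ?_) ?_ ?_
    · exact ((p.2.dvd_mul).1 hd).elim (q.2 p hp) (r.2 p hp)
    · push_cast
      rw [← Rat.mul_den_eq_num (q : ℚ), ← Rat.mul_den_eq_num (r : ℚ)]; ring
    · change ((q : ℚ).den * (r : ℚ).den) • (sPartSMul S G q x + sPartSMul S G r x) = _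
      rw [nsmul_add, add_zsmul]
      congr 1
      · rw [mul_comm, mul_nsmul', sPartSMul_spec, mul_zsmul', natCast_zsmul]
      · rw [mul_nsmul', sPartSMul_spec, mul_zsmul', natCast_zsmul]
  zero_smul x := by
    refine sPartSMul_eq S G 0 x 0 1 0 (fun p _ h => ?_) (by simp) (by simp)
    exact p.2.one_lt.ne' (Nat.dvd_one.1 h)

theorem sPart_smul_spec (S : Set Nat.Primes) (G : Type*) [CommGroup G] (q : ZLoc S)
    (x : Additive (sPart S G)) : (q : ℚ).den • (q • x) = (q : ℚ).num • x :=
  sPartSMul_spec S G q x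

/-- The `ℤ_S`-linear representation on `G^S` induced by an action of a group `Γ` on `G` by
automorphisms; it makes `G^S` a `ℤ_S[Γ]`-module. -/
def sPartRep (S : Set Nat.Primes) {Γ G : Type*} [Group Γ] [CommGroup G] (φ : Γ →* MulAut G) :
    Representation (ZLoc S) Γ (Additive (sPart S G)) where
  toFun σ :=
    { toFun := MonoidHom.toAdditive (sPartAut S (φ σ))
      map_add' := map_add _
      map_smul' := fun q x => by
        refine (sPartSMul_eq S G q _ _ _ _ q.2 (Rat.mul_den_eq_num _) ?_).symm
        rw [← map_nsmul, sPart_smul_spec, map_zsmul] }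
  map_one' := by
    ext x
    change (φ 1) _ = _
    rw [map_one]; rfl
  map_mul' σ τ := by
    ext x
    change (φ (σ * τ)) _ = _
    rw [map_mul]; rfl

/-- The subgroup `a · G^S` of `G`, for `a ∈ ℤ_S[Γ]`. -/
def smulSPart (S : Set Nat.Primes) {Γ G : Type*} [Group Γ] [CommGroup G] (φ : Γ →* MulAut G)
    (a : MonoidAlgebra (ZLoc S) Γ) : Subgroup G :=
  (AddSubgroup.toSubgroup'
    (LinearMap.range ((sPartRep S φ).asAlgebraHom a)).toAddSubgroup).map (sPart S G).subtype

/-- The elements of `G` fixed by a subgroup `Γ'` of `Γ`. -/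
def fixedSubgroup {Γ G : Type*} [Group Γ] [CommGroup G] (φ : Γ →* MulAut G) (Γ' : Subgroup Γ) :
    Subgroup G where
  carrier := {x | ∀ σ ∈ Γ', φ σ x = x}
  mul_mem' := fun ha hb σ hσ => by rw [map_mul, ha σ hσ, hb σ hσ]
  one_mem' := fun σ _ => map_one _
  inv_mem' := fun ha σ hσ => by rw [map_inv, ha σ hσ]

/-! ### Orders, good primes, and the idempotent of the augmentation character -/

/-- For an idempotent `e` of a `ℚ`-algebra `A` and a subring `R` of `ℚ`, the `R`-submodule `Λ` is
an `R`-order in the algebra `eAe` (which is `eA` if `e` is central), whose identity is `e`. -/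
structure IsOrderIn (R : Subring ℚ) {A : Type*} [Ring A] [Algebra ℚ A] (e : A)
    (Λ : Submodule R A) : Prop where
  one_mem : e ∈ Λ
  mul_mem : ∀ x ∈ Λ, ∀ y ∈ Λ, x * y ∈ Λ
  mem_corner : ∀ x ∈ Λ, e * x * e = x
  fg : Λ.FG
  span_eq : ∀ x : A, e * x * e ∈ Submodule.span ℚ (Λ : Set A)

/-- A maximal `R`-order in `eAe`. -/
def IsMaximalOrderIn (R : Subring ℚ) {A : Type*} [Ring A] [Algebra ℚ A] (e : A)
    (Λ : Submodule R A) : Prop :=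
  IsOrderIn R e Λ ∧ ∀ Λ' : Submodule R A, IsOrderIn R e Λ' → Λ ≤ Λ' → Λ' = Λ

/-- The inclusion `R[Γ] → ℚ[Γ]`, for a subring `R` of `ℚ`. -/
def groupRingIncl (R : Subring ℚ) (Γ : Type*) [Group Γ] :
    MonoidAlgebra R Γ →ₐ[R] MonoidAlgebra ℚ Γ :=
  MonoidAlgebra.mapAlgHom Γ (Algebra.ofId R ℚ)

/-- The prime `p` is good for the central idempotent `e` of `ℚ[Γ]`: `e ∈ ℤ_(p)[Γ]` and
`e ℤ_(p)[Γ]` is a maximal `ℤ_(p)`-order in `e ℚ[Γ]`. -/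
def IsGoodPrime {Γ : Type*} [Group Γ] (e : MonoidAlgebra ℚ Γ) (p : Nat.Primes) : Prop :=
  e ∈ (groupRingIncl (ZLoc {p}) Γ).range ∧
    IsMaximalOrderIn (ZLoc {p}) e
      ((Subalgebra.toSubmodule (groupRingIncl (ZLoc {p}) Γ).range).map
        (LinearMap.mulLeft (ZLoc {p}) e))

/-- The augmentation submodule of the permutation representation `ℚ[Γ/Γ']`. As
`ℚ[Γ/Γ'] = Ind_{Γ'}^Γ 1`, its character is `a_{Γ/Γ'} = Ind_{Γ'}^Γ 1_{Γ'} - 1_Γ`. -/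
def augSubmodule {Γ : Type*} [Group Γ] (Γ' : Subgroup Γ) : Submodule ℚ (MonoidAlgebra ℚ (Γ ⧸ Γ')) :=
  LinearMap.ker ((Finsupp.linearCombination ℚ fun _ : Γ ⧸ Γ' => (1 : ℚ)) ∘ₗ
    (MonoidAlgebra.coeffLinearEquiv ℚ).toLinearMap)

/-- `e` is a central idempotent of `ℚ[Γ]` that acts as the identity on the augmentation submodule
of `ℚ[Γ/Γ']`. -/
structure ActsAsOneOnAug {Γ : Type*} [Group Γ] (Γ' : Subgroup Γ) (e : MonoidAlgebra ℚ Γ) :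
    Prop where
  central : e ∈ Subring.center (MonoidAlgebra ℚ Γ)
  idem : IsIdempotentElem e
  acts : ∀ v ∈ augSubmodule Γ', (Representation.ofMulAction ℚ Γ (Γ ⧸ Γ')).asAlgebraHom e v = v

theorem exists_augIdempotent {Γ : Type*} [Group Γ] [Finite Γ] (Γ' : Subgroup Γ) :
    ∃ e : MonoidAlgebra ℚ Γ, ActsAsOneOnAug Γ' e ∧ ∀ f, ActsAsOneOnAug Γ' f → e * f = e := by
  classical
  have hne : ∃ n : ℕ, ∃ e : MonoidAlgebra ℚ Γ, ActsAsOneOnAug Γ' e ∧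
      Module.finrank ℚ (LinearMap.range (LinearMap.mulLeft ℚ e)) = n :=
    ⟨_, 1, ⟨Subring.one_mem _, IsIdempotentElem.one, fun v _ => by simp⟩, rfl⟩
  obtain ⟨e, he, hen⟩ := Nat.find_spec hne
  refine ⟨e, he, fun f hf => ?_⟩
  have hcomm : ∀ z, z * f = f * z := fun z => (Subring.mem_center_iff.1 hf.central) z
  have hef : ActsAsOneOnAug Γ' (e * f) := by
    refine ⟨Subring.mul_mem _ he.central hf.central, ?_, fun v hv => ?_⟩
    · change e * f * (e * f) = e * f
      rw [mul_assoc, ← mul_assoc f, ← hcomm e, mul_assoc e f f, hf.idem.eq, ← mul_assoc,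
        he.idem.eq]
    · rw [map_mul, Module.End.mul_apply, hf.acts v hv, he.acts v hv]
  have : FiniteDimensional ℚ (MonoidAlgebra ℚ Γ) := inferInstance
  have hle : LinearMap.range (LinearMap.mulLeft ℚ (e * f)) ≤
      LinearMap.range (LinearMap.mulLeft ℚ e) := by
    rintro _ ⟨z, rfl⟩
    exact ⟨f * z, by simp⟩
  have heq := Submodule.eq_of_le_of_finrank_le hle (by
    rw [hen]
    exact Nat.find_min' hne ⟨_, hef, rfl⟩)
  have hmem : e ∈ LinearMap.range (LinearMap.mulLeft ℚ e) := ⟨1, by simp⟩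
  rw [← heq] at hmem
  obtain ⟨z, hz⟩ := hmem
  have hz' : e * f * z = e := hz
  calc e * f = e * f * z * f := by rw [hz']
    _ = e * (f * (z * f)) := by simp only [mul_assoc]
    _ = e * (f * f * z) := by rw [hcomm z, mul_assoc]
    _ = e * f * z := by rw [hf.idem.eq, ← mul_assoc]
    _ = e := hz'

/-- The central idempotent `e_{Γ/Γ'}` of `ℚ[Γ]` associated to the augmentation character
`a_{Γ/Γ'}`: the smallest central idempotent that acts as the identity on the representation with
that character. Here `e ≤ f` means `e * f = e`. -/
def augIdempotent {Γ : Type*} [Group Γ] [Finite Γ] (Γ' : Subgroup Γ) : MonoidAlgebra ℚ Γ :=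
  (exists_augIdempotent Γ').choose

theorem augIdempotent_spec {Γ : Type*} [Group Γ] [Finite Γ] (Γ' : Subgroup Γ) :
    ActsAsOneOnAug Γ' (augIdempotent Γ') ∧
      ∀ f, ActsAsOneOnAug Γ' f → augIdempotent Γ' * f = augIdempotent Γ' :=
  (exists_augIdempotent Γ').choose_spec

/-! ### Class groups of number fields -/

/-- The class group `Cl_K` of a number field. -/
abbrev Cl (K : Type*) [Field K] : Type _ := ClassGroup (𝓞 K)

/-- The map `i_* : Cl_K → Cl_L` induced by extension of ideals. -/
abbrev clExt (K L : Type*) [Field K] [Field L] [NumberField K] [NumberField L] [Algebra K L] :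
    Cl K →* Cl L :=
  ClassGroup.extendedHom (𝓞 K) (𝓞 L)

section Norm

variable (K₀ K : Type*) [Field K₀] [Field K] [NumberField K₀] [NumberField K] [Algebra K₀ K]

/-- The norm of a nonzero integral ideal. -/
def idealNorm : (Ideal (𝓞 K))⁰ →* (Ideal (𝓞 K₀))⁰ where
  toFun I := ⟨Ideal.relNorm (𝓞 K₀) (I : Ideal (𝓞 K)), by
    rw [mem_nonZeroDivisors_iff_ne_zero, Ideal.zero_eq_bot, Ne, Ideal.relNorm_eq_bot_iff]
    exact nonZeroDivisors.coe_ne_zero I⟩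
  map_one' := Subtype.ext (by simp)
  map_mul' I J := Subtype.ext (by simp)

theorem idealNorm_wd (I J : (Ideal (𝓞 K))⁰) (h : ClassGroup.mk0 I = ClassGroup.mk0 J) :
    ClassGroup.mk0 (idealNorm K₀ K I) = ClassGroup.mk0 (idealNorm K₀ K J) := by
  obtain ⟨x, y, hx, hy, hxy⟩ := ClassGroup.mk0_eq_mk0_iff.1 h
  refine ClassGroup.mk0_eq_mk0_iff.2 ⟨Algebra.intNorm (𝓞 K₀) (𝓞 K) x,
    Algebra.intNorm (𝓞 K₀) (𝓞 K) y, Algebra.intNorm_ne_zero.2 hx,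
    Algebra.intNorm_ne_zero.2 hy, ?_⟩
  have := congrArg (Ideal.relNorm (𝓞 K₀)) hxy
  rw [map_mul, map_mul, Ideal.relNorm_singleton, Ideal.relNorm_singleton] at this
  exact this

/-- The norm `Cl_K → Cl_{K₀}`, which sends the class of `I` to the class of the norm of `I`. -/
def clNorm : Cl K →* Cl K₀ where
  toFun c := ClassGroup.mk0 (idealNorm K₀ K (ClassGroup.mk0_surjective c).choose)
  map_one' := by
    rw [idealNorm_wd K₀ K _ 1, map_one, map_one]
    rw [(ClassGroup.mk0_surjective (1 : Cl K)).choose_spec, map_one]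
  map_mul' c d := by
    rw [← map_mul, ← map_mul]
    apply idealNorm_wd
    rw [map_mul, (ClassGroup.mk0_surjective (c * d)).choose_spec,
      (ClassGroup.mk0_surjective c).choose_spec, (ClassGroup.mk0_surjective d).choose_spec]

theorem clNorm_mk0 (I : (Ideal (𝓞 K))⁰) :
    clNorm K₀ K (ClassGroup.mk0 I) = ClassGroup.mk0 (idealNorm K₀ K I) :=
  idealNorm_wd K₀ K _ _ (ClassGroup.mk0_surjective (ClassGroup.mk0 I)).choose_spec

/-- The relative class group `Cl_{K|K₀}`: the ideal classes of `K` with trivial norm in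
`Cl_{K₀}`. -/
def relCl : Subgroup (Cl K) := (clNorm K₀ K).ker

/-- The `S`-part `Cl_{K|K₀}^S` of the relative class group, as a subgroup of `Cl_K`. -/
def relClS (S : Set Nat.Primes) : Subgroup (Cl K) :=
  (sPart S (relCl K₀ K)).map (relCl K₀ K).subtype

end Norm

section Galois

theorem clMulEquiv_mk0 {L : Type*} [Field L] [NumberField L] (g : 𝓞 L ≃+* 𝓞 L)
    (I J : (Ideal (𝓞 L))⁰) (h : (J : Ideal (𝓞 L)) = (I : Ideal (𝓞 L)).map g) :
    ClassGroup.mulEquiv g (ClassGroup.mk0 I) = ClassGroup.mk0 J := by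
  have key : FractionalIdeal.ringEquivOfRingEquiv (FractionRing (𝓞 L)) (FractionRing (𝓞 L)) g
      ((I : Ideal (𝓞 L)) : FractionalIdeal (𝓞 L)⁰ (FractionRing (𝓞 L))) =
      ((J : Ideal (𝓞 L)) : FractionalIdeal (𝓞 L)⁰ (FractionRing (𝓞 L))) := by
    ext x
    rw [FractionalIdeal.mem_coeIdeal, h, ← FractionalIdeal.mem_coe,
      FractionalIdeal.ringEquivOfRingEquiv_apply]
    change x ∈ Submodule.map _ _ ↔ _
    rw [Submodule.mem_map]
    constructor
    · rintro ⟨y, hy, rfl⟩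
      obtain ⟨z, hz, rfl⟩ := (FractionalIdeal.mem_coeIdeal _).1 hy
      exact ⟨g z, Ideal.mem_map_of_mem g hz,
        (IsFractionRing.ringEquivOfRingEquiv_algebraMap g z).symm⟩
    · rintro ⟨y, hy, rfl⟩
      obtain ⟨z, hz, rfl⟩ := (Ideal.mem_map_of_equiv g y).1 hy
      exact ⟨algebraMap _ _ z, (FractionalIdeal.mem_coeIdeal _).2 ⟨z, hz, rfl⟩,
        IsFractionRing.ringEquivOfRingEquiv_algebraMap g z⟩
  rw [ClassGroup.mulEquiv, MulEquiv.trans_apply, MulEquiv.trans_apply, MulEquiv.symm_apply_eq,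
    ClassGroup.equiv_mk0, ClassGroup.equiv_mk0]
  refine congrArg (QuotientGroup.mk' (toPrincipalIdeal (𝓞 L) (FractionRing (𝓞 L))).range) ?_
  exact Units.ext key

/-- The image of a nonzero ideal under an automorphism of the ring of integers. -/
def idealMap {L : Type*} [Field L] (g : 𝓞 L ≃+* 𝓞 L) (I : (Ideal (𝓞 L))⁰) :
    (Ideal (𝓞 L))⁰ :=
  ⟨(I : Ideal (𝓞 L)).map g, by
    rw [mem_nonZeroDivisors_iff_ne_zero, Ideal.zero_eq_bot, Ne,
      Ideal.map_eq_bot_iff_of_injective g.injective]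
    exact nonZeroDivisors.coe_ne_zero I⟩

/-- The action of `Gal(L/K₀)` on `Cl_L`: `σ` sends the class of `I` to the class of `σ(I)`. -/
def galCl (K₀ L : Type*) [Field K₀] [Field L] [NumberField L] [Algebra K₀ L] :
    (L ≃ₐ[K₀] L) →* MulAut (Cl L) where
  toFun σ := ClassGroup.mulEquiv (RingOfIntegers.mapRingEquiv σ.toRingEquiv)
  map_one' := by
    refine MulEquiv.ext fun c => ?_
    obtain ⟨I, rfl⟩ := ClassGroup.mk0_surjective c
    exact clMulEquiv_mk0 _ I I (Ideal.map_id _).symm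
  map_mul' σ τ := by
    refine MulEquiv.ext fun c => ?_
    obtain ⟨I, rfl⟩ := ClassGroup.mk0_surjective c
    rw [MulAut.mul_apply, clMulEquiv_mk0 _ I (idealMap _ I) rfl,
      clMulEquiv_mk0 _ I (idealMap _ I) rfl, clMulEquiv_mk0 _ (idealMap _ I) (idealMap _ _) rfl]
    refine congrArg ClassGroup.mk0 (Subtype.ext ?_)
    exact (Ideal.map_map (RingOfIntegers.mapRingEquiv τ.toRingEquiv : 𝓞 L →+* 𝓞 L)
      (RingOfIntegers.mapRingEquiv σ.toRingEquiv : 𝓞 L →+* 𝓞 L)).symm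

theorem galCl_mk0 (K₀ L : Type*) [Field K₀] [Field L] [NumberField L] [Algebra K₀ L]
    (σ : L ≃ₐ[K₀] L) (I : (Ideal (𝓞 L))⁰) : galCl K₀ L σ (ClassGroup.mk0 I) =
      ClassGroup.mk0 (idealMap (RingOfIntegers.mapRingEquiv σ.toRingEquiv) I) :=
  clMulEquiv_mk0 _ I _ rfl

end Galois

end

/-! Write `N` and `s` for the sums over `Γ'` and `Γ` in the group ring, `n` for the index of `Γ'`,
and `e` for `augIdempotent Γ'`. Since `e` kills `s` and fixes every `gN - N`, one has `eN = N -
s/n`. For a good prime `p` the coefficient `1 - 1/n` of `eN` must be `p`-integral, so `p ∤ n`. As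
`Nm ∘ i_*` is the `n`-th power map on `Cl_{K₀}`, part (i) follows.

For (ii), if no prime of `S` divided `|Γ'|`, one could average over `Γ'`; but good primes may divide
`|Γ'|`. The substitute is that a lattice over a maximal order is projective. For `eℤ_(p)[Γ/Γ']` this
says `N u N = e N` with `u` integral (`IsGoodPrime.exists_subgroupSum_mul_mul`). It comes from
`IsMaximalOrderIn.exists_eq_mul_mul`, which applies three times the criterion
`IsMaximalOrderIn.mem_of_forall_mul_mul_mem`, or its consequences: a full two-sided ideal `J` of a
maximal order `Λ` is all of `Λ` as soon as its inverse `{x | J x J ⊆ J}` is contained in `Λ`.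

Clearing denominators, combining the primes of `S` and adding a constant function gives nonnegative
integers `b γ` such that `B = ∑ b γ • γ` satisfies `N B N = M N + t s`, with `M` prime to `S`
(`exists_hecke_identity`). Applied to an ideal `I` of `K` this becomes `Nm_{L/K}(B · I𝓞_L) = I^M
(Nm_{K/K₀} I)^t` (`relNorm_prod_of_hecke_identity`). The identity is exact, because the powers
introduced in its proof cancel in the torsion-free group of ideals. Hence on relative classes
`Nm_{L/K} ∘ B ∘ i_*` is the `M`-th power map, which is invertible on `S`-parts, and `i_*` is
injective there.

For the image (`map_clExt_relClS`), `y = i_* c` satisfies `N B y = M y`, while `n(1 - e)N = s` kills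
`B y`; so `y = e y`. Conversely, a `Γ'`-fixed `y = e y` satisfies `M y = N e B y = i_*(Nm_{L/K}(e B
y))`, and `e B y` has trivial norm to `K₀` because `e` has augmentation `0`. -/

noncomputable section

/-! ### Arithmetic of `ℤ_S` and of the local ring `ℤ_(p)`. -/

section ZLoc

variable {S : Set Nat.Primes}

theorem ZLoc.mem_of_mul_eq {q : ℚ} {n a : ℤ} (hn : ∀ p ∈ S, ¬ ((p : ℕ) : ℤ) ∣ n)
    (h : q * n = a) : q ∈ ZLoc S := by
  intro p hp hd
  apply hn p hp
  have h1 : q.num * n = a * q.den := by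
    have h2 := Rat.mul_den_eq_num q
    have : (q.num * n : ℚ) = a * q.den := by rw [← h2, ← h]; ring
    exact_mod_cast this
  have h2 : ((p : ℕ) : ℤ) ∣ q.num * n := h1 ▸ (Int.natCast_dvd_natCast.2 hd).mul_left a
  refine (IsCoprime.dvd_of_dvd_mul_left ?_ h2)
  have h3 : IsCoprime (q.den : ℤ) q.num := by
    rw [Int.isCoprime_iff_gcd_eq_one, Int.gcd_comm]
    simpa [Int.gcd] using q.reduced
  exact h3.of_isCoprime_of_dvd_left (Int.natCast_dvd_natCast.2 hd)

theorem ZLoc.not_dvd_den (q : ZLoc S) : ∀ p ∈ S, ¬ ((p : ℕ) : ℤ) ∣ ((q : ℚ).den : ℤ) :=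
  fun p hp h => q.2 p hp (by exact_mod_cast h)

/-- `ℤ_S` is a localization of `ℤ`: an ideal is generated by the generator of its contraction, since
denominators are units. The noetherian property it implies makes submodules of orders finitely
generated. -/
instance ZLoc.isPrincipalIdealRing : IsPrincipalIdealRing (ZLoc S) where
  principal I := by
    obtain ⟨g, hg⟩ := IsPrincipalIdealRing.principal (I.comap (algebraMap ℤ (ZLoc S)))
    refine ⟨algebraMap ℤ (ZLoc S) g, le_antisymm (fun x hx => ?_) ?_⟩
    · have h1 : (x : ℚ).num ∈ I.comap (algebraMap ℤ (ZLoc S)) := by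
        rw [Ideal.mem_comap]
        have h2 : algebraMap ℤ (ZLoc S) (x : ℚ).num = ((x : ℚ).den : ZLoc S) * x :=
          Subtype.ext (by simp [mul_comm])
        rw [h2]
        exact I.mul_mem_left _ hx
      rw [hg] at h1
      obtain ⟨k, hk⟩ := Ideal.mem_span_singleton'.1 h1
      have hden : ((x : ℚ).den : ℚ) ≠ 0 := by exact_mod_cast (x : ℚ).den_nz
      refine Ideal.mem_span_singleton'.2 ⟨⟨k / (x : ℚ).den, ZLoc.mem_of_mul_eq (a := k)
        (ZLoc.not_dvd_den x) (by push_cast; field_simp)⟩, Subtype.ext ?_⟩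
      have h3 : ((k * g : ℤ) : ℚ) = (x : ℚ).num := by exact_mod_cast hk
      rw [← Rat.mul_den_eq_num (x : ℚ)] at h3
      push_cast at h3
      change (k / (x : ℚ).den : ℚ) * ((algebraMap ℤ (ZLoc S) g : ZLoc S) : ℚ) = x
      have h4 : ((algebraMap ℤ (ZLoc S) g : ZLoc S) : ℚ) = g := by simp
      rw [h4]
      field_simp
      linarith
    · refine (Ideal.span_singleton_le_iff_mem I).2 ?_
      have : g ∈ I.comap (algebraMap ℤ (ZLoc S)) := hg ▸ Ideal.mem_span_singleton_self g
      exact this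

theorem ZLoc.isUnit_of_not_dvd {q : ZLoc S} (hq : ∀ p ∈ S, ¬ ((p : ℕ) : ℤ) ∣ (q : ℚ).num)
    (h0 : q ≠ 0) : IsUnit q := by
  have hq0 : (q : ℚ) ≠ 0 := fun h => h0 (Subtype.ext h)
  refine IsUnit.of_mul_eq_one ⟨(q : ℚ)⁻¹, ZLoc.mem_of_mul_eq (a := (q : ℚ).den) hq ?_⟩
    (Subtype.ext (mul_inv_cancel₀ hq0))
  rw [← Rat.mul_den_eq_num (q : ℚ)]
  field_simp
  simp

variable {p : Nat.Primes}

theorem ZLoc.span_le_jacobson :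
    Ideal.span {((p : ℕ) : ZLoc {p})} ≤ (⊥ : Ideal (ZLoc {p})).jacobson := by
  rw [Ideal.span_singleton_le_iff_mem, Ideal.mem_jacobson_bot]
  intro y
  have hnum : ∀ q ∈ ({p} : Set Nat.Primes), ¬ ((q : ℕ) : ℤ) ∣
      ((((p : ℕ) : ZLoc {p}) * y + 1 : ZLoc {p}) : ℚ).num := by
    rintro q rfl hd
    set z : ZLoc {q} := ((q : ℕ) : ZLoc {q}) * y + 1 with hz
    have h1 : (z : ℚ) = (q : ℕ) * (y : ℚ) + 1 := by simp [hz]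
    have h2 : (z : ℚ).num * (y : ℚ).den = ((q : ℕ) * (y : ℚ).num + (y : ℚ).den) * (z : ℚ).den := by
      have h3 := Rat.mul_den_eq_num (z : ℚ)
      have h4 := Rat.mul_den_eq_num (y : ℚ)
      have : ((z : ℚ).num * (y : ℚ).den : ℚ) =
          ((q : ℕ) * (y : ℚ).num + (y : ℚ).den) * (z : ℚ).den := by
        rw [← h3, ← h4, h1]; ring
      exact_mod_cast this
    have hp := Nat.prime_iff_prime_int.1 q.2
    rcases hp.dvd_or_dvd (h2 ▸ hd.mul_right _) with h | h
    · exact ZLoc.not_dvd_den y q rfl ((dvd_add_right (dvd_mul_right _ _)).1 h)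
    · exact ZLoc.not_dvd_den z q rfl h
  refine ZLoc.isUnit_of_not_dvd hnum fun h0 => ?_
  apply hnum p rfl
  rw [h0]
  exact dvd_zero _

theorem ZLoc.finite_quotient :
    Finite (ZLoc {p} ⧸ Ideal.span {((p : ℕ) : ZLoc {p})}) := by
  have hp := p.2.pos
  refine Finite.of_surjective
    (fun c : Fin p => Ideal.Quotient.mk (Ideal.span {((p : ℕ) : ZLoc {p})}) ((c : ℕ) : ZLoc {p}))
    fun x => ?_
  obtain ⟨q, rfl⟩ := Ideal.Quotient.mk_surjective x
  have hcop : IsCoprime ((q : ℚ).den : ℤ) (p : ℕ) := by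
    rw [Nat.isCoprime_iff_coprime, Nat.coprime_comm]
    exact (Nat.Prime.coprime_iff_not_dvd p.2).2 (q.2 p rfl)
  obtain ⟨u, v, huv⟩ := hcop
  have hpz : ((p : ℕ) : ℤ) ≠ 0 := by exact_mod_cast hp.ne'
  -- `u` inverts the denominator modulo `p`, so `c` is the residue of `q` in `{0, …, p - 1}`.
  set c := ((q : ℚ).num * u) % (p : ℕ) with hc
  have hc0 : 0 ≤ c := Int.emod_nonneg _ hpz
  have hcp : c < (p : ℕ) := Int.emod_lt_of_pos _ (by exact_mod_cast hp)
  refine ⟨⟨c.toNat, by omega⟩, ?_⟩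
  rw [Ideal.Quotient.mk_eq_mk_iff_sub_mem, Ideal.mem_span_singleton']
  have hden : ((q : ℚ).den : ℚ) ≠ 0 := by exact_mod_cast (q : ℚ).den_nz
  refine ⟨⟨(-(((q : ℚ).num * u) / (p : ℕ) * (q : ℚ).den + (q : ℚ).num * v) : ℤ) / (q : ℚ).den,
    ZLoc.mem_of_mul_eq (ZLoc.not_dvd_den q) (div_mul_cancel₀ _ (by exact_mod_cast hden))⟩,
    Subtype.ext ?_⟩
  have h1 : c = (q : ℚ).num * u - (p : ℕ) * (((q : ℚ).num * u) / (p : ℕ)) := by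
    rw [hc, Int.emod_def]
  generalize ((q : ℚ).num * u) / (p : ℕ) = k at h1 ⊢
  have h2 : (((c.toNat : ℕ) : ZLoc {p}) : ℚ) = (c : ℤ) := by
    have : ((c.toNat : ℤ) : ℚ) = c := by rw [Int.toNat_of_nonneg hc0]
    rw [← this]
    rfl
  have h3 := Rat.mul_den_eq_num (q : ℚ)
  have h4 : (u * (q : ℚ).den + v * (p : ℕ) : ℚ) = 1 := by exact_mod_cast huv
  change ((-(k * (q : ℚ).den + (q : ℚ).num * v) : ℤ) / (q : ℚ).den : ℚ) *
    (((p : ℕ) : ZLoc {p}) : ℚ) = (((c.toNat : ℕ) : ZLoc {p}) : ℚ) - (q : ℚ)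
  rw [h2, h1, div_mul_eq_mul_div, div_eq_iff hden]
  push_cast
  rw [← h3]
  linear_combination (-(q : ℚ) * (q : ℚ).den) * h4

end ZLoc

/-! ### Proper ideals of a semiprimary ring. -/

section Semiprimary

/-- In a semiprimary ring, a proper two-sided ideal annihilates, modulo the radical, an element
that is not nilpotent. -/
theorem IsSemiprimaryRing.exists_mul_mem_jacobson {F : Type*} [Ring F] [IsSemiprimaryRing F]
    (J : Ideal F) (hJ : J ≠ ⊤) :
    ∃ f : F, (∀ j ∈ J, j * f ∈ Ring.jacobson F) ∧ ∀ n : ℕ, f ^ n ≠ 0 := by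
  let π := Ideal.Quotient.mk (Ring.jacobson F)
  -- Modulo the radical `J` is generated by an idempotent `ε`, and `f` lifts `1 - ε`. If `f` were
  -- nilpotent then `ε = 1`, and `J` would contain an element congruent to `1` modulo the radical.
  obtain ⟨ε, hε, hJε⟩ := IsSemisimpleRing.ideal_eq_span_idempotent (J.map π)
  obtain ⟨f, hf⟩ := Ideal.Quotient.mk_surjective (I := Ring.jacobson F) (1 - ε)
  refine ⟨f, fun j hj => ?_, fun n hn => ?_⟩
  · have h1 : π j ∈ J.map π := Ideal.mem_map_of_mem π hj
    rw [hJε] at h1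
    obtain ⟨s, hs⟩ := Ideal.mem_span_singleton'.1 h1
    rw [← Ideal.Quotient.eq_zero_iff_mem, map_mul, hf]
    change π j * _ = 0
    rw [← hs, mul_assoc, mul_sub, mul_one, hε.eq, sub_self, mul_zero]
  · have h1 : (1 - ε) ^ (n + 1) = 0 := by
      rw [← hf, ← map_pow, pow_succ, hn, zero_mul, map_zero]
    rw [hε.one_sub.pow_succ_eq, sub_eq_zero] at h1
    have h2 : (1 : F ⧸ Ring.jacobson F) ∈ J.map π := by
      rw [hJε, h1]; exact Ideal.mem_span_singleton_self ε
    obtain ⟨j, hj, hj1⟩ :=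
      (Ideal.mem_map_iff_of_surjective π Ideal.Quotient.mk_surjective).1 h2
    have h3 : j - 1 ∈ Ring.jacobson F := by
      rw [← Ideal.Quotient.eq_zero_iff_mem, map_sub, map_one, sub_eq_zero]
      exact hj1
    rw [← Ideal.jacobson_bot, Ideal.mem_jacobson_iff] at h3
    obtain ⟨z, hz⟩ := h3 1
    apply hJ
    rw [Ideal.eq_top_iff_one]
    have h4 : z * j = 1 := by
      have := (Submodule.mem_bot _).1 hz
      rw [mul_one, mul_sub, mul_one, sub_add_cancel, sub_eq_zero] at this
      exact this
    exact h4 ▸ J.mul_mem_left z hj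

end Semiprimary

/-! ### Full two-sided ideals of a maximal order. -/

section Orders

variable {A : Type*} [Ring A] [Algebra ℚ A]

theorem Submodule.FG.of_nsmul_mem {R : Subring ℚ} [IsNoetherianRing R] {Λ N : Submodule R A}
    (hΛ : Λ.FG) {n : ℕ} (hn : n ≠ 0) (h : ∀ x ∈ N, n • x ∈ Λ) : N.FG := by
  refine Submodule.fg_of_fg_map_injective (LinearMap.lsmul R A (n : R)) (fun x y hxy => ?_)
    (hΛ.of_le ?_)
  · have h1 : (n : R) • x = (n : R) • y := hxy
    rw [Nat.cast_smul_eq_nsmul, Nat.cast_smul_eq_nsmul, ← Nat.cast_smul_eq_nsmul ℚ,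
      ← Nat.cast_smul_eq_nsmul ℚ] at h1
    exact smul_right_injective A (r := (n : ℚ)) (by exact_mod_cast hn) h1
  · rintro _ ⟨x, hx, rfl⟩
    change (n : R) • x ∈ Λ
    rw [Nat.cast_smul_eq_nsmul]
    exact h x hx

variable {R : Subring ℚ} {e : A} {Λ : Submodule R A}

theorem IsOrderIn.left_mul (h : IsOrderIn R e Λ) (he : IsIdempotentElem e) {x : A} (hx : x ∈ Λ) :
    e * x = x := by
  rw [← h.mem_corner x hx, ← mul_assoc, ← mul_assoc, he.eq]

theorem IsOrderIn.right_mul (h : IsOrderIn R e Λ) (he : IsIdempotentElem e) {x : A}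
    (hx : x ∈ Λ) : x * e = x := by
  rw [← h.mem_corner x hx, mul_assoc, he.eq]

theorem IsOrderIn.exists_nsmul_mem (h : IsOrderIn R e Λ) (x : A) :
    ∃ n : ℕ, n ≠ 0 ∧ n • (e * x * e) ∈ Λ := by
  have hx := h.span_eq x
  refine Submodule.span_induction (p := fun y _ => ∃ n : ℕ, n ≠ 0 ∧ n • y ∈ Λ) (fun y hy =>
    ⟨1, one_ne_zero, by simpa using hy⟩) ⟨1, one_ne_zero, by simp⟩ ?_ ?_ hx
  · rintro y z _ _ ⟨n, hn, hy⟩ ⟨m, hm, hz⟩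
    refine ⟨n * m, mul_ne_zero hn hm, ?_⟩
    rw [nsmul_add]
    refine Λ.add_mem ?_ ?_
    · rw [mul_comm, mul_smul]; exact Λ.smul_of_tower_mem m hy
    · rw [mul_smul]; exact Λ.smul_of_tower_mem n hz
  · rintro q y _ ⟨n, hn, hy⟩
    refine ⟨n * q.den, mul_ne_zero hn q.den_nz, ?_⟩
    have : (n * q.den) • q • y = q.num • n • y := by
      rw [← Nat.cast_smul_eq_nsmul ℚ, ← Nat.cast_smul_eq_nsmul ℚ, ← Int.cast_smul_eq_zsmul ℚ,
        smul_smul, smul_smul, ← Rat.mul_den_eq_num q]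
      push_cast
      congr 1
      rw [Rat.mul_den_eq_num]
      rw [← Rat.mul_den_eq_num q]; ring
    rw [this]
    exact Λ.smul_of_tower_mem q.num hy

/-- A two-sided ideal `B` of the order `Λ` that spans the same `ℚ`-subspace as `Λ`. -/
structure IsFullIdealIn (R : Subring ℚ) (e : A) (Λ B : Submodule R A) : Prop where
  le : B ≤ Λ
  mul_left : ∀ x ∈ Λ, ∀ b ∈ B, x * b ∈ B
  mul_right : ∀ b ∈ B, ∀ x ∈ Λ, b * x ∈ B
  full : ∃ n : ℕ, n ≠ 0 ∧ n • e ∈ B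

theorem IsOrderIn.isFullIdealIn_self (h : IsOrderIn R e Λ) : IsFullIdealIn R e Λ Λ :=
  ⟨le_rfl, h.mul_mem, h.mul_mem, 1, one_ne_zero, by simpa using h.one_mem⟩

theorem IsFullIdealIn.mul {B C : Submodule R A} (he : IsIdempotentElem e)
    (hB : IsFullIdealIn R e Λ B) (hC : IsFullIdealIn R e Λ C) : IsFullIdealIn R e Λ (B * C) where
  le := Submodule.mul_le.2 fun b hb c hc => hC.le (hC.mul_left b (hB.le hb) c hc)
  mul_left x hx y hy := by
    induction hy using Submodule.mul_induction_on' with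
    | mem_mul_mem b hb c hc =>
      rw [← mul_assoc]
      exact Submodule.mul_mem_mul (hB.mul_left x hx b hb) hc
    | add y _ z _ h1 h2 => rw [mul_add]; exact Submodule.add_mem _ h1 h2
  mul_right y hy x hx := by
    induction hy using Submodule.mul_induction_on' with
    | mem_mul_mem b hb c hc =>
      rw [mul_assoc]
      exact Submodule.mul_mem_mul hb (hC.mul_right c hc x hx)
    | add y _ z _ h1 h2 => rw [add_mul]; exact Submodule.add_mem _ h1 h2
  full := by
    obtain ⟨n, hn, h1⟩ := hB.full
    obtain ⟨m, hm, h2⟩ := hC.full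
    refine ⟨n * m, mul_ne_zero hn hm, ?_⟩
    have : (n * m) • e = (n • e) * (m • e) := by
      rw [smul_mul_smul_comm, he.eq]
    rw [this]
    exact Submodule.mul_mem_mul h1 h2

theorem IsMaximalOrderIn.mem_of_isOrderIn {Λ' : Submodule R A} (hΛ : IsMaximalOrderIn R e Λ)
    (h : Λ ≤ Λ') (he : e ∈ Λ') (hmul : ∀ x ∈ Λ', ∀ y ∈ Λ', x * y ∈ Λ')
    (hcorner : ∀ x ∈ Λ', e * x * e = x) (hfg : Λ'.FG) : Λ' = Λ :=
  hΛ.2 Λ' ⟨he, hmul, hcorner, hfg, fun x => Submodule.span_mono h (hΛ.1.span_eq x)⟩ h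

variable [IsNoetherianRing R]

/-- The right multipliers of `B` form a ring containing `Λ`. It is finitely generated because `n • e
∈ B` forces `n` times it into `B ⊆ Λ`. So it is an order, and maximality makes it `Λ`. The next
lemma is the mirror image. -/
theorem IsMaximalOrderIn.mem_of_forall_mul_mem_right (he : IsIdempotentElem e)
    (hΛ : IsMaximalOrderIn R e Λ) {B : Submodule R A} (hB : IsFullIdealIn R e Λ B) {x : A}
    (hx : e * x * e = x) (h : ∀ b ∈ B, b * x ∈ B) : x ∈ Λ := by
  obtain ⟨n, hn, hne⟩ := hB.full
  let Λ' : Submodule R A :=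
    { carrier := {x | e * x * e = x ∧ ∀ b ∈ B, b * x ∈ B}
      add_mem' := fun {x y} hx hy => ⟨by rw [mul_add, add_mul, hx.1, hy.1], fun b hb => by
        rw [mul_add]; exact B.add_mem (hx.2 b hb) (hy.2 b hb)⟩
      zero_mem' := ⟨by simp, fun b _ => by simp⟩
      smul_mem' := fun r x hx => ⟨by rw [mul_smul_comm, smul_mul_assoc, hx.1], fun b hb => by
        rw [mul_smul_comm]; exact B.smul_mem r (hx.2 b hb)⟩ }
  have hle : Λ ≤ Λ' := fun x hx => ⟨hΛ.1.mem_corner x hx, fun b hb => hB.mul_right b hb x hx⟩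
  have := hΛ.mem_of_isOrderIn hle (hle hΛ.1.one_mem)
    (fun x hx y hy => ⟨by
      conv_rhs => rw [← hx.1, ← hy.1]
      conv_lhs => rw [← hx.1, ← hy.1]
      simp only [mul_assoc, he.eq]
      simp only [← mul_assoc, he.eq],
      fun b hb => by rw [← mul_assoc]; exact hy.2 _ (hx.2 b hb)⟩)
    (fun x hx => hx.1)
    (hΛ.1.fg.of_nsmul_mem hn fun x hx => by
      have h1 := hB.le (hx.2 _ hne)
      rwa [smul_mul_assoc, ← hx.1, ← mul_assoc, ← mul_assoc, he.eq, hx.1] at h1)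
  rw [← this]
  exact ⟨hx, h⟩

theorem IsMaximalOrderIn.mem_of_forall_mul_mem_left (he : IsIdempotentElem e)
    (hΛ : IsMaximalOrderIn R e Λ) {B : Submodule R A} (hB : IsFullIdealIn R e Λ B) {x : A}
    (hx : e * x * e = x) (h : ∀ b ∈ B, x * b ∈ B) : x ∈ Λ := by
  obtain ⟨n, hn, hne⟩ := hB.full
  let Λ' : Submodule R A :=
    { carrier := {x | e * x * e = x ∧ ∀ b ∈ B, x * b ∈ B}
      add_mem' := fun {x y} hx hy => ⟨by rw [mul_add, add_mul, hx.1, hy.1], fun b hb => by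
        rw [add_mul]; exact B.add_mem (hx.2 b hb) (hy.2 b hb)⟩
      zero_mem' := ⟨by simp, fun b _ => by simp⟩
      smul_mem' := fun r x hx => ⟨by rw [mul_smul_comm, smul_mul_assoc, hx.1], fun b hb => by
        rw [smul_mul_assoc]; exact B.smul_mem r (hx.2 b hb)⟩ }
  have hle : Λ ≤ Λ' := fun x hx => ⟨hΛ.1.mem_corner x hx, fun b hb => hB.mul_left x hx b hb⟩
  have := hΛ.mem_of_isOrderIn hle (hle hΛ.1.one_mem)
    (fun x hx y hy => ⟨by
      conv_rhs => rw [← hx.1, ← hy.1]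
      conv_lhs => rw [← hx.1, ← hy.1]
      simp only [mul_assoc, he.eq]
      simp only [← mul_assoc, he.eq],
      fun b hb => by rw [mul_assoc]; exact hx.2 _ (hy.2 b hb)⟩)
    (fun x hx => hx.1)
    (hΛ.1.fg.of_nsmul_mem hn fun x hx => by
      have h1 := hB.le (hx.2 _ hne)
      rwa [mul_smul_comm, ← hx.1, mul_assoc, he.eq, hx.1] at h1)
  rw [← this]
  exact ⟨hx, h⟩

/-- Let `J` be a full two-sided ideal of a maximal order `Λ` such that `J x J ⊆ J` implies `x ∈ Λ`.
If `B J C ⊆ q⁻¹ Λ`, then also `C B ⊆ q⁻¹ Λ`. -/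
theorem IsMaximalOrderIn.smul_mul_mem_of_smul_mul_mul_mem (he : IsIdempotentElem e)
    (hΛ : IsMaximalOrderIn R e Λ) {J : Submodule R A} (hJ : IsFullIdealIn R e Λ J)
    (H : ∀ x, e * x * e = x → (∀ j ∈ J, ∀ j' ∈ J, j * x * j' ∈ J) → x ∈ Λ)
    {B C : Submodule R A} (hB : IsFullIdealIn R e Λ B) (hC : C ≤ Λ) {q : ℚ}
    (h : ∀ x ∈ B * J * C, q • x ∈ Λ) : ∀ x ∈ C * B, q • x ∈ Λ := by
  have hcorner : ∀ x ∈ Λ, e * (q • x) * e = q • x := fun x hx => by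
    rw [mul_smul_comm, smul_mul_assoc, hΛ.1.mem_corner x hx]
  intro x hx
  induction hx using Submodule.mul_induction_on' with
  | mem_mul_mem c hc b hb =>
    have hcb := hΛ.1.mul_mem c (hC hc) b (hB.le hb)
    -- By `H` it is enough that `J (q c b) ⊆ Λ`. An element `q j c b` lies in `Λ` because it
    -- multiplies `B` into itself from the right: `b' (q j c b) = (q b' j c) b ∈ Λ B`.
    refine H _ (hcorner _ hcb) fun j hj j' hj' => hJ.mul_left _ ?_ j' hj'
    rw [mul_smul_comm]
    refine hΛ.mem_of_forall_mul_mem_right he hB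
      (hcorner _ (hΛ.1.mul_mem j (hJ.le hj) _ hcb)) fun b' hb' => ?_
    have h1 := h _ (Submodule.mul_mem_mul (Submodule.mul_mem_mul hb' hj) hc)
    have h2 := hB.mul_left _ h1 b hb
    rw [smul_mul_assoc] at h2
    rw [mul_smul_comm]
    simpa only [mul_assoc] using h2
  | add y _ z _ h1 h2 => rw [smul_add]; exact Λ.add_mem h1 h2

/-- Iterated rotation: each round deletes one factor `J` and carries one factor `Q` to the right
end, so a bound on `(J Q)^a D` passes to `D Q^a`. -/
theorem IsMaximalOrderIn.smul_mul_pow_mem (he : IsIdempotentElem e)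
    (hΛ : IsMaximalOrderIn R e Λ) {J : Submodule R A} (hJ : IsFullIdealIn R e Λ J)
    (H : ∀ x, e * x * e = x → (∀ j ∈ J, ∀ j' ∈ J, j * x * j' ∈ J) → x ∈ Λ)
    {Q : Submodule R A} (hQ : IsFullIdealIn R e Λ Q) {q : ℚ} (a : ℕ) :
    ∀ D : Submodule R A, IsFullIdealIn R e Λ D → (∀ x ∈ (J * Q) ^ a * D, q • x ∈ Λ) →
      ∀ x ∈ D * Q ^ a, q • x ∈ Λ := by
  induction a with
  | zero =>
    intro D _ h
    simpa using h
  | succ a ih =>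
    intro D hD h
    have hle : (J * Q) ^ a * D ≤ Λ := by
      clear h ih
      induction a with
      | zero => simpa using hD.le
      | succ a ih =>
        rw [pow_succ', mul_assoc]
        exact Submodule.mul_le.2 fun x hx y hy => hΛ.1.mul_mem x ((hJ.mul he hQ).le hx) y (ih hy)
    have hQle : Q * ((J * Q) ^ a * D) ≤ Λ :=
      Submodule.mul_le.2 fun x hx y hy => hΛ.1.mul_mem x (hQ.le hx) y (hle hy)
    -- The exchange with `B = Λ` deletes the leading `J`; a second exchange, with `B = Q`, moves the
    -- exposed `Q` behind `D`.
    have h1 : ∀ x ∈ Q * ((J * Q) ^ a * D) * Λ, q • x ∈ Λ := by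
      refine hΛ.smul_mul_mem_of_smul_mul_mul_mem he hJ H hΛ.1.isFullIdealIn_self hQle ?_
      intro x hx
      refine h x ?_
      have h2 : Λ * J ≤ J := Submodule.mul_le.2 fun x hx y hy => hJ.mul_left x hx y hy
      have h3 : Λ * J * (Q * ((J * Q) ^ a * D)) ≤ (J * Q) ^ (a + 1) * D := by
        rw [pow_succ', mul_assoc (J * Q), mul_assoc J Q]
        exact mul_le_mul' h2 le_rfl
      exact h3 hx
    have h2 : ∀ x ∈ Q * J * ((J * Q) ^ a * D), q • x ∈ Λ := by
      intro x hx
      have h3 : Q * J * ((J * Q) ^ a * D) ≤ Q * ((J * Q) ^ a * D) * Λ := by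
        have h4 : Q * J ≤ Q := Submodule.mul_le.2 fun x hx y hy => hQ.mul_right x hx y (hJ.le hy)
        refine (mul_le_mul' h4 le_rfl).trans fun y hy => ?_
        have h5 := Submodule.mul_mem_mul hy hΛ.1.one_mem
        rwa [hΛ.1.right_mul he (hQle hy)] at h5
      exact h1 x (h3 hx)
    have h3 := hΛ.smul_mul_mem_of_smul_mul_mul_mem he hJ H hQ hle h2
    rw [mul_assoc] at h3
    have h4 := ih (D * Q) (hD.mul he hQ) h3
    rwa [mul_assoc, ← pow_succ'] at h4

end Orders

/-! ### Reduction modulo `p`, and the triviality criterion for two-sided ideals. -/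

section OrderRing

variable {A : Type*} [Ring A] [Algebra ℚ A] {R : Subring ℚ} {e : A} {Λ : Submodule R A}

/-- The ring structure of an order in `eAe`, with identity `e`. -/
abbrev IsOrderIn.ring (h : IsOrderIn R e Λ) (he : IsIdempotentElem e) : Ring Λ :=
  { (inferInstance : AddCommGroup Λ) with
    mul := fun x y => ⟨x * y, h.mul_mem x x.2 y y.2⟩
    one := ⟨e, h.one_mem⟩
    left_distrib := fun x y z => Subtype.ext (mul_add (x : A) y z)
    right_distrib := fun x y z => Subtype.ext (add_mul (x : A) y z)
    zero_mul := fun x => Subtype.ext (zero_mul (x : A))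
    mul_zero := fun x => Subtype.ext (mul_zero (x : A))
    mul_assoc := fun x y z => Subtype.ext (mul_assoc (x : A) y z)
    one_mul := fun x => Subtype.ext (h.left_mul he x.2)
    mul_one := fun x => Subtype.ext (h.right_mul he x.2) }

variable {p : Nat.Primes} {Λ : Submodule (ZLoc {p}) A}

/-- An order over `ℤ_(p)` maps onto a finite ring, with kernel `pΛ`. -/
theorem IsOrderIn.exists_residue.{u} {A : Type u} [Ring A] [Algebra ℚ A] {e : A}
    {Λ : Submodule (ZLoc {p}) A} (h : IsOrderIn (ZLoc {p}) e Λ) (he : IsIdempotentElem e) :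
    ∃ (F : Type u) (_ : Ring F) (_ : Finite F) (π : Λ →+ F), Function.Surjective π ∧
      (∀ x y : Λ, π ⟨x * y, h.mul_mem x x.2 y y.2⟩ = π x * π y) ∧ π ⟨e, h.one_mem⟩ = 1 ∧
      ∀ x : Λ, π x = 0 ↔ ((p : ℕ) : ℚ)⁻¹ • (x : A) ∈ Λ := by
  let _ : Ring Λ := h.ring he
  have hp : ((p : ℕ) : ℚ) ≠ 0 := by exact_mod_cast p.2.pos.ne'
  let I : Ideal Λ :=
    { carrier := {x | ((p : ℕ) : ℚ)⁻¹ • (x : A) ∈ Λ}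
      add_mem' := fun {x y} hx hy => by
        change ((p : ℕ) : ℚ)⁻¹ • ((x : A) + y) ∈ Λ
        rw [smul_add]; exact Λ.add_mem hx hy
      zero_mem' := by
        change ((p : ℕ) : ℚ)⁻¹ • (0 : A) ∈ Λ
        rw [smul_zero]; exact Λ.zero_mem
      smul_mem' := fun x y hy => by
        change ((p : ℕ) : ℚ)⁻¹ • ((x : A) * y) ∈ Λ
        rw [← mul_smul_comm]; exact h.mul_mem x x.2 _ hy }
  have hI : I.IsTwoSided := ⟨fun {x} y hx => by
    change ((p : ℕ) : ℚ)⁻¹ • ((x : A) * y) ∈ Λ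
    rw [← smul_mul_assoc]; exact h.mul_mem _ hx y y.2⟩
  have hsmul : ∀ (r : ZLoc {p}) (x : Λ), x ∈ I → r • x ∈ I := fun r x hx => by
    change ((p : ℕ) : ℚ)⁻¹ • (r • (x : A)) ∈ Λ
    rw [smul_comm]; exact Λ.smul_mem r hx
  let I' : Submodule (ZLoc {p}) Λ :=
    { carrier := I, add_mem' := I.add_mem, zero_mem' := I.zero_mem, smul_mem' := hsmul }
  have hfin : Finite (Λ ⧸ I') := by
    have hfg : Module.Finite (ZLoc {p}) Λ := Module.Finite.iff_fg.2 h.fg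
    have htor : Module.IsTorsionBySet (ZLoc {p}) (Λ ⧸ I')
        (Ideal.span {((p : ℕ) : ZLoc {p})} : Set (ZLoc {p})) := by
      rw [Module.isTorsionBySet_span_singleton_iff]
      intro x
      obtain ⟨x, rfl⟩ := Submodule.Quotient.mk_surjective _ x
      change ((p : ℕ) : ZLoc {p}) • Submodule.Quotient.mk x = 0
      rw [← Submodule.Quotient.mk_smul, Submodule.Quotient.mk_eq_zero]
      change ((p : ℕ) : ℚ)⁻¹ • (((p : ℕ) : ZLoc {p}) • (x : A)) ∈ Λ
      rw [Nat.cast_smul_eq_nsmul, ← Nat.cast_smul_eq_nsmul ℚ, smul_smul, inv_mul_cancel₀ hp,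
        one_smul]
      exact x.2
    let _ := htor.module
    have := ZLoc.finite_quotient (p := p)
    have : Module.Finite (ZLoc {p} ⧸ Ideal.span {((p : ℕ) : ZLoc {p})}) (Λ ⧸ I') :=
      Module.Finite.of_restrictScalars_finite (ZLoc {p}) _ _
    exact Module.finite_of_finite (ZLoc {p} ⧸ Ideal.span {((p : ℕ) : ZLoc {p})})
  have hfin' : Finite (Λ ⧸ I) := by
    refine Finite.of_surjective (α := Λ ⧸ I') (Quotient.lift (fun x => Ideal.Quotient.mk I x)
      fun x y hxy => ?_) (fun y => ?_)
    · have h1 := (Submodule.quotientRel_def I').1 hxy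
      exact Ideal.Quotient.eq.2 h1
    · obtain ⟨y, rfl⟩ := Ideal.Quotient.mk_surjective y
      exact ⟨Submodule.Quotient.mk y, rfl⟩
  exact ⟨Λ ⧸ I, inferInstance, hfin', (Ideal.Quotient.mk I : Λ →+* Λ ⧸ I).toAddMonoidHom,
    Ideal.Quotient.mk_surjective, fun x y => map_mul (Ideal.Quotient.mk I) x y,
    map_one (Ideal.Quotient.mk I), fun x => Ideal.Quotient.eq_zero_iff_mem⟩

/-- A proper full two-sided ideal `J` of a maximal order has an inverse larger than `Λ`. Otherwise
pick `φ`, not nilpotent modulo `pΛ`, with `J φ` in the radical modulo `pΛ`, and let `Q` be the ideal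
of all elements that `J` multiplies there. Then `(J Q)^N ⊆ pΛ`, and rotation removes the factors
`J`: `Q^N ⊆ pΛ`, so `φ` is nilpotent modulo `pΛ`, a contradiction. -/
theorem IsMaximalOrderIn.mem_of_forall_mul_mul_mem (he : IsIdempotentElem e)
    (hΛ : IsMaximalOrderIn (ZLoc {p}) e Λ) {J : Submodule (ZLoc {p}) A}
    (hJ : IsFullIdealIn (ZLoc {p}) e Λ J)
    (H : ∀ x, e * x * e = x → (∀ j ∈ J, ∀ j' ∈ J, j * x * j' ∈ J) → x ∈ Λ) : e ∈ J := by
  by_contra heJ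
  have hp : ((p : ℕ) : ℚ) ≠ 0 := by exact_mod_cast p.2.pos.ne'
  obtain ⟨F, _, _, π, hsurj, hmul, hone, hker⟩ := hΛ.1.exists_residue he
  let JF : Ideal F :=
    { carrier := {y | ∃ x : Λ, (x : A) ∈ J ∧ π x = y}
      add_mem' := by
        rintro _ _ ⟨x, hx, rfl⟩ ⟨y, hy, rfl⟩
        exact ⟨x + y, J.add_mem hx hy, map_add _ _ _⟩
      zero_mem' := ⟨0, J.zero_mem, map_zero _⟩
      smul_mem' := by
        rintro c _ ⟨x, hx, rfl⟩
        obtain ⟨c, rfl⟩ := hsurj c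
        exact ⟨_, hJ.mul_left c c.2 x hx, hmul c x⟩ }
  have hJF : JF ≠ ⊤ := by
    intro htop
    obtain ⟨x, hx, hx1⟩ : (1 : F) ∈ JF := htop ▸ Submodule.mem_top
    have h1 : π (⟨e, hΛ.1.one_mem⟩ - x) = 0 := by rw [map_sub, hone, hx1, sub_self]
    rw [hker] at h1
    set y : A := ((p : ℕ) : ℚ)⁻¹ • ((⟨e, hΛ.1.one_mem⟩ - x : Λ) : A) with hy
    have h2 : e = x + ((p : ℕ) : ZLoc {p}) • y := by
      rw [Nat.cast_smul_eq_nsmul, ← Nat.cast_smul_eq_nsmul ℚ, hy, smul_smul, mul_inv_cancel₀ hp,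
        one_smul]
      simp
    apply heJ
    -- Nakayama: if `J` maps onto `Λ / pΛ`, then `Λ = J + pΛ`, hence `Λ = J`.
    refine Submodule.le_of_le_smul_of_le_jacobson_bot hΛ.1.fg ZLoc.span_le_jacobson ?_
      hΛ.1.one_mem
    intro z hz
    rw [← hΛ.1.left_mul he hz, h2, add_mul, smul_mul_assoc]
    exact Submodule.add_mem_sup (hJ.mul_right _ hx z hz)
      (Submodule.smul_mem_smul (Ideal.mem_span_singleton_self _) (hΛ.1.mul_mem y h1 z hz))
  obtain ⟨f, hf, hfn⟩ := IsSemiprimaryRing.exists_mul_mem_jacobson JF hJF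
  obtain ⟨N, hN⟩ := IsSemiprimaryRing.isNilpotent (R := F)
  obtain ⟨φ, rfl⟩ := hsurj f
  have hmul' : ∀ x (hx : x ∈ Λ) y (hy : y ∈ Λ), π ⟨x * y, hΛ.1.mul_mem x hx y hy⟩ =
      π ⟨x, hx⟩ * π ⟨y, hy⟩ := fun x hx y hy => hmul ⟨x, hx⟩ ⟨y, hy⟩
  -- elements of `Λ` that `J` multiplies into the radical
  let Q : Submodule (ZLoc {p}) A :=
    { carrier := {x | ∃ hx : x ∈ Λ, ∀ j ∈ JF, j * π ⟨x, hx⟩ ∈ Ring.jacobson F}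
      add_mem' := by
        rintro x y ⟨hx, hx'⟩ ⟨hy, hy'⟩
        refine ⟨Λ.add_mem hx hy, fun j hj => ?_⟩
        have : π ⟨x + y, Λ.add_mem hx hy⟩ = π ⟨x, hx⟩ + π ⟨y, hy⟩ :=
          map_add π ⟨x, hx⟩ ⟨y, hy⟩
        rw [this, mul_add]
        exact Ideal.add_mem _ (hx' j hj) (hy' j hj)
      zero_mem' := ⟨Λ.zero_mem, fun j _ => by
        have : π ⟨0, Λ.zero_mem⟩ = 0 := map_zero π
        rw [this, mul_zero]; exact Ideal.zero_mem _⟩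
      smul_mem' := by
        rintro r x ⟨hx, hx'⟩
        refine ⟨Λ.smul_mem r hx, fun j hj => ?_⟩
        have hre : r • e ∈ Λ := Λ.smul_mem r hΛ.1.one_mem
        have : (⟨r • x, Λ.smul_mem r hx⟩ : Λ) = ⟨x * (r • e), hΛ.1.mul_mem x hx _ hre⟩ :=
          Subtype.ext (by simp only [mul_smul_comm, hΛ.1.right_mul he hx])
        rw [this, hmul' x hx _ hre, ← mul_assoc]
        exact Ideal.mul_mem_right _ _ (hx' j hj) }
  have hQ : IsFullIdealIn (ZLoc {p}) e Λ Q := by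
    refine ⟨fun x hx => hx.1, ?_, ?_, p, p.2.pos.ne', ?_⟩
    · rintro x hx b ⟨hb, hb'⟩
      refine ⟨hΛ.1.mul_mem x hx b hb, fun j hj => ?_⟩
      rw [hmul' x hx b hb, ← mul_assoc]
      refine hb' _ ?_
      obtain ⟨j, hj, rfl⟩ := hj
      exact ⟨_, hJ.mul_right j hj x hx, hmul' j j.2 x hx⟩
    · rintro b ⟨hb, hb'⟩ x hx
      refine ⟨hΛ.1.mul_mem b hb x hx, fun j hj => ?_⟩
      rw [hmul' b hb x hx, ← mul_assoc]
      exact Ideal.mul_mem_right _ _ (hb' j hj)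
    · have hpe : (p : ℕ) • e ∈ Λ := Λ.smul_of_tower_mem _ hΛ.1.one_mem
      refine ⟨hpe, fun j _ => ?_⟩
      have : π ⟨(p : ℕ) • e, hpe⟩ = 0 := by
        rw [hker]
        change ((p : ℕ) : ℚ)⁻¹ • ((p : ℕ) • e) ∈ Λ
        rw [← Nat.cast_smul_eq_nsmul ℚ, smul_smul, inv_mul_cancel₀ hp, one_smul]
        exact hΛ.1.one_mem
      rw [this, mul_zero]; exact Ideal.zero_mem _
  have hφQ : (φ : A) ∈ Q := ⟨φ.2, hf⟩
  have hJQ : ∀ x ∈ J * Q, ∃ hx : x ∈ Λ, π ⟨x, hx⟩ ∈ Ring.jacobson F := by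
    intro x hx
    induction hx using Submodule.mul_induction_on' with
    | mem_mul_mem j hj q hq =>
      obtain ⟨hq, hq'⟩ := hq
      refine ⟨hΛ.1.mul_mem j (hJ.le hj) q hq, ?_⟩
      rw [hmul' j (hJ.le hj) q hq]
      exact hq' _ ⟨⟨j, hJ.le hj⟩, hj, rfl⟩
    | add y _ z _ h1 h2 =>
      obtain ⟨hy, hy'⟩ := h1
      obtain ⟨hz, hz'⟩ := h2
      exact ⟨Λ.add_mem hy hz, (map_add π ⟨y, hy⟩ ⟨z, hz⟩).symm ▸ Ideal.add_mem _ hy' hz'⟩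
  have hpow : ∀ n : ℕ, ∀ x ∈ (J * Q) ^ n * Λ, ∃ hx : x ∈ Λ,
      π ⟨x, hx⟩ ∈ Ring.jacobson F ^ n := by
    intro n
    induction n with
    | zero =>
      intro x hx
      rw [pow_zero, one_mul] at hx
      exact ⟨hx, by
        change _ ∈ (1 : Ideal F)
        rw [Ideal.one_eq_top]; exact Submodule.mem_top⟩
    | succ n ih =>
      intro x hx
      rw [pow_succ', mul_assoc] at hx
      induction hx using Submodule.mul_induction_on' with
      | mem_mul_mem j hj q hq =>
        obtain ⟨hj, hj'⟩ := hJQ j hj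
        obtain ⟨hq, hq'⟩ := ih q hq
        refine ⟨hΛ.1.mul_mem j hj q hq, ?_⟩
        rw [hmul' j hj q hq, Ideal.IsTwoSided.pow_succ]
        exact Ideal.mul_mem_mul hj' hq'
      | add y _ z _ h1 h2 =>
        obtain ⟨hy, hy'⟩ := h1
        obtain ⟨hz, hz'⟩ := h2
        exact ⟨Λ.add_mem hy hz, (map_add π ⟨y, hy⟩ ⟨z, hz⟩).symm ▸ Ideal.add_mem _ hy' hz'⟩
  have hzero := hΛ.smul_mul_pow_mem he hJ H hQ (q := ((p : ℕ) : ℚ)⁻¹) N Λ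
    hΛ.1.isFullIdealIn_self fun x hx => by
      obtain ⟨hx', hx''⟩ := hpow N x hx
      rw [hN] at hx''
      exact (hker ⟨x, hx'⟩).1 hx''
  have hφpow : ∀ n : ℕ, ∃ hx : e * (φ : A) ^ n ∈ Λ, π ⟨e * (φ : A) ^ n, hx⟩ = π φ ^ n := by
    intro n
    induction n with
    | zero => exact ⟨by simpa using hΛ.1.one_mem, by simp [hone]⟩
    | succ n ih =>
      obtain ⟨hx, hx'⟩ := ih
      have h1 : e * (φ : A) ^ (n + 1) = (e * (φ : A) ^ n) * φ := by rw [pow_succ, mul_assoc]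
      refine ⟨h1 ▸ hΛ.1.mul_mem _ hx φ φ.2, ?_⟩
      exact (congrArg π (Subtype.ext h1)).trans
        ((hmul' _ hx φ φ.2).trans (by rw [hx', pow_succ]))
  obtain ⟨hx, hx'⟩ := hφpow N
  apply hfn N
  rw [← hx', hker]
  exact hzero _ (Submodule.mul_mem_mul hΛ.1.one_mem (Submodule.pow_mem_pow Q hφQ N))

end OrderRing

/-! ### Projectivity over a maximal order, as von Neumann regularity of a quasi-idempotent. -/

section Regular

variable {A : Type*} [Ring A] [Algebra ℚ A]

theorem mul_eq_self_of_mem_mul_left {R : Subring ℚ} {e : A} {M N : Submodule R A}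
    (h : ∀ x ∈ M, e * x = x) {x : A} (hx : x ∈ M * N) : e * x = x := by
  induction hx using Submodule.mul_induction_on' with
  | mem_mul_mem a ha b _ => rw [← mul_assoc, h a ha]
  | add y _ z _ h1 h2 => rw [mul_add, h1, h2]

theorem mul_eq_self_of_mem_mul_right {R : Subring ℚ} {e : A} {M N : Submodule R A}
    (h : ∀ x ∈ N, x * e = x) {x : A} (hx : x ∈ M * N) : x * e = x := by
  induction hx using Submodule.mul_induction_on' with
  | mem_mul_mem a _ b hb => rw [mul_assoc, h b hb]
  | add y _ z _ h1 h2 => rw [add_mul, h1, h2]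

variable {p : Nat.Primes} {e : A} {Λ : Submodule (ZLoc {p}) A}

/-- The two-sided ideal `Λ w Λ`. -/
abbrev twoSidedSpan (Λ : Submodule (ZLoc {p}) A) (w : A) : Submodule (ZLoc {p}) A :=
  Λ * Λ.map (LinearMap.mulLeft (ZLoc {p}) w)

/-- The criterion is applied to `T = Λ w Λ`. If `T x T ⊆ T`, then `w b x` multiplies `T` into itself
from the left, so it lies in `Λ`. Being an eigenvector of `w`, it lies in `wΛ`. Thus `T x ⊆ T`, and
`x ∈ Λ`. -/
theorem IsMaximalOrderIn.mem_twoSidedSpan (he : IsIdempotentElem e)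
    (hΛ : IsMaximalOrderIn (ZLoc {p}) e Λ) {w : A} (hw : w ∈ Λ) {h : ℕ}
    (hww : w * w = h • w) (hL : ∀ z ∈ Λ, w * z = h • z → ∃ u ∈ Λ, z = w * u)
    (hfull : ∃ n : ℕ, n ≠ 0 ∧ n • e ∈ twoSidedSpan Λ w) : e ∈ twoSidedSpan Λ w := by
  have hT : IsFullIdealIn (ZLoc {p}) e Λ (twoSidedSpan Λ w) := by
    refine ⟨?_, ?_, ?_, hfull⟩
    · refine Submodule.mul_le.2 ?_
      rintro a ha _ ⟨b, hb, rfl⟩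
      exact hΛ.1.mul_mem a ha _ (hΛ.1.mul_mem w hw b hb)
    · intro x hx y hy
      induction hy using Submodule.mul_induction_on' with
      | mem_mul_mem a ha b hb =>
        rw [← mul_assoc]; exact Submodule.mul_mem_mul (hΛ.1.mul_mem x hx a ha) hb
      | add y _ z _ h1 h2 => rw [mul_add]; exact Submodule.add_mem _ h1 h2
    · intro y hy x hx
      induction hy using Submodule.mul_induction_on' with
      | mem_mul_mem a ha b hb =>
        obtain ⟨b, hb, rfl⟩ := hb
        rw [mul_assoc]
        exact Submodule.mul_mem_mul ha ⟨b * x, hΛ.1.mul_mem b hb x hx, (mul_assoc w b x).symm⟩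
      | add y _ z _ h1 h2 => rw [add_mul]; exact Submodule.add_mem _ h1 h2
  refine hΛ.mem_of_forall_mul_mul_mem he hT fun x hx hxT => ?_
  have hex : e * x = x := by rw [← hx, ← mul_assoc, ← mul_assoc, he.eq]
  have hxe : x * e = x := by rw [← hx, mul_assoc, he.eq]
  refine hΛ.mem_of_forall_mul_mem_right he hT hx fun t ht => ?_
  induction ht using Submodule.mul_induction_on' with
  | mem_mul_mem a ha b hb =>
    obtain ⟨b, hb, rfl⟩ := hb
    change a * (w * b) * x ∈ _
    have hwb : w * b ∈ twoSidedSpan Λ w := by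
      rw [← hΛ.1.left_mul he (hΛ.1.mul_mem w hw b hb)]
      exact Submodule.mul_mem_mul hΛ.1.one_mem ⟨b, hb, rfl⟩
    have h1 : w * b * x ∈ Λ := by
      refine hΛ.mem_of_forall_mul_mem_left he hT ?_ fun t' ht' => hxT _ hwb t' ht'
      rw [mul_assoc, mul_assoc (w * b), hxe, ← mul_assoc,
        hΛ.1.left_mul he (hΛ.1.mul_mem w hw b hb)]
    obtain ⟨u, hu, hu'⟩ := hL _ h1 (by
      rw [← mul_assoc, ← mul_assoc, hww, smul_mul_assoc, smul_mul_assoc])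
    rw [mul_assoc, hu']
    exact Submodule.mul_mem_mul ha ⟨u, hu, rfl⟩
  | add y _ z _ h1 h2 => rw [add_mul]; exact Submodule.add_mem _ h1 h2

/-- The corner order `{z ∈ εAε | h z ∈ Λ}`. -/
def cornerOrder (Λ : Submodule (ZLoc {p}) A) (ε : A) (h : ℕ) : Submodule (ZLoc {p}) A where
  carrier := {z | ε * z * ε = z ∧ h • z ∈ Λ}
  add_mem' := fun {x y} hx hy => ⟨by rw [mul_add, add_mul, hx.1, hy.1], by
    rw [nsmul_add]; exact Λ.add_mem hx.2 hy.2⟩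
  zero_mem' := ⟨by simp, by simp⟩
  smul_mem' := fun r x hx => ⟨by rw [mul_smul_comm, smul_mul_assoc, hx.1], by
    rw [smul_comm]; exact Λ.smul_mem r hx.2⟩

/-- With `wΛ` the full `h`-eigenlattice of `w`, the corner order is the endomorphism ring of `wΛ`.
Because `Λ w Λ = Λ`, enlarging it to `E'` would enlarge `Λ` to the order `Λ (w E') Λ`, contrary to
maximality. -/
theorem IsMaximalOrderIn.isMaximalOrderIn_cornerOrder (he : IsIdempotentElem e)
    (hΛ : IsMaximalOrderIn (ZLoc {p}) e Λ) {w ε : A} (hw : w ∈ Λ) {h : ℕ} (hh : h ≠ 0)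
    (hwε : w = h • ε) (hε : IsIdempotentElem ε)
    (hR : ∀ z ∈ Λ, z * w = h • z → ∃ u ∈ Λ, z = u * w)
    (hT : e ∈ twoSidedSpan Λ w) :
    IsMaximalOrderIn (ZLoc {p}) ε (cornerOrder Λ ε h) := by
  have hinj : ∀ {x y : A}, h • x = h • y → x = y := fun {x y} hxy => by
    rw [← Nat.cast_smul_eq_nsmul ℚ, ← Nat.cast_smul_eq_nsmul ℚ] at hxy
    exact smul_right_injective A (r := (h : ℚ)) (by exact_mod_cast hh) hxy
  have heε : e * ε = ε := hinj (by rw [← mul_smul_comm, ← hwε, hΛ.1.left_mul he hw])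
  have hεe : ε * e = ε := hinj (by rw [← smul_mul_assoc, ← hwε, hΛ.1.right_mul he hw])
  have hleft : ∀ {z : A}, ε * z * ε = z → ε * z = z := fun {z} hz => by
    rw [← hz, ← mul_assoc, ← mul_assoc, hε.eq]
  have hright : ∀ {z : A}, ε * z * ε = z → z * ε = z := fun {z} hz => by
    rw [← hz, mul_assoc, hε.eq]
  have hwl : ∀ {z : A}, ε * z * ε = z → w * z = h • z := fun {z} hz => by
    rw [hwε, smul_mul_assoc, hleft hz]
  have hwr : ∀ {z : A}, ε * z * ε = z → z * w = h • z := fun {z} hz => by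
    rw [hwε, mul_smul_comm, hright hz]
  have hεw : ε * w = w := by rw [hwε, mul_smul_comm, hε.eq]
  have hwε' : w * ε = w := by rw [hwε, smul_mul_assoc, hε.eq]
  have hone : ε ∈ cornerOrder Λ ε h := ⟨by rw [hε.eq, hε.eq], hwε ▸ hw⟩
  refine ⟨⟨hone, ?_, fun x hx => hx.1, hΛ.1.fg.of_nsmul_mem hh fun x hx => hx.2, ?_⟩, ?_⟩
  · intro x hx y hy
    refine ⟨by rw [← mul_assoc, hleft hx.1, mul_assoc, hright hy.1], ?_⟩
    obtain ⟨u, hu, hu'⟩ := hR _ hx.2 (by rw [smul_mul_assoc, hwr hx.1])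
    rw [← smul_mul_assoc, hu', mul_assoc, hwl hy.1]
    exact hΛ.1.mul_mem u hu _ hy.2
  · intro x
    obtain ⟨n, hn, hx⟩ := hΛ.1.exists_nsmul_mem (ε * x * ε)
    have h1 : e * (ε * x * ε) * e = ε * x * ε := by
      rw [← mul_assoc, ← mul_assoc, heε, mul_assoc, hεe]
    rw [h1] at hx
    have h2 : n • (ε * x * ε) ∈ cornerOrder Λ ε h := by
      refine ⟨?_, Λ.smul_of_tower_mem h hx⟩
      rw [mul_smul_comm, smul_mul_assoc, ← mul_assoc, ← mul_assoc, hε.eq, mul_assoc _ ε ε, hε.eq]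
    have h3 : ε * x * ε = (n : ℚ)⁻¹ • (n • (ε * x * ε)) := by
      rw [← Nat.cast_smul_eq_nsmul ℚ, smul_smul, inv_mul_cancel₀ (by exact_mod_cast hn), one_smul]
    rw [h3]
    exact Submodule.smul_mem _ _ (Submodule.subset_span h2)
  · intro E' hE' hle
    let V := E'.map (LinearMap.mulLeft (ZLoc {p}) w)
    have hVΛV : V * Λ * V ≤ V := by
      rw [mul_assoc]
      refine Submodule.mul_le.2 ?_
      rintro _ ⟨z, hz, rfl⟩ y hy
      induction hy using Submodule.mul_induction_on' with
      | mem_mul_mem c hc y hy =>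
        obtain ⟨z', hz', rfl⟩ := hy
        -- This is what makes `V = w E'` satisfy `V Λ V ⊆ V`: the middle factor `ε c w` already lies
        -- in the corner order, hence in `E'`.
        have h1 : ε * c * w ∈ cornerOrder Λ ε h := by
          refine ⟨by rw [← mul_assoc, ← mul_assoc, hε.eq, mul_assoc, hwε'], ?_⟩
          rw [← smul_mul_assoc, ← smul_mul_assoc, ← hwε]
          exact hΛ.1.mul_mem _ (hΛ.1.mul_mem w hw c hc) w hw
        refine ⟨z * (ε * c * w) * z', hE'.mul_mem _ (hE'.mul_mem z hz _ (hle h1)) z' hz', ?_⟩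
        change w * (z * (ε * c * w) * z') = w * z * (c * (w * z'))
        rw [← mul_assoc z, ← mul_assoc z, hright (hE'.mem_corner z hz)]
        simp only [mul_assoc]
      | add y _ y' _ h1 h2 => rw [mul_add]; exact Submodule.add_mem _ h1 h2
    have hΛΛ : Λ * Λ ≤ Λ := Submodule.mul_le.2 hΛ.1.mul_mem
    have hTle : twoSidedSpan Λ w ≤ Λ * V * Λ := by
      refine Submodule.mul_le.2 ?_
      rintro a ha _ ⟨b, hb, rfl⟩
      change a * (w * b) ∈ _
      rw [← hwε', ← mul_assoc]
      exact Submodule.mul_mem_mul (Submodule.mul_mem_mul ha ⟨ε, hE'.one_mem, rfl⟩) hb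
    have hΛ' : Λ * V * Λ = Λ := by
      refine hΛ.mem_of_isOrderIn ?_ (hTle hT) ?_ ?_ ?_
      · intro x hx
        have h1 : Λ * (Λ * V * Λ) ≤ Λ * V * Λ := by
          rw [← mul_assoc, ← mul_assoc]
          exact mul_le_mul' (mul_le_mul' hΛΛ le_rfl) le_rfl
        rw [← hΛ.1.right_mul he hx]
        exact h1 (Submodule.mul_mem_mul hx (hTle hT))
      · have h1 : Λ * V * Λ * (Λ * V * Λ) ≤ Λ * V * Λ :=
          calc Λ * V * Λ * (Λ * V * Λ) = Λ * (V * (Λ * Λ) * V) * Λ := by simp only [mul_assoc]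
            _ ≤ Λ * (V * Λ * V) * Λ := by gcongr
            _ ≤ Λ * V * Λ := by gcongr
        exact fun x hx y hy => h1 (Submodule.mul_mem_mul hx hy)
      · intro x hx
        rw [mul_eq_self_of_mem_mul_right (fun y hy => hΛ.1.right_mul he hy)
          (show e * x ∈ Λ * V * Λ from ?_)]
        · rw [mul_assoc] at hx
          exact mul_eq_self_of_mem_mul_left (fun y hy => hΛ.1.left_mul he hy) hx
        · rw [mul_assoc] at hx ⊢
          rwa [mul_eq_self_of_mem_mul_left (fun y hy => hΛ.1.left_mul he hy) hx]
      · exact (hΛ.1.fg.mul (hE'.fg.map _)).mul hΛ.1.fg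
    refine le_antisymm (fun z hz => ⟨hE'.mem_corner z hz, ?_⟩) hle
    have hz' := hE'.mem_corner z hz
    rw [← hwl hz', ← hΛ', ← hΛ.1.left_mul he hw]
    have h1 : e * w * z = e * (w * z) * e := by
      rw [mul_assoc, mul_assoc, mul_assoc w z e]
      conv_rhs => rw [← hright hz', mul_assoc z, hεe, hright hz']
    rw [h1]
    exact Submodule.mul_mem_mul (Submodule.mul_mem_mul hΛ.1.one_mem ⟨z, hz, rfl⟩) hΛ.1.one_mem

/-- In a maximal order `Λ`, a quasi-idempotent `w` that generates its left and right eigenspaces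
and whose two-sided ideal is full is von Neumann regular. -/
theorem IsMaximalOrderIn.exists_eq_mul_mul (he : IsIdempotentElem e)
    (hΛ : IsMaximalOrderIn (ZLoc {p}) e Λ) {w : A} (hw : w ∈ Λ) {h : ℕ} (hh : h ≠ 0)
    (hww : w * w = h • w) (hL : ∀ z ∈ Λ, w * z = h • z → ∃ u ∈ Λ, z = w * u)
    (hR : ∀ z ∈ Λ, z * w = h • z → ∃ u ∈ Λ, z = u * w)
    (hfull : ∃ n : ℕ, n ≠ 0 ∧ n • e ∈ twoSidedSpan Λ w) : ∃ u ∈ Λ, w = w * u * w := by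
  have hhQ : (h : ℚ) ≠ 0 := by exact_mod_cast hh
  have hinj : ∀ {x y : A}, h • x = h • y → x = y := fun {x y} hxy => by
    rw [← Nat.cast_smul_eq_nsmul ℚ, ← Nat.cast_smul_eq_nsmul ℚ] at hxy
    exact smul_right_injective A (r := (h : ℚ)) hhQ hxy
  obtain ⟨ε, hwε⟩ : ∃ ε : A, w = h • ε := ⟨(h : ℚ)⁻¹ • w, by
    rw [← Nat.cast_smul_eq_nsmul ℚ, smul_smul, mul_inv_cancel₀ hhQ, one_smul]⟩
  have hε : IsIdempotentElem ε := by
    rw [hwε, smul_mul_smul_comm, mul_smul] at hww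
    exact hinj (hinj hww)
  have hT := hΛ.mem_twoSidedSpan he hw hww hL hfull
  have hE := hΛ.isMaximalOrderIn_cornerOrder he hw hh hwε hε hR hT
  have heε : e * ε = ε := hinj (by rw [← mul_smul_comm, ← hwε, hΛ.1.left_mul he hw])
  have hεe : ε * e = ε := hinj (by rw [← smul_mul_assoc, ← hwε, hΛ.1.right_mul he hw])
  have hεw : ε * w = w := by rw [hwε, mul_smul_comm, hε.eq]
  have hwε' : w * ε = w := by rw [hwε, smul_mul_assoc, hε.eq]
  -- `J = εΛw` consists of the endomorphisms of `wΛ` that factor through `Λ`. The identity `ε` lies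
  -- in it exactly when `w = w u w` for some `u ∈ Λ`, so the criterion is applied to `J` in the
  -- corner order.
  let J : Submodule (ZLoc {p}) A :=
    Λ.map (LinearMap.mulRight (ZLoc {p}) w ∘ₗ LinearMap.mulLeft (ZLoc {p}) ε)
  have hJmem : ∀ c ∈ Λ, ε * c * w ∈ J := fun c hc => ⟨c, hc, rfl⟩
  have hJ : IsFullIdealIn (ZLoc {p}) ε (cornerOrder Λ ε h) J := by
    refine ⟨?_, ?_, ?_, h, hh, ?_⟩
    · rintro _ ⟨c, hc, rfl⟩
      change ε * c * w ∈ _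
      refine ⟨by rw [← mul_assoc, ← mul_assoc, hε.eq, mul_assoc, hwε'], ?_⟩
      rw [← smul_mul_assoc, ← smul_mul_assoc, ← hwε]
      exact hΛ.1.mul_mem _ (hΛ.1.mul_mem w hw c hc) w hw
    · rintro z hz _ ⟨c, hc, rfl⟩
      change z * (ε * c * w) ∈ J
      obtain ⟨v, hv, hv'⟩ := hL _ hz.2 (by
        rw [mul_smul_comm, hwε, smul_mul_assoc, hE.1.left_mul hε hz])
      have h1 : z = ε * v := hinj (by rw [hv', hwε, smul_mul_assoc])
      have h2 : z * (ε * c * w) = ε * (v * c) * w := by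
        rw [← mul_assoc, ← mul_assoc, hE.1.right_mul hε hz, h1, mul_assoc ε v c]
      rw [h2]
      exact hJmem _ (hΛ.1.mul_mem v hv c hc)
    · rintro _ ⟨c, hc, rfl⟩ z hz
      change ε * c * w * z ∈ J
      obtain ⟨u, hu, hu'⟩ := hR _ hz.2 (by
        rw [smul_mul_assoc, hwε, mul_smul_comm, hE.1.right_mul hε hz])
      have h1 : w * z = u * w := by
        rw [← hu', hwε, smul_mul_assoc, hE.1.left_mul hε hz]
      rw [mul_assoc, h1, ← mul_assoc, mul_assoc ε]
      exact hJmem _ (hΛ.1.mul_mem c hc u hu)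
    · rw [← hwε, ← hεw, ← hεe]
      exact hJmem e hΛ.1.one_mem
  have hmem : ε ∈ J := by
    refine hE.mem_of_forall_mul_mul_mem hε hJ fun x hx hxJ => ?_
    have hJx : ∀ j ∈ J, j * x ∈ cornerOrder Λ ε h := fun j hj => by
      refine hE.mem_of_forall_mul_mem_left hε hJ ?_ fun j' hj' => hxJ j hj j' hj'
      rw [← mul_assoc, hE.1.left_mul hε (hJ.le hj), mul_assoc, ← hx, mul_assoc (ε * x), hε.eq]
    refine hE.mem_of_forall_mul_mem_right hε hJ hx ?_
    rintro _ ⟨c, hc, rfl⟩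
    change ε * c * w * x ∈ J
    -- Inserting `e = ∑ a w b` splits `ε c w x` into terms `(ε c a w)(ε b w x)`. The first factor is
    -- in `J`, and the second is in the corner order by `hJx`.
    have key : ∀ t ∈ twoSidedSpan Λ w, ε * c * t * w * x ∈ J := by
      intro t ht
      induction ht using Submodule.mul_induction_on' with
      | mem_mul_mem a ha b hb =>
        obtain ⟨b, hb, rfl⟩ := hb
        change ε * c * (a * (w * b)) * w * x ∈ J
        have h1 : ε * c * (a * (w * b)) * w * x = ε * (c * a) * w * (ε * b * w * x) := by
          simp only [mul_assoc]
          rw [← mul_assoc w ε, hwε']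
        rw [h1]
        exact hJ.mul_right _ (hJmem _ (hΛ.1.mul_mem c hc a ha)) _ (hJx _ (hJmem b hb))
      | add y _ z _ h1 h2 =>
        rw [mul_add, add_mul, add_mul]; exact Submodule.add_mem _ h1 h2
    have h1 := key e hT
    rwa [mul_assoc ε c e, hΛ.1.right_mul he hc] at h1
  obtain ⟨u, hu, hu'⟩ := hmem
  refine ⟨u, hu, ?_⟩
  change ε * u * w = ε at hu'
  conv_lhs => rw [hwε, ← hu', ← smul_mul_assoc, ← smul_mul_assoc, ← hwε]

end Regular

/-! ### Central idempotents of a semisimple ring. -/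

section SemisimpleRing

/-- An idempotent generator of `I` as a left ideal is a right identity of `I`. It is also a left
identity: `y = x - f x` is killed by `I` on the left, yet `y = y c y` with `y c ∈ I`, so `y = 0`. A
two-sided identity of a two-sided ideal is central. -/
theorem IsSemisimpleRing.exists_central_idempotent {A : Type*} [Ring A] [IsSemisimpleRing A]
    (I : Ideal A) [I.IsTwoSided] :
    ∃ f ∈ I, IsIdempotentElem f ∧ (∀ x, f * x = x * f) ∧ ∀ x ∈ I, x * f = x := by
  obtain ⟨f, hf, hI⟩ := IsSemisimpleRing.ideal_eq_span_idempotent I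
  have hfI : f ∈ I := hI ▸ Ideal.mem_span_singleton_self f
  have hr : ∀ x ∈ I, x * f = x := fun x hx => by
    rw [hI] at hx
    obtain ⟨a, rfl⟩ := Ideal.mem_span_singleton'.1 hx
    rw [mul_assoc, hf.eq]
  have hl : ∀ x ∈ I, f * x = x := fun x hx => by
    set y := x - f * x with hy
    have hyI : y ∈ I := I.sub_mem hx (I.mul_mem_left f hx)
    have hay : ∀ a ∈ I, a * y = 0 := fun a ha => by
      rw [hy, mul_sub, ← mul_assoc, hr a ha, sub_self]
    obtain ⟨δ, hδ, hyδ⟩ := IsSemisimpleRing.ideal_eq_span_idempotent (Ideal.span {y})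
    obtain ⟨c, hc⟩ := Ideal.mem_span_singleton'.1
      (hyδ ▸ Ideal.mem_span_singleton_self δ : δ ∈ Ideal.span {y})
    obtain ⟨d, hd⟩ := Ideal.mem_span_singleton'.1
      (hyδ ▸ Ideal.mem_span_singleton_self y : y ∈ Ideal.span {δ})
    have h1 : y = y * c * y := by
      conv_lhs => rw [← hd, ← hδ.eq, ← mul_assoc, hd, ← hc, ← mul_assoc]
    rw [hay _ (I.mul_mem_right c hyI)] at h1
    rw [hy, sub_eq_zero] at h1
    exact h1.symm
  refine ⟨f, hfI, hf, fun x => ?_, hr⟩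
  rw [← hr (f * x) (I.mul_mem_right x hfI), mul_assoc, hl (x * f) (I.mul_mem_left x hfI)]

end SemisimpleRing

/-! ### Subgroup sums and functions constant on cosets. -/

section GroupRing

variable {Γ : Type*} [Group Γ]

theorem mem_range_groupRingIncl {R : Subring ℚ} {x : MonoidAlgebra ℚ Γ} :
    x ∈ (groupRingIncl R Γ).range ↔ ∀ g, x.coeff g ∈ R := by
  constructor
  · rintro ⟨y, rfl⟩ g
    have : (groupRingIncl R Γ y).coeff g = y.coeff g := MonoidAlgebra.coeff_mapAlgHom _ _ _
    change (groupRingIncl R Γ y).coeff g ∈ R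
    rw [this]
    exact (y.coeff g).2
  · intro h
    refine ⟨.ofCoeff (Finsupp.onFinset x.coeff.support (fun g => (⟨x.coeff g, h g⟩ : R))
      fun g hg => ?_), ?_⟩
    · rw [Finsupp.mem_support_iff]
      exact fun h0 => hg (Subtype.ext h0)
    · ext g
      exact MonoidAlgebra.coeff_mapAlgHom _ _ _

theorem groupRingIncl_injective (R : Subring ℚ) : Function.Injective (groupRingIncl R Γ) := by
  intro x y hxy
  ext g
  have h1 := congrArg (fun z => z.coeff g) hxy
  have h2 : ∀ z, (groupRingIncl R Γ z).coeff g = z.coeff g :=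
    fun z => MonoidAlgebra.coeff_mapAlgHom _ _ _
  simpa only [h2] using h1

variable (k : Type*) [CommRing k] (Γ' : Subgroup Γ) [Fintype Γ']

/-- The sum of the elements of a subgroup in the group ring. -/
def subgroupSum : MonoidAlgebra k Γ := ∑ σ : Γ', MonoidAlgebra.single (σ : Γ) 1

variable {k}

theorem coeff_subgroupSum_mul (x : MonoidAlgebra k Γ) (g : Γ) :
    (subgroupSum k Γ' * x).coeff g = ∑ σ : Γ', x.coeff (σ * g) := by
  rw [subgroupSum, Finset.sum_mul, MonoidAlgebra.coeff_sum, Finsupp.finsetSum_apply]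
  simp only [MonoidAlgebra.coeff_single_mul_apply, one_mul]
  exact Fintype.sum_equiv (Equiv.inv Γ') _ _ fun σ => by simp

theorem coeff_mul_subgroupSum (x : MonoidAlgebra k Γ) (g : Γ) :
    (x * subgroupSum k Γ').coeff g = ∑ σ : Γ', x.coeff (g * σ) := by
  rw [subgroupSum, Finset.mul_sum, MonoidAlgebra.coeff_sum, Finsupp.finsetSum_apply]
  simp only [MonoidAlgebra.coeff_mul_single_apply, mul_one]
  exact Fintype.sum_equiv (Equiv.inv Γ') _ _ fun σ => by simp

theorem coeff_subgroupSum [DecidablePred (· ∈ Γ')] (g : Γ) :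
    (subgroupSum k Γ').coeff g = if g ∈ Γ' then 1 else 0 := by
  classical
  rw [subgroupSum, MonoidAlgebra.coeff_sum, Finsupp.finsetSum_apply]
  simp only [MonoidAlgebra.coeff_single, Finsupp.single_apply]
  split_ifs with hg
  · rw [Finset.sum_eq_single ⟨g, hg⟩]
    · simp
    · intro b _ hb
      rw [if_neg]
      exact fun h => hb (Subtype.ext h)
    · simp
  · refine Finset.sum_eq_zero fun σ _ => ?_
    rw [if_neg]
    rintro rfl
    exact hg σ.2

theorem single_mul_subgroupSum {σ : Γ} (hσ : σ ∈ Γ') :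
    MonoidAlgebra.single σ 1 * subgroupSum k Γ' = subgroupSum k Γ' := by
  classical
  ext g
  rw [MonoidAlgebra.coeff_single_mul_apply, one_mul, coeff_subgroupSum, coeff_subgroupSum]
  simp only [Γ'.mul_mem_cancel_left (Γ'.inv_mem hσ)]

theorem subgroupSum_mul_subgroupSum :
    subgroupSum k Γ' * subgroupSum k Γ' = Fintype.card Γ' • subgroupSum k Γ' := by
  conv_lhs => lhs; rw [subgroupSum]
  rw [Finset.sum_mul, Finset.sum_congr rfl fun σ _ => single_mul_subgroupSum Γ' σ.2]
  simp

variable {Γ'}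

theorem coeff_mul_left_of_subgroupSum_mul {z : MonoidAlgebra ℚ Γ}
    (hz : subgroupSum ℚ Γ' * z = Fintype.card Γ' • z) {σ : Γ} (hσ : σ ∈ Γ') (g : Γ) :
    z.coeff (σ * g) = z.coeff g := by
  have h1 : ∀ g, (Fintype.card Γ' : ℚ) * z.coeff g = ∑ τ : Γ', z.coeff (τ * g) := fun g => by
    rw [← coeff_subgroupSum_mul, hz, MonoidAlgebra.coeff_smul, Finsupp.smul_apply,
      nsmul_eq_mul]
  have h0 : (Fintype.card Γ' : ℚ) ≠ 0 := by exact_mod_cast Fintype.card_ne_zero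
  apply mul_left_cancel₀ h0
  rw [h1, h1]
  exact Fintype.sum_equiv (Equiv.mulRight ⟨σ, hσ⟩) _ _ fun τ => by simp [mul_assoc]

theorem coeff_mul_right_of_mul_subgroupSum {z : MonoidAlgebra ℚ Γ}
    (hz : z * subgroupSum ℚ Γ' = Fintype.card Γ' • z) {σ : Γ} (hσ : σ ∈ Γ') (g : Γ) :
    z.coeff (g * σ) = z.coeff g := by
  have h1 : ∀ g, (Fintype.card Γ' : ℚ) * z.coeff g = ∑ τ : Γ', z.coeff (g * τ) := fun g => by
    rw [← coeff_mul_subgroupSum, hz, MonoidAlgebra.coeff_smul, Finsupp.smul_apply,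
      nsmul_eq_mul]
  have h0 : (Fintype.card Γ' : ℚ) ≠ 0 := by exact_mod_cast Fintype.card_ne_zero
  apply mul_left_cancel₀ h0
  rw [h1, h1]
  exact Fintype.sum_equiv (Equiv.mulLeft ⟨σ, hσ⟩) _ _ fun τ => by simp [mul_assoc]

/-- A function that is constant on left cosets is a coset sum. -/
theorem exists_sum_coset_eq {k : Type*} [AddCommMonoid k] (f : Γ → k)
    (hf : ∀ g, ∀ σ ∈ Γ', f (g * σ) = f g) :
    ∃ u : Γ → k, (∀ g, u g = f g ∨ u g = 0) ∧ ∀ g, ∑ σ : Γ', u (g * σ) = f g := by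
  classical
  refine ⟨fun g => if (g : Γ ⧸ Γ').out = g then f g else 0, fun g => ?_, fun g => ?_⟩
  · dsimp only
    split_ifs <;> simp
  · obtain ⟨τ, hτ⟩ := QuotientGroup.mk_out_eq_mul Γ' g
    rw [Finset.sum_eq_single τ]
    · have h1 : ((g * τ : Γ) : Γ ⧸ Γ') = g := QuotientGroup.mk_mul_of_mem g τ.2
      dsimp only
      rw [if_pos (by rw [h1, hτ]), hf g τ τ.2]
    · intro σ _ hσ
      dsimp only
      rw [if_neg]
      intro h
      rw [QuotientGroup.mk_mul_of_mem g σ.2, hτ] at h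
      exact hσ (Subtype.ext (mul_left_cancel h)).symm
    · simp

/-- The coefficients of `z` are constant on the cosets `gΓ'`; let `u` keep them at one
representative of each coset. Nothing is divided by `|Γ'|`, so integrality survives even when `p`
divides `|Γ'|`. -/
theorem exists_eq_mul_subgroupSum [Finite Γ] {R : Subring ℚ} {z : MonoidAlgebra ℚ Γ}
    (hzR : z ∈ (groupRingIncl R Γ).range) (hz : z * subgroupSum ℚ Γ' = Fintype.card Γ' • z) :
    ∃ u ∈ (groupRingIncl R Γ).range, z = u * subgroupSum ℚ Γ' := by
  obtain ⟨u, hu, hu'⟩ := exists_sum_coset_eq (Γ' := Γ') z.coeff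
    fun g σ hσ => coeff_mul_right_of_mul_subgroupSum hz hσ g
  rw [mem_range_groupRingIncl] at hzR
  refine ⟨.ofCoeff (Finsupp.equivFunOnFinite.symm u), mem_range_groupRingIncl.2 fun g => ?_, ?_⟩
  · change u g ∈ R
    rcases hu g with h | h <;> rw [h]
    exacts [hzR g, R.zero_mem]
  · ext g
    rw [coeff_mul_subgroupSum, ← hu' g]
    rfl

theorem exists_eq_subgroupSum_mul [Finite Γ] {R : Subring ℚ} {z : MonoidAlgebra ℚ Γ}
    (hzR : z ∈ (groupRingIncl R Γ).range) (hz : subgroupSum ℚ Γ' * z = Fintype.card Γ' • z) :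
    ∃ u ∈ (groupRingIncl R Γ).range, z = subgroupSum ℚ Γ' * u := by
  obtain ⟨u, hu, hu'⟩ := exists_sum_coset_eq (Γ' := Γ') (fun g => z.coeff g⁻¹)
    fun g σ hσ => by
      rw [mul_inv_rev]
      exact coeff_mul_left_of_subgroupSum_mul hz (Γ'.inv_mem hσ) _
  rw [mem_range_groupRingIncl] at hzR
  refine ⟨.ofCoeff (Finsupp.equivFunOnFinite.symm fun g => u g⁻¹),
    mem_range_groupRingIncl.2 fun g => ?_, ?_⟩
  · change u g⁻¹ ∈ R
    rcases hu g⁻¹ with h | h <;> rw [h]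
    exacts [hzR _, R.zero_mem]
  · ext g
    have h1 := hu' g⁻¹
    rw [inv_inv] at h1
    rw [coeff_subgroupSum_mul, ← h1]
    refine Fintype.sum_equiv (Equiv.inv Γ') _ _ fun σ => ?_
    change u _ = u _
    simp

end GroupRing

/-! ### The augmentation of a group ring. -/

section Augmentation

variable {Γ : Type*} [Group Γ]

/-- The augmentation `k[Γ] → k`. -/
def groupRingAug (k Γ : Type*) [CommRing k] [Group Γ] : MonoidAlgebra k Γ →ₐ[k] k :=
  MonoidAlgebra.lift k k Γ 1

@[simp]
theorem groupRingAug_single {k : Type*} [CommRing k] (g : Γ) (r : k) :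
    groupRingAug k Γ (MonoidAlgebra.single g r) = r := by
  simp [groupRingAug]

theorem groupRingAug_groupRingIncl {R : Subring ℚ} (x : MonoidAlgebra R Γ) :
    groupRingAug ℚ Γ (groupRingIncl R Γ x) = groupRingAug R Γ x := by
  induction x using MonoidAlgebra.induction_linear with
  | zero => simp
  | add x y hx hy => rw [map_add, map_add, hx, hy, map_add]; rfl
  | single g r =>
    have : groupRingIncl R Γ (MonoidAlgebra.single g r) = MonoidAlgebra.single g (r : ℚ) := by
      rw [groupRingIncl, MonoidAlgebra.mapAlgHom_single]
      rfl
    rw [this, groupRingAug_single, groupRingAug_single]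

variable {k : Type*} [CommRing k]

@[simp]
theorem groupRingAug_subgroupSum (Γ' : Subgroup Γ) [Fintype Γ'] :
    groupRingAug k Γ (subgroupSum k Γ') = Fintype.card Γ' := by
  rw [subgroupSum, map_sum]
  simp

variable [Fintype (⊤ : Subgroup Γ)]

theorem subgroupSum_top_mul (x : MonoidAlgebra k Γ) :
    subgroupSum k (⊤ : Subgroup Γ) * x = groupRingAug k Γ x • subgroupSum k (⊤ : Subgroup Γ) := by
  classical
  induction x using MonoidAlgebra.induction_linear with
  | zero => simp
  | add x y hx hy => rw [mul_add, hx, hy, map_add, add_smul]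
  | single g r =>
    rw [groupRingAug_single]
    ext h
    rw [MonoidAlgebra.coeff_mul_single_apply, MonoidAlgebra.coeff_smul, Finsupp.smul_apply,
      coeff_subgroupSum, coeff_subgroupSum]
    simp

theorem mul_subgroupSum_top (x : MonoidAlgebra k Γ) :
    x * subgroupSum k (⊤ : Subgroup Γ) = groupRingAug k Γ x • subgroupSum k (⊤ : Subgroup Γ) := by
  classical
  induction x using MonoidAlgebra.induction_linear with
  | zero => simp
  | add x y hx hy => rw [add_mul, hx, hy, map_add, add_smul]
  | single g r =>
    rw [groupRingAug_single]
    ext h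
    rw [MonoidAlgebra.coeff_single_mul_apply, MonoidAlgebra.coeff_smul, Finsupp.smul_apply,
      coeff_subgroupSum, coeff_subgroupSum]
    simp

end Augmentation

/-! ### The idempotent of the augmentation character. -/

section AugIdempotent

variable {Γ : Type*} [Group Γ] [Fintype Γ] (Γ' : Subgroup Γ)

/-- A function on `Γ/Γ'`, pulled back to `Γ`. -/
def cosetPullback : MonoidAlgebra ℚ (Γ ⧸ Γ') →ₗ[ℚ] MonoidAlgebra ℚ Γ where
  toFun v := .ofCoeff (Finsupp.equivFunOnFinite.symm fun g => v.coeff g)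
  map_add' v w := by ext g; rfl
  map_smul' r v := by ext g; rfl

theorem coeff_cosetPullback (v : MonoidAlgebra ℚ (Γ ⧸ Γ')) (g : Γ) :
    (cosetPullback Γ' v).coeff g = v.coeff g := rfl

theorem cosetPullback_injective : Function.Injective (cosetPullback Γ') := by
  intro v w hvw
  ext c
  obtain ⟨g, rfl⟩ := QuotientGroup.mk_surjective c
  rw [← coeff_cosetPullback, hvw, coeff_cosetPullback]

/-- Pullback embeds `ℚ[Γ/Γ']` as a left ideal, so acting as the identity on the augmentation
submodule becomes a multiplicative identity in `ℚ[Γ]`. -/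
theorem cosetPullback_asAlgebraHom (x : MonoidAlgebra ℚ Γ) (v : MonoidAlgebra ℚ (Γ ⧸ Γ')) :
    cosetPullback Γ' ((Representation.ofMulAction ℚ Γ (Γ ⧸ Γ')).asAlgebraHom x v) =
      x * cosetPullback Γ' v := by
  induction x using MonoidAlgebra.induction_linear with
  | zero => simp
  | add x y hx hy => rw [map_add, LinearMap.add_apply, map_add, hx, hy, add_mul]
  | single g r =>
    rw [Representation.asAlgebraHom_single, LinearMap.smul_apply, map_smul]
    ext h
    rw [MonoidAlgebra.coeff_smul, Finsupp.smul_apply, MonoidAlgebra.coeff_single_mul_apply,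
      coeff_cosetPullback, coeff_cosetPullback, smul_eq_mul]
    congr 1
    have h1 : ((h : Γ) : Γ ⧸ Γ') = g • ((g⁻¹ * h : Γ) : Γ ⧸ Γ') := by
      rw [MulAction.Quotient.smul_coe, smul_eq_mul, mul_inv_cancel_left]
    rw [h1]
    exact Finsupp.mapDomain_apply (MulAction.injective g) _ _

variable {Γ'}

theorem acts_iff_mul_cosetPullback {e : MonoidAlgebra ℚ Γ} {v : MonoidAlgebra ℚ (Γ ⧸ Γ')} :
    (Representation.ofMulAction ℚ Γ (Γ ⧸ Γ')).asAlgebraHom e v = v ↔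
      e * cosetPullback Γ' v = cosetPullback Γ' v := by
  rw [← cosetPullback_asAlgebraHom]
  exact (cosetPullback_injective Γ').eq_iff.symm

theorem augIdempotent_isIdempotentElem : IsIdempotentElem (augIdempotent Γ') :=
  (augIdempotent_spec Γ').1.idem

theorem augIdempotent_comm (x : MonoidAlgebra ℚ Γ) : x * augIdempotent Γ' = augIdempotent Γ' * x :=
  Subring.mem_center_iff.1 (augIdempotent_spec Γ').1.central x

theorem augIdempotent_mul_cosetPullback {v : MonoidAlgebra ℚ (Γ ⧸ Γ')}
    (hv : v ∈ augSubmodule Γ') :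
    augIdempotent Γ' * cosetPullback Γ' v = cosetPullback Γ' v :=
  acts_iff_mul_cosetPullback.1 ((augIdempotent_spec Γ').1.acts v hv)

variable [Fintype Γ']

theorem cosetPullback_mul_subgroupSum (v : MonoidAlgebra ℚ (Γ ⧸ Γ')) :
    cosetPullback Γ' v * subgroupSum ℚ Γ' = Fintype.card Γ' • cosetPullback Γ' v := by
  ext g
  rw [coeff_mul_subgroupSum, MonoidAlgebra.coeff_smul, Finsupp.smul_apply]
  simp only [coeff_cosetPullback]
  rw [Finset.sum_congr rfl fun σ _ => by rw [QuotientGroup.mk_mul_of_mem g σ.2]]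
  simp

theorem cosetPullback_single (g : Γ) :
    cosetPullback Γ' (MonoidAlgebra.single (g : Γ ⧸ Γ') 1) =
      MonoidAlgebra.single g 1 * subgroupSum ℚ Γ' := by
  classical
  ext h
  rw [coeff_cosetPullback, MonoidAlgebra.coeff_single_mul_apply, coeff_subgroupSum,
    MonoidAlgebra.coeff_single, Finsupp.single_apply, one_mul]
  simp only [QuotientGroup.eq]

theorem groupRingAug_cosetPullback {v : MonoidAlgebra ℚ (Γ ⧸ Γ')} (hv : v ∈ augSubmodule Γ') :
    groupRingAug ℚ Γ (cosetPullback Γ' v) = 0 := by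
  have h1 : (groupRingAug ℚ Γ).toLinearMap ∘ₗ cosetPullback Γ' = (Fintype.card Γ' : ℚ) •
      ((Finsupp.linearCombination ℚ fun _ : Γ ⧸ Γ' => (1 : ℚ)) ∘ₗ
        (MonoidAlgebra.coeffLinearEquiv ℚ).toLinearMap) := by
    ext c
    obtain ⟨g, rfl⟩ := QuotientGroup.mk_surjective c
    simp [cosetPullback_single]
  have h2 := LinearMap.congr_fun h1 v
  rw [LinearMap.smul_apply, LinearMap.mem_ker.1 hv, smul_zero] at h2
  exact h2

/-- The trivial character does not occur in the augmentation character. -/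
theorem groupRingAug_augIdempotent : groupRingAug ℚ Γ (augIdempotent Γ') = 0 := by
  classical
  set e := augIdempotent Γ' with he
  set s := subgroupSum ℚ (⊤ : Subgroup Γ) with hs
  set N : ℚ := ((Fintype.card (⊤ : Subgroup Γ) : ℕ) : ℚ) with hN
  have hN0 : N ≠ 0 := by simp [hN]
  have hidem : groupRingAug ℚ Γ e * groupRingAug ℚ Γ e = groupRingAug ℚ Γ e := by
    rw [← map_mul, augIdempotent_isIdempotentElem.eq]
  by_contra h0
  have h1 : groupRingAug ℚ Γ e = 1 := mul_left_cancel₀ h0 (by rw [hidem, mul_one])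
  have hes : e * s = s := by rw [mul_subgroupSum_top, h1, one_smul]
  have hse : s * e = s := by rw [subgroupSum_top_mul, h1, one_smul]
  have hss : s * s = N • s := by
    rw [hs, subgroupSum_top_mul, groupRingAug_subgroupSum]
  have hcomm : ∀ x, x * s = s * x := fun x => by
    rw [mul_subgroupSum_top, subgroupSum_top_mul]
  -- If `e` had augmentation `1`, its trivial component `s/|Γ|` could be removed, contradicting
  -- minimality.
  have hf : ActsAsOneOnAug Γ' (e - N⁻¹ • s) := by
    refine ⟨Subring.mem_center_iff.2 fun x => ?_, ?_, fun v hv => ?_⟩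
    · rw [mul_sub, sub_mul, augIdempotent_comm, mul_smul_comm, hcomm, smul_mul_assoc]
    · change (e - N⁻¹ • s) * (e - N⁻¹ • s) = e - N⁻¹ • s
      rw [mul_sub, sub_mul, sub_mul, mul_smul_comm, mul_smul_comm, smul_mul_assoc, smul_mul_assoc,
        hes, hse, hss, augIdempotent_isIdempotentElem.eq, smul_smul N⁻¹ N, inv_mul_cancel₀ hN0,
        one_smul, sub_self, sub_zero]
    · rw [acts_iff_mul_cosetPullback, sub_mul, augIdempotent_mul_cosetPullback hv, smul_mul_assoc,
        subgroupSum_top_mul, groupRingAug_cosetPullback hv, zero_smul, smul_zero, sub_zero]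
  have h2 := (augIdempotent_spec Γ').2 _ hf
  rw [← he, mul_sub, augIdempotent_isIdempotentElem.eq, mul_smul_comm, hes, sub_eq_self] at h2
  have h3 := congrArg (groupRingAug ℚ Γ) h2
  rw [map_smul, groupRingAug_subgroupSum, map_zero, smul_eq_mul, ← hN, inv_mul_cancel₀ hN0] at h3
  exact one_ne_zero h3

/-- Sum over `g ∈ Γ` the relations saying that `e` fixes `gN - N`, use `e s = 0`, and cancel `|Γ'|`.
-/
theorem augIdempotent_mul_subgroupSum [Fintype (⊤ : Subgroup Γ)] :
    Γ'.index • (augIdempotent Γ' * subgroupSum ℚ Γ') =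
      Γ'.index • subgroupSum ℚ Γ' - subgroupSum ℚ (⊤ : Subgroup Γ) := by
  classical
  set e := augIdempotent Γ' with he
  set s := subgroupSum ℚ (⊤ : Subgroup Γ) with hs
  have h1 : ∀ g : Γ, e * (MonoidAlgebra.single g 1 * subgroupSum ℚ Γ' - subgroupSum ℚ Γ') =
      MonoidAlgebra.single g 1 * subgroupSum ℚ Γ' - subgroupSum ℚ Γ' := by
    intro g
    have h2 : cosetPullback Γ' (MonoidAlgebra.single ((1 : Γ) : Γ ⧸ Γ') 1) = subgroupSum ℚ Γ' := by
      rw [cosetPullback_single, ← MonoidAlgebra.one_def, one_mul]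
    rw [← cosetPullback_single, ← h2, ← map_sub]
    refine augIdempotent_mul_cosetPullback ?_
    rw [augSubmodule, LinearMap.mem_ker]
    simp
  have h2 : ∑ g : Γ, (MonoidAlgebra.single g 1 * subgroupSum ℚ Γ' - subgroupSum ℚ Γ') =
      Fintype.card Γ' • s - Fintype.card Γ • subgroupSum ℚ Γ' := by
    rw [Finset.sum_sub_distrib, ← Finset.sum_mul, Finset.sum_const, Finset.card_univ]
    congr 1
    have h3 : ∑ g : Γ, MonoidAlgebra.single g (1 : ℚ) = s := by
      rw [hs, subgroupSum]
      exact Fintype.sum_equiv Subgroup.topEquiv.toEquiv.symm _ _ fun g => rfl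
    rw [h3, subgroupSum_top_mul, groupRingAug_subgroupSum, Nat.cast_smul_eq_nsmul]
  have h3 : e * (Fintype.card Γ' • s - Fintype.card Γ • subgroupSum ℚ Γ') =
      Fintype.card Γ' • s - Fintype.card Γ • subgroupSum ℚ Γ' := by
    rw [← h2, Finset.mul_sum]
    exact Finset.sum_congr rfl fun g _ => h1 g
  have hcard : Fintype.card Γ = Fintype.card Γ' * Γ'.index := by
    rw [← Nat.card_eq_fintype_card, ← Nat.card_eq_fintype_card, Subgroup.card_mul_index]
  rw [mul_sub, mul_smul_comm, mul_subgroupSum_top, groupRingAug_augIdempotent, zero_smul,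
    smul_zero, zero_sub, mul_smul_comm, hcard, mul_smul, mul_smul, ← smul_neg, ← smul_sub,
    ← Nat.cast_smul_eq_nsmul ℚ (Fintype.card Γ'), ← Nat.cast_smul_eq_nsmul ℚ (Fintype.card Γ')] at h3
  have h4 := smul_right_injective (MonoidAlgebra ℚ Γ) (r := (Fintype.card Γ' : ℚ))
    (by exact_mod_cast Fintype.card_ne_zero) h3
  rw [← neg_sub, ← h4, neg_neg]

/-- The two-sided ideal of `eN` is generated by a central idempotent `f`. It acts as the identity on
the augmentation submodule, whose pullback is contained in that ideal, so minimality gives `e = e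
f`. This makes `Λ(eN)Λ` a full ideal of `Λ = eℤ_(p)[Γ]`. -/
theorem augIdempotent_mem_span :
    augIdempotent Γ' ∈ Ideal.span
      (Set.range fun b => augIdempotent Γ' * subgroupSum ℚ Γ' * b) := by
  set e := augIdempotent Γ' with he
  set w := e * subgroupSum ℚ Γ' with hw
  let I := Ideal.span (Set.range fun b => w * b)
  have hI : I.IsTwoSided := ⟨fun {x} c hx => by
    induction hx using Submodule.span_induction with
    | mem x hx =>
      obtain ⟨b, rfl⟩ := hx
      exact Ideal.subset_span ⟨b * c, (mul_assoc _ _ _).symm⟩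
    | zero => rw [zero_mul]; exact I.zero_mem
    | add x y _ _ hx hy => rw [add_mul]; exact I.add_mem hx hy
    | smul a x _ hx => rw [smul_eq_mul, mul_assoc]; exact I.mul_mem_left a hx⟩
  obtain ⟨f, hfI, hf, hfc, hfx⟩ := IsSemisimpleRing.exists_central_idempotent I
  have hwI : w ∈ I := Ideal.subset_span ⟨1, mul_one w⟩
  have hact : ActsAsOneOnAug Γ' f := by
    refine ⟨Subring.mem_center_iff.2 fun x => (hfc x).symm, hf, fun v hv => ?_⟩
    rw [acts_iff_mul_cosetPullback, hfc]
    refine hfx _ ?_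
    have h1 : Fintype.card Γ' • cosetPullback Γ' v = cosetPullback Γ' v * w := by
      rw [hw, ← mul_assoc, augIdempotent_comm, augIdempotent_mul_cosetPullback hv,
        cosetPullback_mul_subgroupSum]
    have h2 : cosetPullback Γ' v = (Fintype.card Γ' : ℚ)⁻¹ • (cosetPullback Γ' v * w) := by
      rw [← h1, ← Nat.cast_smul_eq_nsmul ℚ, smul_smul,
        inv_mul_cancel₀ (by exact_mod_cast Fintype.card_ne_zero), one_smul]
    rw [h2, ← smul_mul_assoc]
    exact I.mul_mem_left _ hwI
  have h1 := (augIdempotent_spec Γ').2 f hact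
  have h2 : e * f ∈ I := I.mul_mem_left e hfI
  rwa [show e * f = e from h1] at h2

end AugIdempotent

/-! ### Consequences of goodness: the index, projectivity, the integral Hecke identity. -/

section GoodPrime

variable {Γ : Type*} [Group Γ] [Fintype Γ] {Γ' : Subgroup Γ} [Fintype Γ'] {p : Nat.Primes}

theorem coeff_index_mul_augIdempotent [DecidablePred (· ∈ Γ')] (g : Γ) :
    (Γ'.index : ℚ) * (augIdempotent Γ' * subgroupSum ℚ Γ').coeff g =
      Γ'.index * (if g ∈ Γ' then 1 else 0) - 1 := by
  classical
  have h := augIdempotent_mul_subgroupSum (Γ' := Γ')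
  rw [← Nat.cast_smul_eq_nsmul ℚ, ← Nat.cast_smul_eq_nsmul ℚ] at h
  replace h := congrArg (fun x => x.coeff g) h
  simp only [MonoidAlgebra.coeff_smul, MonoidAlgebra.coeff_sub, Finsupp.smul_apply,
    Finsupp.sub_apply, coeff_subgroupSum, smul_eq_mul] at h
  simpa using h

/-- A prime that is good for `e_{Γ/Γ'}` does not divide the index of `Γ'`. -/
theorem IsGoodPrime.not_dvd_index (hp : IsGoodPrime (augIdempotent Γ') p) :
    ¬ (p : ℕ) ∣ Γ'.index := by
  classical
  intro hd
  have h1 : augIdempotent Γ' * subgroupSum ℚ Γ' ∈ (groupRingIncl (ZLoc {p}) Γ).range := by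
    refine mul_mem hp.1 (mem_range_groupRingIncl.2 fun g => ?_)
    rw [coeff_subgroupSum]
    split_ifs
    exacts [one_mem _, zero_mem _]
  set q : ZLoc {p} := ⟨_, mem_range_groupRingIncl.1 h1 1⟩ with hq
  -- The coefficient of `eN` at the identity is `1 - 1/n`. If `p ∣ n`, then `p` would divide its
  -- denominator.
  have h2 := coeff_index_mul_augIdempotent (Γ' := Γ') 1
  rw [if_pos Γ'.one_mem, mul_one] at h2
  have h3 : (Γ'.index : ℚ) * (q : ℚ) = Γ'.index - 1 := h2
  rw [← mul_left_inj' (c := ((q : ℚ).den : ℚ)) (by exact_mod_cast (q : ℚ).den_nz), mul_assoc,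
    Rat.mul_den_eq_num] at h3
  have h4 : (Γ'.index : ℤ) * (q : ℚ).num = (Γ'.index - 1) * (q : ℚ).den := by exact_mod_cast h3
  have h5 : ((q : ℚ).den : ℤ) = Γ'.index * ((q : ℚ).den - (q : ℚ).num) := by
    rw [mul_sub, h4]; ring
  refine ZLoc.not_dvd_den q p rfl ?_
  rw [h5]
  exact (Int.natCast_dvd_natCast.2 hd).mul_right _

/-- If `p` is good for `e_{Γ/Γ'}`, then `e_{Γ/Γ'} ℤ_(p)[Γ/Γ']` is projective; that is, the
projection of `ℤ_(p)[Γ/Γ']` to it factors through `ℤ_(p)[Γ]`. -/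
theorem IsGoodPrime.exists_subgroupSum_mul_mul (hp : IsGoodPrime (augIdempotent Γ') p) :
    ∃ u ∈ (groupRingIncl (ZLoc {p}) Γ).range,
      subgroupSum ℚ Γ' * u * subgroupSum ℚ Γ' = augIdempotent Γ' * subgroupSum ℚ Γ' := by
  classical
  set e := augIdempotent Γ' with he
  set N := subgroupSum ℚ Γ' with hN
  set P := (groupRingIncl (ZLoc {p}) Γ).range with hP
  obtain ⟨heP, hmax⟩ := hp
  set Λ := (Subalgebra.toSubmodule P).map (LinearMap.mulLeft (ZLoc {p}) e) with hΛ
  have hidem : IsIdempotentElem e := augIdempotent_isIdempotentElem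
  have hcomm : ∀ x, x * e = e * x := augIdempotent_comm
  have hNP : N ∈ P := mem_range_groupRingIncl.2 fun g => by
    rw [hN, coeff_subgroupSum]
    split_ifs
    exacts [one_mem _, zero_mem _]
  have hmem : ∀ x ∈ P, e * x ∈ Λ := fun x hx => ⟨x, hx, rfl⟩
  have hΛP : ∀ x ∈ Λ, x ∈ P := by
    rintro _ ⟨x, hx, rfl⟩
    exact mul_mem heP hx
  have hel : ∀ x ∈ Λ, e * x = x := fun x hx => hmax.1.left_mul hidem hx
  have her : ∀ x ∈ Λ, x * e = x := fun x hx => hmax.1.right_mul hidem hx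
  have hNN : N * N = Fintype.card Γ' • N := subgroupSum_mul_subgroupSum Γ'
  have hww : e * N * (e * N) = Fintype.card Γ' • (e * N) := by
    rw [mul_assoc, ← mul_assoc N, hcomm, mul_assoc e N, hNN, ← mul_assoc, hidem.eq, mul_smul_comm]
  have hfull : ∃ n : ℕ, n ≠ 0 ∧ n • e ∈ twoSidedSpan Λ (e * N) := by
    have hTl : ∀ a ∈ Λ, ∀ t ∈ twoSidedSpan Λ (e * N), a * t ∈ twoSidedSpan Λ (e * N) := by
      intro a ha t ht
      induction ht using Submodule.mul_induction_on' with
      | mem_mul_mem b hb c hc =>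
        rw [← mul_assoc]; exact Submodule.mul_mem_mul (hmax.1.mul_mem a ha b hb) hc
      | add y _ z _ h1 h2 => rw [mul_add]; exact Submodule.add_mem _ h1 h2
    suffices h : ∃ n : ℕ, n ≠ 0 ∧ n • (e * e * e) ∈ twoSidedSpan Λ (e * N) by
      rwa [hidem.eq, hidem.eq] at h
    refine Submodule.span_induction
      (p := fun x _ => ∃ n : ℕ, n ≠ 0 ∧ n • (e * x * e) ∈ twoSidedSpan Λ (e * N))
      ?_ ⟨1, one_ne_zero, by simp⟩ ?_ ?_ (augIdempotent_mem_span (Γ' := Γ'))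
    · rintro _ ⟨b, rfl⟩
      obtain ⟨n, hn, hb⟩ := hmax.1.exists_nsmul_mem b
      refine ⟨n, hn, ?_⟩
      have h1 : n • (e * (e * N * b) * e) = e * (e * N * (n • (e * b * e))) := by
        rw [mul_smul_comm, mul_smul_comm]
        congr 1
        simp only [mul_assoc]
        rw [← mul_assoc N e, hcomm N, mul_assoc e N, ← mul_assoc e e (N * _), hidem.eq,
          ← mul_assoc e e (N * _), hidem.eq]
      change n • (e * (e * N * b) * e) ∈ _
      rw [h1]
      exact Submodule.mul_mem_mul hmax.1.one_mem ⟨_, hb, rfl⟩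
    · rintro x y _ _ ⟨n, hn, hx⟩ ⟨m, hm, hy⟩
      refine ⟨n * m, mul_ne_zero hn hm, ?_⟩
      rw [mul_add, add_mul, nsmul_add]
      refine Submodule.add_mem _ ?_ ?_
      · rw [mul_comm, mul_smul]; exact Submodule.smul_of_tower_mem _ m hx
      · rw [mul_smul]; exact Submodule.smul_of_tower_mem _ n hy
    · rintro a x _ ⟨n, hn, hx⟩
      obtain ⟨m, hm, ha⟩ := hmax.1.exists_nsmul_mem a
      refine ⟨m * n, mul_ne_zero hm hn, ?_⟩
      have h1 : (m * n) • (e * (a • x) * e) = (m • (e * a * e)) * (n • (e * x * e)) := by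
        rw [smul_mul_smul_comm, smul_eq_mul]
        congr 1
        simp only [mul_assoc]
        rw [← mul_assoc e e (x * e), hidem.eq, ← mul_assoc a e, hcomm a, mul_assoc e a,
          ← mul_assoc e e, hidem.eq]
      rw [h1]
      exact hTl _ ha _ hx
  -- Regularity for `w = eN`, `h = |Γ'|`: an eigenvector of `w` in `Λ` is an eigenvector of `N`, so
  -- it is an integral multiple of `N`. As `e` is central and `u = e u e`, the result `w = w u w`
  -- collapses to `e N = N u N`.
  obtain ⟨u, hu, huw⟩ := hmax.exists_eq_mul_mul (w := e * N) hidem (hmem N hNP)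
    (h := Fintype.card Γ') Fintype.card_ne_zero hww
    (fun z hz hwz => by
      rw [mul_assoc, ← hcomm, mul_assoc, her z hz] at hwz
      obtain ⟨v, hv, hv'⟩ := exists_eq_subgroupSum_mul (hΛP z hz) hwz
      refine ⟨e * v, hmem v hv, ?_⟩
      rw [mul_assoc, ← mul_assoc N, hcomm, mul_assoc e N, ← hv', hel z hz, hel z hz])
    (fun z hz hwz => by
      rw [← mul_assoc, her z hz] at hwz
      obtain ⟨v, hv, hv'⟩ := exists_eq_mul_subgroupSum (hΛP z hz) hwz
      refine ⟨e * v, hmem v hv, ?_⟩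
      rw [mul_assoc, ← mul_assoc v, hcomm v, mul_assoc e v, ← hv', hel z hz, hel z hz])
    hfull
  refine ⟨u, hΛP u hu, ?_⟩
  conv_lhs => rw [← hmax.1.mem_corner u hu]
  rw [huw, ← hcomm N]
  simp only [mul_assoc]
  rw [← mul_assoc N e (u * _), hcomm N, mul_assoc e N]
  rw [← mul_assoc e N, ← hcomm N, mul_assoc N e]

/-- The projectivity of `e_{Γ/Γ'} ℤ_S[Γ/Γ']` as an identity between integral functions on `Γ`. -/
theorem exists_hecke_identity {S : Set Nat.Primes}
    (hS : ∀ p ∈ S, IsGoodPrime (augIdempotent Γ') p) [DecidablePred (· ∈ Γ')] :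
    ∃ (b : Γ → ℕ) (M t : ℕ), (∀ p ∈ S, ¬ (p : ℕ) ∣ M) ∧
      ∀ g, ∑ σ : Γ', ∑ τ : Γ', b (σ * g * τ) = (if g ∈ Γ' then M else 0) + t := by
  classical
  have hn : (Γ'.index : ℤ) ≠ 0 := by exact_mod_cast Γ'.index_ne_zero_of_finite
  -- The integers `m` for which `m (eN) = N β N` has an integral solution `β`. For each `p ∈ S` this
  -- group contains a number prime to `p`, so its generator is prime to all of `S` at once, even for
  -- infinite `S`.
  let 𝔐 : AddSubgroup ℤ :=
    { carrier := {m | ∃ β : Γ → ℤ, ∀ g, (Γ'.index : ℤ) * ∑ σ : Γ', ∑ τ : Γ', β (σ * g * τ) =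
        m * (Γ'.index * (if g ∈ Γ' then 1 else 0) - 1)}
      add_mem' := by
        rintro m m' ⟨β, hβ⟩ ⟨β', hβ'⟩
        refine ⟨β + β', fun g => ?_⟩
        rw [add_mul, ← hβ, ← hβ', ← mul_add, ← Finset.sum_add_distrib]
        simp only [Pi.add_apply, Finset.sum_add_distrib]
      zero_mem' := ⟨0, fun g => by simp⟩
      neg_mem' := by
        rintro m ⟨β, hβ⟩
        exact ⟨-β, fun g => by rw [neg_mul, ← hβ]; simp⟩ }
  have hprime : ∀ p ∈ S, ∃ d ∈ 𝔐, ¬ ((p : ℕ) : ℤ) ∣ d := by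
    intro p hp
    obtain ⟨u, hu, huN⟩ := (hS p hp).exists_subgroupSum_mul_mul
    rw [mem_range_groupRingIncl] at hu
    refine ⟨((∏ g : Γ, (u.coeff g).den : ℕ) : ℤ), ⟨fun g => (∏ h ∈ Finset.univ.erase g,
      ((u.coeff h).den : ℤ)) * (u.coeff g).num, fun g => ?_⟩, fun hd => ?_⟩
    · have h1 : ∀ g : Γ, (((∏ h ∈ Finset.univ.erase g, ((u.coeff h).den : ℤ)) *
          (u.coeff g).num : ℤ) : ℚ) = ((∏ g : Γ, (u.coeff g).den : ℕ) : ℚ) * u.coeff g := by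
        intro g
        rw [← Finset.mul_prod_erase _ _ (Finset.mem_univ g)]
        push_cast
        rw [← Rat.mul_den_eq_num (u.coeff g)]
        ring
      have h2 : (augIdempotent Γ' * subgroupSum ℚ Γ').coeff g =
          ∑ σ : Γ', ∑ τ : Γ', u.coeff (σ * g * τ) := by
        rw [← huN, coeff_mul_subgroupSum]
        simp only [coeff_subgroupSum_mul]
        rw [Finset.sum_comm]
        simp only [mul_assoc]
      have h3 := coeff_index_mul_augIdempotent (Γ' := Γ') g
      rw [h2] at h3
      have h4 : ((Γ'.index * ∑ σ : Γ', ∑ τ : Γ', ((∏ h ∈ Finset.univ.erase ((σ : Γ) * g * τ),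
          ((u.coeff h).den : ℤ)) * (u.coeff ((σ : Γ) * g * τ)).num) : ℤ) : ℚ) =
          ((∏ g : Γ, (u.coeff g).den : ℕ) : ℚ) * (Γ'.index * (if g ∈ Γ' then 1 else 0) - 1) := by
        rw [← h3, Int.cast_mul, Int.cast_sum]
        simp only [Int.cast_sum, h1, ← Finset.mul_sum]
        push_cast
        ring
      rw [← Int.cast_inj (α := ℚ), h4]
      push_cast
      simp
    · rw [Int.natCast_dvd_natCast, Prime.dvd_finsetProd_iff p.2.prime] at hd
      obtain ⟨g, _, hg⟩ := hd
      exact hu g p rfl hg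
  obtain ⟨γ, hγ⟩ := Int.subgroup_cyclic 𝔐
  rw [← AddSubgroup.zmultiples_eq_closure] at hγ
  have hγM : (γ.natAbs : ℤ) ∈ 𝔐 := by
    rw [hγ]
    rcases Int.natAbs_eq γ with h | h
    · rw [← h]; exact AddSubgroup.mem_zmultiples γ
    · rw [← neg_eq_iff_eq_neg.2 h]; exact neg_mem (AddSubgroup.mem_zmultiples γ)
  obtain ⟨β, hβ⟩ := hγM
  -- Evaluation at `g = 1` shows `n ∣ M`, so `M eN = M N - M' s` with `M' = M / n` an integer.
  have hdvd : (Γ'.index : ℤ) ∣ γ.natAbs := by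
    have h1 := hβ 1
    rw [if_pos Γ'.one_mem, mul_one] at h1
    have h2 : (γ.natAbs : ℤ) = Γ'.index *
        (γ.natAbs - ∑ σ : Γ', ∑ τ : Γ', β (σ * 1 * τ)) := by
      rw [mul_sub, h1]; ring
    exact ⟨_, h2⟩
  obtain ⟨M', hM'⟩ := hdvd
  have hβ' : ∀ g, ∑ σ : Γ', ∑ τ : Γ', β (σ * g * τ) =
      γ.natAbs * (if g ∈ Γ' then 1 else 0) - M' := by
    intro g
    apply mul_left_cancel₀ hn
    rw [hβ g, mul_sub, mul_sub, ← hM']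
    ring
  have hM'0 : 0 ≤ M' := by
    by_contra hneg
    have : (Γ'.index : ℤ) * M' < 0 :=
      mul_neg_of_pos_of_neg (lt_of_le_of_ne (by positivity) hn.symm) (not_le.1 hneg)
    omega
  -- Adding `k` to `β` makes it nonnegative and adds `|Γ'|² k` to every double coset sum, which also
  -- absorbs `-M'`. Natural exponents let the identity act on integral ideals.
  set k : ℤ := ∑ g, |β g| + M' with hk
  have hkβ : ∀ g, 0 ≤ β g + k := by
    intro g
    have h1 : |β g| ≤ ∑ g, |β g| :=
      Finset.single_le_sum (f := fun g => |β g|) (fun _ _ => abs_nonneg _) (Finset.mem_univ g)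
    have h2 := neg_abs_le (β g)
    omega
  have hkM : 0 ≤ (Fintype.card Γ' : ℤ) * ((Fintype.card Γ' : ℤ) * k) - M' := by
    have h1 : 0 ≤ ∑ g, |β g| := Finset.sum_nonneg fun _ _ => abs_nonneg _
    have h2 : (1 : ℤ) ≤ Fintype.card Γ' := by exact_mod_cast Fintype.card_pos
    nlinarith [mul_nonneg (sub_nonneg.2 h2) (show 0 ≤ k by omega),
      mul_nonneg (sub_nonneg.2 h2) (mul_nonneg (sub_nonneg.2 h2) (show 0 ≤ k by omega))]
  refine ⟨fun g => (β g + k).toNat, γ.natAbs,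
    ((Fintype.card Γ' : ℤ) * ((Fintype.card Γ' : ℤ) * k) - M').toNat, ?_, fun g => ?_⟩
  · intro p hp hd
    obtain ⟨d, hd1, hd2⟩ := hprime p hp
    rw [hγ, AddSubgroup.mem_zmultiples_iff] at hd1
    obtain ⟨c, rfl⟩ := hd1
    exact hd2 ((Int.natCast_dvd.2 hd).mul_left c)
  · zify
    simp only [Int.toNat_of_nonneg (hkβ _), Int.toNat_of_nonneg hkM, Finset.sum_add_distrib, hβ',
      Finset.sum_const, Finset.card_univ, nsmul_eq_mul]
    split_ifs <;> push_cast <;> ring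

end GoodPrime

/-! ### The Hecke identity in multiplicative form. -/

section HeckeProduct

/-- A Hecke identity between integral functions on `Γ`, applied to a `Γ'`-invariant element of a
commutative monoid with `Γ`-action. -/
theorem prod_pow_eq_of_hecke_identity {Γ M : Type*} [Group Γ] [Fintype Γ] [CommMonoid M]
    (act : Γ →* Monoid.End M) {Γ' : Subgroup Γ} [Fintype Γ'] [DecidablePred (· ∈ Γ')] {J : M}
    (hJ : ∀ τ ∈ Γ', act τ J = J) {b : Γ → ℕ} {m t : ℕ}
    (hb : ∀ g, ∑ σ : Γ', ∑ τ : Γ', b (σ * g * τ) = (if g ∈ Γ' then m else 0) + t) :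
    (∏ σ : Γ', act σ (∏ γ, act γ J ^ b γ)) ^ Fintype.card Γ' =
      (J ^ m) ^ Fintype.card Γ' * (∏ γ, act γ J) ^ t := by
  -- Right translation by `τ ∈ Γ'` does not change the conjugate of `J`, so one product has an
  -- expression for every `τ`. Multiplying these accounts for the exponent `|Γ'|` and produces the
  -- double sum.
  have h1 : ∀ σ τ : Γ', act (σ : Γ) (∏ γ, act γ J ^ b γ) =
      ∏ g, act g J ^ b ((σ⁻¹ : Γ') * g * (τ⁻¹ : Γ')) := by
    intro σ τ
    rw [map_prod]
    refine Fintype.prod_equiv ((Equiv.mulLeft (σ : Γ)).trans (Equiv.mulRight (τ : Γ))) _ _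
      fun γ => ?_
    have h2 : act ((σ : Γ) * γ * τ) J = act (σ : Γ) (act γ J) := by
      rw [map_mul, map_mul]
      change act (σ : Γ) (act γ (act (τ : Γ) J)) = _
      rw [hJ τ τ.2]
    change _ = act ((σ : Γ) * γ * τ) J ^ b ((σ⁻¹ : Γ') * ((σ : Γ) * γ * τ) * (τ⁻¹ : Γ'))
    rw [h2, map_pow]
    congr 2
    simp [mul_assoc]
  calc (∏ σ : Γ', act σ (∏ γ, act γ J ^ b γ)) ^ Fintype.card Γ'
      = ∏ τ : Γ', ∏ σ : Γ', act (σ : Γ) (∏ γ, act γ J ^ b γ) := by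
        rw [Finset.prod_const, Finset.card_univ]
    _ = ∏ τ : Γ', ∏ σ : Γ', ∏ g, act g J ^ b ((σ⁻¹ : Γ') * g * (τ⁻¹ : Γ')) :=
        Finset.prod_congr rfl fun τ _ => Finset.prod_congr rfl fun σ _ => h1 σ τ
    _ = ∏ τ : Γ', ∏ σ : Γ', ∏ g, act g J ^ b (σ * g * τ) := by
        refine Fintype.prod_equiv (Equiv.inv Γ') _ _ fun τ => ?_
        exact Fintype.prod_equiv (Equiv.inv Γ') _ _ fun σ => rfl
    _ = ∏ g, act g J ^ ((if g ∈ Γ' then m else 0) + t) := by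
        rw [Finset.prod_comm]
        simp_rw [Finset.prod_comm (s := (Finset.univ : Finset Γ')) (t := (Finset.univ : Finset Γ))]
        refine Finset.prod_congr rfl fun g _ => ?_
        rw [← hb g]
        simp only [Finset.prod_pow_eq_pow_sum]
    _ = (∏ g, act g J ^ (if g ∈ Γ' then m else 0)) * (∏ γ, act γ J) ^ t := by
        simp only [pow_add, Finset.prod_mul_distrib, Finset.prod_pow]
    _ = (J ^ m) ^ Fintype.card Γ' * (∏ γ, act γ J) ^ t := by
        congr 1
        have h3 : ∀ g, act g J ^ (if g ∈ Γ' then m else 0) = if g ∈ Γ' then J ^ m else 1 := by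
          intro g
          split_ifs with hg
          · rw [hJ g hg]
          · rw [pow_zero]
        simp only [h3]
        rw [Finset.prod_ite, Finset.prod_const, Finset.prod_const_one, mul_one,
          Fintype.card_subtype]

end HeckeProduct

/-! ### Relative norms of ideals in Galois extensions. -/

section IdealNorm

theorem Ideal.eq_of_pow_eq_pow {R : Type*} [CommRing R] [IsDedekindDomain R] {I J : Ideal R}
    {n : ℕ} (hn : n ≠ 0) (h : I ^ n = J ^ n) : I = J := by
  have h1 : I ∣ J := (UniqueFactorizationMonoid.pow_dvd_pow_iff_dvd hn).1 h.dvd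
  have h2 : J ∣ I := (UniqueFactorizationMonoid.pow_dvd_pow_iff_dvd hn).1 h.symm.dvd
  exact le_antisymm (Ideal.dvd_iff_le.1 h2) (Ideal.dvd_iff_le.1 h1)

/-- Write `I = J C`; then `C` has norm `1`, and a norm is contained in the contraction of its ideal,
so `C = 1`. -/
theorem Ideal.eq_of_le_of_relNorm_eq {R S : Type*} [CommRing R] [IsDedekindDomain R] [CommRing S]
    [IsDedekindDomain S] [Algebra R S] [Module.Finite R S] [Module.IsTorsionFree R S]
    {I J : Ideal S} (hle : I ≤ J) (hI : I ≠ ⊥)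
    (h : Ideal.relNorm R I = Ideal.relNorm R J) : I = J := by
  obtain ⟨C, rfl⟩ := Ideal.dvd_iff_le.2 hle
  rw [map_mul] at h
  have hJ : Ideal.relNorm R J ≠ 0 := by
    rw [Ne, Ideal.zero_eq_bot, Ideal.relNorm_eq_bot_iff]
    rintro rfl
    exact hI (by simp)
  have h1 : Ideal.relNorm R C = 1 := mul_left_cancel₀ hJ (by rw [h, mul_one])
  have h2 := Ideal.relNorm_le_comap R C
  rw [h1, Ideal.one_eq_top, top_le_iff, Ideal.comap_eq_top_iff] at h2
  rw [h2, Ideal.mul_top]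

variable (F E : Type*) [Field F] [Field E] [NumberField F] [NumberField E] [Algebra F E]

theorem finrank_ringOfIntegers : Module.finrank (𝓞 F) (𝓞 E) = Module.finrank F E :=
  (IsFractionRing.finrank_eq (𝓞 F) F (𝓞 E) E).symm

/-- The action of automorphisms on ideals. -/
def idealAct : (E ≃ₐ[F] E) →* Monoid.End (Ideal (𝓞 E)) where
  toFun σ := (Ideal.mapHom (RingOfIntegers.mapRingEquiv σ.toRingEquiv : 𝓞 E →+* 𝓞 E) :
    Ideal (𝓞 E) →* Ideal (𝓞 E))
  map_one' := MonoidHom.ext Ideal.map_id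
  map_mul' σ τ := MonoidHom.ext fun _ =>
    (Ideal.map_map (RingOfIntegers.mapRingEquiv τ.toRingEquiv : 𝓞 E →+* 𝓞 E)
      (RingOfIntegers.mapRingEquiv σ.toRingEquiv : 𝓞 E →+* 𝓞 E)).symm

variable {F E}

theorem relNorm_idealAct (σ : E ≃ₐ[F] E) (I : Ideal (𝓞 E)) :
    Ideal.relNorm (𝓞 F) (idealAct F E σ I) = Ideal.relNorm (𝓞 F) I :=
  Ideal.relNorm_map_algEquiv (RingOfIntegers.mapAlgEquiv σ) I

/-- Norms of elements are products of conjugates, which gives one inclusion. Both sides have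
relative norm `Nm(I)^[E:F]`, so they coincide. -/
theorem map_relNorm_eq_prod [IsGalois F E] (I : Ideal (𝓞 E)) :
    (Ideal.relNorm (𝓞 F) I).map (algebraMap (𝓞 F) (𝓞 E)) =
      ∏ σ : E ≃ₐ[F] E, idealAct F E σ I := by
  by_cases hI : I = ⊥
  · subst hI
    rw [Ideal.relNorm_bot, Ideal.map_bot]
    symm
    rw [← Ideal.zero_eq_bot]
    refine Finset.prod_eq_zero (Finset.mem_univ 1) ?_
    rw [map_one]
    rfl
  refine Ideal.eq_of_le_of_relNorm_eq (R := 𝓞 F) ?_ ?_ ?_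
  · rw [Ideal.map_relNorm, Ideal.span_le]
    rintro _ ⟨x, hx, rfl⟩
    have h1 : algebraMap (𝓞 F) (𝓞 E) (Algebra.intNorm (𝓞 F) (𝓞 E) x) =
        ∏ σ : E ≃ₐ[F] E, RingOfIntegers.mapRingEquiv σ.toRingEquiv x := by
      apply RingOfIntegers.ext
      have h2 := Algebra.algebraMap_intNorm (A := 𝓞 F) (K := F) (L := E) (B := 𝓞 E) x
      have h3 := Algebra.norm_eq_prod_automorphisms F (x : E)
      rw [show algebraMap (𝓞 E) E x = (x : E) from rfl] at h2
      rw [← h2] at h3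
      have h4 : ((∏ σ : E ≃ₐ[F] E, RingOfIntegers.mapRingEquiv σ.toRingEquiv x : 𝓞 E) : E) =
          ∏ σ : E ≃ₐ[F] E, σ (x : E) := map_prod (algebraMap (𝓞 E) E) _ _
      rw [h4, ← h3]
      rfl
    change algebraMap (𝓞 F) (𝓞 E) (Algebra.intNorm (𝓞 F) (𝓞 E) x) ∈ _
    rw [h1]
    exact Ideal.prod_mem_prod fun σ _ => Ideal.mem_map_of_mem _ hx
  · rw [Ne, Ideal.map_eq_bot_iff_of_injective (FaithfulSMul.algebraMap_injective _ _),
      Ideal.relNorm_eq_bot_iff]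
    exact hI
  · rw [Ideal.relNorm_algebraMap, map_prod, Finset.prod_congr rfl fun σ _ => relNorm_idealAct σ I,
      Finset.prod_const, Finset.card_univ, finrank_ringOfIntegers, ← Nat.card_eq_fintype_card,
      IsGalois.card_aut_eq_finrank]

end IdealNorm

/-! ### Norm and extension on class groups, and the Hecke identity there. -/

section ClassGroupNorm

theorem clNorm_clExt (F E : Type*) [Field F] [Field E] [NumberField F] [NumberField E]
    [Algebra F E] (c : Cl F) : clNorm F E (clExt F E c) = c ^ Module.finrank F E := by
  obtain ⟨I, rfl⟩ := ClassGroup.mk0_surjective c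
  rw [clExt, ClassGroup.extendedHom_mk0, clNorm_mk0, ← map_pow]
  refine congrArg ClassGroup.mk0 (Subtype.ext ?_)
  rw [SubmonoidClass.coe_pow, ← finrank_ringOfIntegers]
  exact Ideal.relNorm_algebraMap (𝓞 E) (I : Ideal (𝓞 F))

theorem clNorm_clNorm (K₀ K L : Type*) [Field K₀] [Field K] [Field L]
    [NumberField K₀] [NumberField K] [NumberField L] [Algebra K₀ K] [Algebra K L] [Algebra K₀ L]
    [IsScalarTower K₀ K L] (c : Cl L) : clNorm K₀ K (clNorm K L c) = clNorm K₀ L c := by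
  obtain ⟨I, rfl⟩ := ClassGroup.mk0_surjective c
  rw [clNorm_mk0, clNorm_mk0, clNorm_mk0]
  refine congrArg ClassGroup.mk0 (Subtype.ext ?_)
  exact Ideal.relNorm_relNorm (𝓞 K₀) (𝓞 K) (I : Ideal (𝓞 L))

theorem clNorm_galCl {F E : Type*} [Field F] [Field E] [NumberField F] [NumberField E]
    [Algebra F E] (σ : E ≃ₐ[F] E) (c : Cl E) : clNorm F E (galCl F E σ c) = clNorm F E c := by
  obtain ⟨I, rfl⟩ := ClassGroup.mk0_surjective c
  rw [galCl_mk0, clNorm_mk0, clNorm_mk0]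
  exact congrArg ClassGroup.mk0 (Subtype.ext (relNorm_idealAct σ (I : Ideal (𝓞 E))))

theorem Cl.eq_one_of_finrank_eq_one {F : Type*} [Field F] [NumberField F]
    (h : Module.finrank ℚ F = 1) (c : Cl F) : c = 1 := by
  have hbij : Function.Bijective (algebraMap ℚ F) :=
    ⟨(algebraMap ℚ F).injective, fun x => by
      have h1 := (finrank_eq_one_iff_of_nonzero' (1 : F) one_ne_zero).1 h x
      obtain ⟨q, hq⟩ := h1
      exact ⟨q, by rw [Algebra.algebraMap_eq_smul_one, hq]⟩⟩
  let f : ℤ ≃+* 𝓞 F := Rat.ringOfIntegersEquiv.symm.trans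
    (RingOfIntegers.mapRingEquiv (RingEquiv.ofBijective (algebraMap ℚ F) hbij))
  have : IsPrincipalIdealRing (𝓞 F) := IsPrincipalIdealRing.of_surjective f f.surjective
  obtain ⟨I, rfl⟩ := ClassGroup.mk0_surjective c
  exact (ClassGroup.mk0_eq_one_iff I.2).2 (IsPrincipalIdealRing.principal _)

theorem idealAct_map_of_fixed {K₀ K L : Type*} [Field K₀] [Field K] [Field L] [Algebra K L]
    [Algebra K₀ L] {Γ' : Subgroup (L ≃ₐ[K₀] L)}
    (hK : ∀ x : L, x ∈ Set.range (algebraMap K L) ↔ ∀ σ ∈ Γ', σ x = x)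
    {σ : L ≃ₐ[K₀] L} (hσ : σ ∈ Γ') (I : Ideal (𝓞 K)) :
    idealAct K₀ L σ (I.map (algebraMap (𝓞 K) (𝓞 L))) = I.map (algebraMap (𝓞 K) (𝓞 L)) := by
  change Ideal.map (RingOfIntegers.mapRingEquiv σ.toRingEquiv : 𝓞 L →+* 𝓞 L) _ = _
  rw [Ideal.map_map]
  congr 1
  ext x
  exact (hK _).1 ⟨x, rfl⟩ σ hσ

theorem galCl_clExt_of_fixed {K₀ K L : Type*} [Field K₀] [Field K] [Field L] [NumberField K]
    [NumberField L] [Algebra K L] [Algebra K₀ L] {Γ' : Subgroup (L ≃ₐ[K₀] L)}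
    (hK : ∀ x : L, x ∈ Set.range (algebraMap K L) ↔ ∀ σ ∈ Γ', σ x = x)
    {σ : L ≃ₐ[K₀] L} (hσ : σ ∈ Γ') (c : Cl K) :
    galCl K₀ L σ (clExt K L c) = clExt K L c := by
  obtain ⟨I, rfl⟩ := ClassGroup.mk0_surjective c
  rw [clExt, ClassGroup.extendedHom_mk0, galCl_mk0]
  exact congrArg ClassGroup.mk0 (Subtype.ext (idealAct_map_of_fixed hK hσ (I : Ideal (𝓞 K))))

variable {K₀ K L : Type*} [Field K₀] [Field K] [Field L]
  [NumberField K₀] [NumberField K] [NumberField L]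
  [Algebra K₀ K] [Algebra K L] [Algebra K₀ L] [IsScalarTower K₀ K L] [IsGalois K₀ L]
  {Γ' : Subgroup (L ≃ₐ[K₀] L)}

/-- The automorphisms of `L` over the fixed field `K` of `Γ'` are the elements of `Γ'`. -/
def galEquivOfFixed (hK : ∀ x : L, x ∈ Set.range (algebraMap K L) ↔ ∀ σ ∈ Γ', σ x = x) :
    (L ≃ₐ[K] L) ≃ Γ' where
  toFun σ := ⟨σ.restrictScalars K₀, by
    rw [← IntermediateField.fixingSubgroup_fixedField Γ', IntermediateField.mem_fixingSubgroup_iff]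
    intro x hx
    obtain ⟨y, rfl⟩ := (hK x).2 fun τ hτ => IntermediateField.mem_fixedField_iff Γ' x |>.1 hx τ hτ
    exact σ.commutes y⟩
  invFun σ := AlgEquiv.ofRingEquiv (f := (σ : L ≃ₐ[K₀] L).toRingEquiv)
    fun y => (hK _).1 ⟨y, rfl⟩ σ σ.2
  left_inv σ := by ext; rfl
  right_inv σ := by ext; rfl

variable (hK : ∀ x : L, x ∈ Set.range (algebraMap K L) ↔ ∀ σ ∈ Γ', σ x = x) [Fintype Γ']

include hK

theorem card_eq_finrank_of_fixed : Fintype.card Γ' = Module.finrank K L := by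
  have : IsGalois K L := IsGalois.tower_top_of_isGalois K₀ K L
  rw [← IsGalois.card_aut_eq_finrank, Nat.card_congr (galEquivOfFixed hK),
    Nat.card_eq_fintype_card]

theorem index_eq_finrank_of_fixed : Γ'.index = Module.finrank K₀ K := by
  have h1 := Subgroup.card_mul_index Γ'
  rw [IsGalois.card_aut_eq_finrank, Nat.card_eq_fintype_card, card_eq_finrank_of_fixed hK,
    ← Module.finrank_mul_finrank K₀ K L, mul_comm] at h1
  exact Nat.eq_of_mul_eq_mul_right Module.finrank_pos h1

theorem map_relNorm_eq_prod_of_fixed (I : Ideal (𝓞 L)) :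
    (Ideal.relNorm (𝓞 K) I).map (algebraMap (𝓞 K) (𝓞 L)) = ∏ σ : Γ', idealAct K₀ L σ I := by
  have : IsGalois K L := IsGalois.tower_top_of_isGalois K₀ K L
  rw [map_relNorm_eq_prod]
  exact Fintype.prod_equiv (galEquivOfFixed hK) _ _ fun σ => rfl

theorem clExt_clNorm_of_fixed (c : Cl L) :
    clExt K L (clNorm K L c) = ∏ σ : Γ', galCl K₀ L σ c := by
  obtain ⟨I, rfl⟩ := ClassGroup.mk0_surjective c
  rw [clNorm_mk0, clExt, ClassGroup.extendedHom_mk0]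
  simp only [galCl_mk0, ← map_prod]
  refine congrArg ClassGroup.mk0 (Subtype.ext ?_)
  rw [Submonoid.coe_finsetProd]
  exact map_relNorm_eq_prod_of_fixed hK (I : Ideal (𝓞 L))

/-- After extension to `L` and raising to the power `|Γ'|` this is the multiplicative Hecke
identity, norms having become products of conjugates. Descending to `K` by the norm costs a further
power `[L:K]`. Both exponents cancel because ideals have unique roots; at the level of classes this
would fail. -/
theorem relNorm_prod_of_hecke_identity [DecidablePred (· ∈ Γ')] {b : (L ≃ₐ[K₀] L) → ℕ} {m t : ℕ}
    (hb : ∀ g, ∑ σ : Γ', ∑ τ : Γ', b (σ * g * τ) = (if g ∈ Γ' then m else 0) + t)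
    (I : Ideal (𝓞 K)) :
    Ideal.relNorm (𝓞 K) (∏ γ, idealAct K₀ L γ (I.map (algebraMap (𝓞 K) (𝓞 L))) ^ b γ) =
      I ^ m * ((Ideal.relNorm (𝓞 K₀) I).map (algebraMap (𝓞 K₀) (𝓞 K))) ^ t := by
  have h0 : Module.finrank (𝓞 K) (𝓞 L) ≠ 0 := by
    rw [finrank_ringOfIntegers]; exact Module.finrank_pos.ne'
  have hc : Fintype.card Γ' = Module.finrank (𝓞 K) (𝓞 L) := by
    rw [finrank_ringOfIntegers, card_eq_finrank_of_fixed hK]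
  have h1 := prod_pow_eq_of_hecke_identity (idealAct K₀ L)
    (fun τ hτ => idealAct_map_of_fixed hK hτ I) hb
  rw [← map_relNorm_eq_prod_of_fixed hK, ← map_relNorm_eq_prod,
    ← Ideal.relNorm_relNorm (𝓞 K₀) (𝓞 K), Ideal.relNorm_algebraMap, map_pow, Ideal.map_pow,
    ← hc, pow_right_comm _ (Fintype.card Γ') t, ← mul_pow, ← Ideal.map_pow, IsScalarTower.algebraMap_eq (𝓞 K₀) (𝓞 K) (𝓞 L),
    ← Ideal.map_map, ← Ideal.map_pow, ← Ideal.map_pow, ← Ideal.map_mul, ← Ideal.map_pow] at h1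
  have h2 := congrArg (Ideal.relNorm (𝓞 K)) h1
  rw [Ideal.relNorm_algebraMap, Ideal.relNorm_algebraMap] at h2
  exact Ideal.eq_of_pow_eq_pow (hc ▸ h0) (Ideal.eq_of_pow_eq_pow h0 h2)

theorem clNorm_prod_of_hecke_identity [DecidablePred (· ∈ Γ')] {b : (L ≃ₐ[K₀] L) → ℕ} {m t : ℕ}
    (hb : ∀ g, ∑ σ : Γ', ∑ τ : Γ', b (σ * g * τ) = (if g ∈ Γ' then m else 0) + t) (c : Cl K) :
    clNorm K L (∏ γ, galCl K₀ L γ (clExt K L c) ^ b γ) =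
      c ^ m * clExt K₀ K (clNorm K₀ K c) ^ t := by
  obtain ⟨I, rfl⟩ := ClassGroup.mk0_surjective c
  rw [clNorm_mk0, clExt, clExt, ClassGroup.extendedHom_mk0, ClassGroup.extendedHom_mk0]
  simp only [galCl_mk0, ← map_pow, ← map_prod, ← map_mul]
  rw [clNorm_mk0]
  refine congrArg ClassGroup.mk0 (Subtype.ext ?_)
  have h1 := relNorm_prod_of_hecke_identity hK hb (I : Ideal (𝓞 K))
  refine Eq.trans ?_ h1
  change Ideal.relNorm (𝓞 K) _ = _
  rw [Submonoid.coe_finsetProd]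
  rfl

end ClassGroupNorm

/-! ### Functoriality of `S`-parts. -/

section SPart

variable {S : Set Nat.Primes} {G G' : Type*} [CommGroup G] [CommGroup G']

/-- If `x` is nontrivial modulo `G^S`, a prime `q` dividing its order there lies in `S` and divides
the index of `G^S`. But `G^S` contains a Sylow `q`-subgroup. -/
theorem mem_sPart_iff [Finite G] {x : G} :
    x ∈ sPart S G ↔ ∀ q : Nat.Primes, (q : ℕ) ∣ orderOf x → q ∈ S := by
  refine ⟨fun hx => (sPart_spec S hx).2, fun h => ?_⟩
  rw [← QuotientGroup.eq_one_iff, ← orderOf_eq_one_iff]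
  by_contra hne
  obtain ⟨q, hq, hqx⟩ := Nat.exists_prime_and_dvd hne
  have : Fact q.Prime := ⟨hq⟩
  have h1 : (⟨q, hq⟩ : Nat.Primes) ∈ S :=
    h ⟨q, hq⟩ (hqx.trans (orderOf_map_dvd (QuotientGroup.mk' (sPart S G)) x))
  have h2 : q ∣ (sPart S G).index := hqx.trans (orderOf_dvd_natCard _)
  let P : Sylow q G := default
  have h3 : (P : Subgroup G) ≤ sPart S G :=
    le_trans (le_iSup (fun P : Sylow q G => (P : Subgroup G)) P)
      (le_iSup₂ (f := fun (p : Nat.Primes) (_ : p ∈ S) =>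
        ⨆ P : Sylow (p : ℕ) G, (P : Subgroup G)) ⟨q, hq⟩ h1)
  exact P.not_dvd_index (h2.trans (Subgroup.index_dvd_of_le h3))

theorem MonoidHom.map_mem_sPart [Finite G'] (f : G →* G') {x : G} (hx : x ∈ sPart S G) :
    f x ∈ sPart S G' :=
  mem_sPart_iff.2 fun q hq => (sPart_spec S hx).2 q (hq.trans (orderOf_map_dvd f x))

theorem map_subtype_sPart [Finite G] (H : Subgroup G) :
    (sPart S H).map H.subtype = sPart S G ⊓ H := by
  ext x
  constructor
  · rintro ⟨y, hy, rfl⟩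
    exact ⟨H.subtype.map_mem_sPart hy, y.2⟩
  · rintro ⟨hx, hxH⟩
    refine ⟨⟨x, hxH⟩, mem_sPart_iff.2 fun q hq => (sPart_spec S hx).2 q ?_, rfl⟩
    rwa [Subgroup.orderOf_mk] at hq

theorem mem_of_pow_mem_of_mem_sPart {n : ℕ} (hn : ∀ p ∈ S, ¬ (p : ℕ) ∣ n) {x : G}
    (hx : x ∈ sPart S G) {H : Subgroup G} (h : x ^ n ∈ H) : x ∈ H := by
  have hc : n.Coprime (orderOf x) := by
    refine Nat.Coprime.symm (Nat.coprime_of_dvd fun q hq hq' hqn => ?_)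
    exact hn ⟨q, hq⟩ ((sPart_spec S hx).2 ⟨q, hq⟩ hq') hqn
  obtain ⟨m, hm⟩ := exists_pow_eq_self_of_coprime hc
  exact hm ▸ H.pow_mem h m

theorem eq_one_of_pow_eq_one_of_mem_sPart {n : ℕ} (hn : ∀ p ∈ S, ¬ (p : ℕ) ∣ n) {x : G}
    (hx : x ∈ sPart S G) (h : x ^ n = 1) : x = 1 :=
  Subgroup.mem_bot.1 (mem_of_pow_mem_of_mem_sPart hn hx (Subgroup.mem_bot.2 h))

theorem injOn_sPart_of_eq_one (f : G →* G') {H : Subgroup G} (h : ∀ x ∈ H, f x = 1 → x = 1) :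
    Set.InjOn f H := fun x hx y hy hxy => by
  rw [← mul_inv_eq_one]
  exact h _ (H.mul_mem hx (H.inv_mem hy)) (by rw [map_mul, map_inv, hxy, mul_inv_cancel])

/-- The `ℤ_S`-linear map of `S`-parts induced by a homomorphism. -/
def sPartMap (S : Set Nat.Primes) [Finite G'] (f : G →* G') :
    Additive (sPart S G) →ₗ[ZLoc S] Additive (sPart S G') where
  toFun := MonoidHom.toAdditive
    ((f.domRestrict (sPart S G)).codRestrict (sPart S G') fun x => f.map_mem_sPart x.2)
  map_add' := map_add _
  map_smul' q x := by
    refine (sPartSMul_eq S G' q _ _ _ _ q.2 (Rat.mul_den_eq_num _) ?_).symm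
    rw [← map_nsmul, sPart_smul_spec, map_zsmul]

theorem sPart_smul_right_cancel {n : ℕ} (hn : ∀ p ∈ S, ¬ (p : ℕ) ∣ n)
    {x : Additive (sPart S G)} (h : n • x = 0) : x = 0 :=
  sPart_nsmul_injective S hn (by rw [h, smul_zero])

end SPart

/-! ### Group ring actions on fixed and invariant vectors. -/

section Representation

variable {k Γ V W : Type*} [CommRing k] [Group Γ] [AddCommGroup V] [Module k V] [AddCommGroup W]
  [Module k W] (ρ : Representation k Γ V)

theorem Representation.asAlgebraHom_subgroupSum (Γ' : Subgroup Γ) [Fintype Γ'] (y : V) :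
    ρ.asAlgebraHom (subgroupSum k Γ') y = ∑ σ : Γ', ρ σ y := by
  rw [subgroupSum, map_sum, LinearMap.sum_apply]
  simp

theorem Representation.map_asAlgebraHom_of_invariant (f : V →ₗ[k] W)
    (hf : ∀ g v, f (ρ g v) = f v) (x : MonoidAlgebra k Γ) (v : V) :
    f (ρ.asAlgebraHom x v) = groupRingAug k Γ x • f v := by
  induction x using MonoidAlgebra.induction_linear with
  | zero => simp
  | add x y hx hy => rw [map_add, LinearMap.add_apply, map_add, hx, hy, map_add, add_smul]
  | single g r => simp [hf]

/-- The action of `k[Γ]` on a vector fixed by `Γ'` factors through `k[Γ/Γ']`. -/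
theorem Representation.asAlgebraHom_apply_eq_of_mul_subgroupSum [Finite Γ] {Γ' : Subgroup Γ}
    [Fintype Γ'] {x x' : MonoidAlgebra k Γ} (h : x * subgroupSum k Γ' = x' * subgroupSum k Γ')
    {y : V} (hy : ∀ σ ∈ Γ', ρ σ y = y) : ρ.asAlgebraHom x y = ρ.asAlgebraHom x' y := by
  classical
  cases nonempty_fintype Γ
  -- The coefficient of `xN` at `g` sums `x` over `gΓ'`, and `y` sees only cosets. Writing `y` as a
  -- multiple of `N y` is not possible, since `|Γ'|` need not be invertible in `k`.
  have key : ∀ x : MonoidAlgebra k Γ, ρ.asAlgebraHom x y = ∑ q : Γ ⧸ Γ',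
      (x * subgroupSum k Γ').coeff q.out • ρ q.out y := by
    intro x
    induction x using MonoidAlgebra.induction_linear with
    | zero => simp
    | add x z hx hz =>
      rw [map_add, LinearMap.add_apply, hx, hz, ← Finset.sum_add_distrib]
      refine Finset.sum_congr rfl fun q _ => ?_
      rw [add_mul, MonoidAlgebra.coeff_add, Finsupp.add_apply, add_smul]
    | single g r =>
      rw [Finset.sum_eq_single (g : Γ ⧸ Γ')]
      · obtain ⟨τ, hτ⟩ := QuotientGroup.mk_out_eq_mul Γ' g
        rw [MonoidAlgebra.coeff_single_mul_apply, coeff_subgroupSum, hτ, inv_mul_cancel_left,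
          if_pos τ.2, mul_one, map_mul, Module.End.mul_apply, hy _ τ.2]
        simp
      · intro q _ hq
        rw [MonoidAlgebra.coeff_single_mul_apply, coeff_subgroupSum, if_neg, mul_zero, zero_smul]
        intro hmem
        refine hq ?_
        rw [← QuotientGroup.out_eq' q]
        exact (QuotientGroup.eq.2 hmem).symm
      · simp
  rw [key, key, h]

end Representation

/-! ### The idempotent and the Hecke identity in `ℤ_S[Γ]`. -/

section LocalGroupRing

theorem groupRingIncl_subgroupSum {Γ : Type*} [Group Γ] (R : Subring ℚ) (H : Subgroup Γ) [Fintype H] :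
    groupRingIncl R Γ (subgroupSum R H) = subgroupSum ℚ H := by
  rw [subgroupSum, map_sum]
  refine Finset.sum_congr rfl fun σ _ => ?_
  rw [groupRingIncl, MonoidAlgebra.mapAlgHom_single]
  rfl

theorem subgroupSum_mul_mul_of_hecke_identity {Γ : Type*} [Group Γ] [Fintype Γ]
    {Γ' : Subgroup Γ} {k : Type*} [CommRing k] [Fintype Γ']
    [Fintype (⊤ : Subgroup Γ)] [DecidablePred (· ∈ Γ')] {b : Γ → ℕ} {m t : ℕ}
    (hb : ∀ g, ∑ σ : Γ', ∑ τ : Γ', b (σ * g * τ) = (if g ∈ Γ' then m else 0) + t) :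
    subgroupSum k Γ' * (∑ γ, MonoidAlgebra.single γ (b γ : k)) * subgroupSum k Γ' =
      m • subgroupSum k Γ' + t • subgroupSum k (⊤ : Subgroup Γ) := by
  classical
  ext g
  rw [coeff_mul_subgroupSum]
  simp only [coeff_subgroupSum_mul]
  have h1 : ∀ g, (∑ γ, MonoidAlgebra.single γ (b γ : k)).coeff g = b g := fun g => by
    rw [MonoidAlgebra.coeff_sum, Finsupp.finsetSum_apply]
    simp [Finsupp.single_apply]
  simp only [h1]
  rw [Finset.sum_comm]
  have h2 := congrArg (Nat.cast : ℕ → k) (hb g)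
  push_cast at h2
  simp only [← mul_assoc]
  rw [h2, MonoidAlgebra.coeff_add, Finsupp.add_apply, MonoidAlgebra.coeff_smul,
    MonoidAlgebra.coeff_smul, Finsupp.smul_apply, Finsupp.smul_apply, coeff_subgroupSum,
    coeff_subgroupSum]
  simp

variable {Γ : Type*} [Group Γ] [Fintype Γ] {Γ' : Subgroup Γ} {S : Set Nat.Primes}

theorem exists_groupRingIncl_eq_augIdempotent
    (hS : ∀ p ∈ S, IsGoodPrime (augIdempotent Γ') p) :
    ∃ e, groupRingIncl (ZLoc S) Γ e = augIdempotent Γ' :=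
  mem_range_groupRingIncl.2 fun g p hp =>
    mem_range_groupRingIncl.1 (hS p hp).1 g p rfl

variable {e : MonoidAlgebra (ZLoc S) Γ} (he : groupRingIncl (ZLoc S) Γ e = augIdempotent Γ')

include he

theorem comm_of_groupRingIncl_eq_augIdempotent (x : MonoidAlgebra (ZLoc S) Γ) : x * e = e * x :=
  groupRingIncl_injective _ (by rw [map_mul, map_mul, he, augIdempotent_comm])

theorem mul_self_of_groupRingIncl_eq_augIdempotent : e * e = e :=
  groupRingIncl_injective _ (by rw [map_mul, he, augIdempotent_isIdempotentElem.eq])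

variable [Fintype Γ']

theorem groupRingAug_of_groupRingIncl_eq_augIdempotent : groupRingAug (ZLoc S) Γ e = 0 :=
  Subtype.ext (by rw [← groupRingAug_groupRingIncl, he, groupRingAug_augIdempotent]; rfl)

theorem index_smul_one_sub_mul_subgroupSum [Fintype (⊤ : Subgroup Γ)] :
    Γ'.index • ((1 - e) * subgroupSum (ZLoc S) Γ') = subgroupSum (ZLoc S) (⊤ : Subgroup Γ) :=
  groupRingIncl_injective _ (by
    rw [map_nsmul, map_mul, map_sub, map_one, he, groupRingIncl_subgroupSum,
      groupRingIncl_subgroupSum, sub_mul, one_mul, smul_sub, augIdempotent_mul_subgroupSum,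
      sub_sub_cancel])

variable {V : Type*} [AddCommGroup V] [Module (ZLoc S) V] (ρ : Representation (ZLoc S) Γ V)

/-- On fixed vectors only the product with `N` on the right matters, and `N e B N = e(m N + t s) = m
e N` because `e s = 0`. -/
theorem asAlgebraHom_hecke_of_fixed [DecidablePred (· ∈ Γ')] {b : Γ → ℕ} {m t : ℕ}
    (hb : ∀ g, ∑ σ : Γ', ∑ τ : Γ', b (σ * g * τ) = (if g ∈ Γ' then m else 0) + t)
    {y : V} (hy : ∀ σ ∈ Γ', ρ σ y = y) :
    ρ.asAlgebraHom (subgroupSum (ZLoc S) Γ' *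
      (e * ∑ γ, MonoidAlgebra.single γ (b γ : ZLoc S))) y = m • ρ.asAlgebraHom e y := by
  classical
  rw [← LinearMap.smul_apply, ← map_nsmul]
  refine ρ.asAlgebraHom_apply_eq_of_mul_subgroupSum ?_ hy
  rw [← mul_assoc, comm_of_groupRingIncl_eq_augIdempotent he, mul_assoc e, mul_assoc e,
    subgroupSum_mul_mul_of_hecke_identity hb, mul_add, mul_smul_comm, mul_smul_comm,
    mul_subgroupSum_top, groupRingAug_of_groupRingIncl_eq_augIdempotent he, zero_smul, smul_zero,
    add_zero, smul_mul_assoc]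

theorem index_smul_asAlgebraHom_one_sub [Fintype (⊤ : Subgroup Γ)] (x : MonoidAlgebra (ZLoc S) Γ)
    (y : V) : Γ'.index • ρ.asAlgebraHom ((1 - e) * (subgroupSum (ZLoc S) Γ' * x)) y =
      groupRingAug (ZLoc S) Γ x • ∑ σ : Γ, ρ σ y := by
  rw [← LinearMap.smul_apply, ← map_nsmul, ← mul_assoc, ← smul_mul_assoc,
    index_smul_one_sub_mul_subgroupSum he, subgroupSum_top_mul, map_smul, LinearMap.smul_apply,
    ρ.asAlgebraHom_subgroupSum]
  congr 1
  exact Fintype.sum_equiv Subgroup.topEquiv.toEquiv _ _ fun σ => rfl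

end LocalGroupRing

/-! ### Extension of relative classes: injectivity and image. -/

section ClassGroupSPart

theorem coe_sPartRep_asAlgebraHom_sum {S : Set Nat.Primes} {Γ G : Type*} [Group Γ] [Fintype Γ]
    [CommGroup G] (φ : Γ →* MulAut G) (b : Γ → ℕ) (y : Additive (sPart S G)) :
    (((sPartRep S φ).asAlgebraHom (∑ γ, MonoidAlgebra.single γ (b γ : ZLoc S)) y).toMul : G) =
      ∏ γ, φ γ (y.toMul : G) ^ b γ := by
  rw [map_sum, LinearMap.sum_apply, toMul_sum, Subgroup.val_finsetProd]
  refine Finset.prod_congr rfl fun γ _ => ?_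
  rw [Representation.asAlgebraHom_single, LinearMap.smul_apply, Nat.cast_smul_eq_nsmul]
  rfl

theorem mem_smulSPart_iff {S : Set Nat.Primes} {Γ G : Type*} [Group Γ] [CommGroup G]
    (φ : Γ →* MulAut G) {e : MonoidAlgebra (ZLoc S) Γ} (he : e * e = e) {x : G} :
    x ∈ smulSPart S φ e ↔ ∃ y : Additive (sPart S G),
      (sPartRep S φ).asAlgebraHom e y = y ∧ (y.toMul : G) = x := by
  constructor
  · rintro ⟨y, ⟨z, rfl⟩, rfl⟩
    refine ⟨(sPartRep S φ).asAlgebraHom e z, ?_, rfl⟩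
    rw [← Module.End.mul_apply, ← map_mul, he]
  · rintro ⟨y, hy, rfl⟩
    exact ⟨y.toMul, ⟨y, hy⟩, rfl⟩

theorem relClS_eq (K₀ K : Type*) [Field K₀] [Field K] [NumberField K₀] [NumberField K]
    [Algebra K₀ K] (S : Set Nat.Primes) : relClS K₀ K S = sPart S (Cl K) ⊓ (clNorm K₀ K).ker :=
  map_subtype_sPart _

variable {K₀ K L : Type*} [Field K₀] [Field K] [Field L]
  [NumberField K₀] [NumberField K] [NumberField L]
  [Algebra K₀ K] [Algebra K L] [Algebra K₀ L] [IsScalarTower K₀ K L] [IsGalois K₀ L]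
  {Γ' : Subgroup (L ≃ₐ[K₀] L)}
  (hK : ∀ x : L, x ∈ Set.range (algebraMap K L) ↔ ∀ σ ∈ Γ', σ x = x)
  {S : Set Nat.Primes} (hS : ∀ p ∈ S, IsGoodPrime (augIdempotent Γ') p)

include hK hS

theorem not_dvd_finrank_of_isGoodPrime : ∀ p ∈ S, ¬ (p : ℕ) ∣ Module.finrank K₀ K := by
  classical
  intro p hp
  rw [← index_eq_finrank_of_fixed hK]
  exact (hS p hp).not_dvd_index

/-- The Hecke identity writes `c^m` as a norm of conjugates of `i_* c`, so `c^m = 1` with `m` prime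
to `S`. -/
theorem eq_one_of_clExt_eq_one {c : Cl K} (hc : c ∈ relClS K₀ K S) (h : clExt K L c = 1) :
    c = 1 := by
  classical
  rw [relClS_eq] at hc
  obtain ⟨b, m, t, hm, hb⟩ := exists_hecke_identity hS
  have h1 := clNorm_prod_of_hecke_identity hK hb c
  rw [h, MonoidHom.mem_ker.1 hc.2] at h1
  simp only [map_one, one_pow, Finset.prod_const_one, mul_one] at h1
  exact eq_one_of_pow_eq_one_of_mem_sPart hm hc.1 h1.symm

theorem map_clExt_relClS {e : MonoidAlgebra (ZLoc S) (L ≃ₐ[K₀] L)}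
    (he : groupRingIncl (ZLoc S) (L ≃ₐ[K₀] L) e = augIdempotent Γ') :
    (relClS K₀ K S).map (clExt K L) =
      smulSPart S (galCl K₀ L) e ⊓ fixedSubgroup (galCl K₀ L) Γ' := by
  classical
  have hee := mul_self_of_groupRingIncl_eq_augIdempotent he
  obtain ⟨b, m, t, hm, hb⟩ := exists_hecke_identity hS
  set B : MonoidAlgebra (ZLoc S) (L ≃ₐ[K₀] L) := ∑ γ, MonoidAlgebra.single γ (b γ : ZLoc S) with hB
  set ρ := sPartRep S (galCl K₀ L) with hρ
  have hNm : ∀ z : Additive (sPart S (Cl L)),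
      ρ.asAlgebraHom (subgroupSum (ZLoc S) Γ') z =
        sPartMap S (clExt K L) (sPartMap S (clNorm K L) z) := fun z => by
    refine Subtype.ext ?_
    change ((ρ.asAlgebraHom (subgroupSum (ZLoc S) Γ') z).toMul : Cl L) =
      clExt K L (clNorm K L z.toMul)
    rw [clExt_clNorm_of_fixed hK, ρ.asAlgebraHom_subgroupSum, toMul_sum, Subgroup.val_finsetProd]
    rfl
  have hinv : ∀ g z, sPartMap S (clNorm K₀ L) (ρ g z) = sPartMap S (clNorm K₀ L) z :=
    fun g z => Subtype.ext (clNorm_galCl g _)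
  rw [relClS_eq]
  ext x
  constructor
  · rintro ⟨c, ⟨hcS, hc⟩, rfl⟩
    have hfix : ∀ σ ∈ Γ', galCl K₀ L σ (clExt K L c) = clExt K L c :=
      fun σ hσ => galCl_clExt_of_fixed hK hσ c
    refine ⟨(mem_smulSPart_iff _ hee).2 ?_, hfix⟩
    set c' : Additive (sPart S (Cl K)) := Additive.ofMul ⟨c, hcS⟩ with hc'
    set y := sPartMap S (clExt K L) c' with hy
    refine ⟨y, ?_, rfl⟩
    have h1 : ρ.asAlgebraHom (subgroupSum (ZLoc S) Γ' * B) y = m • y := by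
      rw [map_mul, Module.End.mul_apply, hNm, hy, ← map_nsmul]
      congr 1
      refine Subtype.ext ?_
      change clNorm K L ((ρ.asAlgebraHom B y).toMul : Cl L) = c ^ m
      rw [hB, hρ, coe_sPartRep_asAlgebraHom_sum]
      have h2 := clNorm_prod_of_hecke_identity hK hb c
      rwa [MonoidHom.mem_ker.1 hc, map_one, one_pow, mul_one] at h2
    have h2 : ∑ σ : L ≃ₐ[K₀] L, ρ σ y = 0 := by
      -- The product of all conjugates of `i_* c` is extended from its norm in `Cl_{K₀}`, a power of
      -- the trivial class `Nm c`.
      have h3 := clExt_clNorm_of_fixed (K₀ := K₀) (K := K₀) (Γ' := ⊤)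
        (fun x => by
          rw [IsGalois.mem_range_algebraMap_iff_fixed]
          simp) (clExt K L c)
      rw [← clNorm_clNorm K₀ K L, clNorm_clExt, map_pow, MonoidHom.mem_ker.1 hc, one_pow,
        map_one] at h3
      refine Subtype.ext ?_
      change (((∑ σ : L ≃ₐ[K₀] L, ρ σ y).toMul : sPart S (Cl L)) : Cl L) = 1
      rw [toMul_sum, Subgroup.val_finsetProd, h3]
      exact Fintype.prod_equiv Subgroup.topEquiv.toEquiv.symm _ _ fun σ => rfl
    -- Since `N B y = m y`, this reads `n m (1 - e) y = 0`; both `n` and `m` are prime to `S`, so `e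
    -- y = y`.
    have h3 := index_smul_asAlgebraHom_one_sub he ρ B y
    rw [h2, smul_zero, map_mul, Module.End.mul_apply, h1, map_nsmul] at h3
    have h4 := sPart_smul_right_cancel hm
      (sPart_smul_right_cancel (fun p hp => (hS p hp).not_dvd_index) h3)
    rw [map_sub, map_one, LinearMap.sub_apply, Module.End.one_apply, sub_eq_zero] at h4
    exact h4.symm
  · rintro ⟨hx, hfix⟩
    obtain ⟨y, hy, rfl⟩ := (mem_smulSPart_iff _ hee).1 hx
    have h1 := asAlgebraHom_hecke_of_fixed he ρ hb (y := y) fun σ hσ => Subtype.ext (hfix σ hσ)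
    rw [hy, map_mul, Module.End.mul_apply, hNm] at h1
    set z := ρ.asAlgebraHom (e * B) y with hz
    -- It suffices to place the `m`-th power of the class in the image; it equals `i_*` of the norm
    -- of `z = e B y`.
    refine mem_of_pow_mem_of_mem_sPart hm (y.toMul).2
      ⟨clNorm K L z.toMul, ⟨(clNorm K L).map_mem_sPart (z.toMul).2, ?_⟩,
        congrArg (fun w => (w.toMul : Cl L)) h1⟩
    -- The norm to `K₀` is `Γ`-invariant, so `e B` acts on it through its augmentation, which is
    -- `0`.
    have h2 := ρ.map_asAlgebraHom_of_invariant _ hinv (e * B) y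
    rw [map_mul (groupRingAug _ _), groupRingAug_of_groupRingIncl_eq_augIdempotent he, zero_mul, zero_smul] at h2
    change clNorm K₀ K (clNorm K L z.toMul) = 1
    rw [clNorm_clNorm]
    exact congrArg (fun w => (w.toMul : Cl K₀)) h2

end ClassGroupSPart

/-! ### Splitting of the norm sequence when the degree is prime to `S`. -/

theorem pow_bijective_sPart {S : Set Nat.Primes} {G : Type*} [CommGroup G] {n : ℕ}
    (hn : ∀ p ∈ S, ¬ (p : ℕ) ∣ n) : Function.Bijective (powMonoidHom n : sPart S G →* sPart S G) :=
  ⟨fun x y h => sPart_nsmul_injective S hn (x := Additive.ofMul x) (y := Additive.ofMul y) h,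
    fun x => sPart_exists_nsmul_eq S hn (Additive.ofMul x)⟩

section RelativeClassGroup

variable {K₀ K : Type*} [Field K₀] [Field K] [NumberField K₀] [NumberField K] [Algebra K₀ K]
  {S : Set Nat.Primes} (hn : ∀ p ∈ S, ¬ (p : ℕ) ∣ Module.finrank K₀ K)

include hn

/-- `Nm ∘ i_*` is the power map of exponent `[K:K₀]`, bijective on the `S`-part; the section is
`i_*` after its inverse. That its values lie in the image of `i_*` yields the internal direct
product. -/
theorem exists_clNorm_section : ∃ s : sPart S (Cl K₀) →* sPart S (Cl K),
    (∀ x, (s x : Cl K) ∈ (sPart S (Cl K₀)).map (clExt K₀ K)) ∧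
      ∀ x : sPart S (Cl K₀), clNorm K₀ K (s x : Cl K) = (x : Cl K₀) := by
  let f := MulEquiv.ofBijective _ (pow_bijective_sPart (G := Cl K₀) hn)
  refine ⟨(((clExt K₀ K).domRestrict (sPart S (Cl K₀))).codRestrict (sPart S (Cl K))
    fun x => (clExt K₀ K).map_mem_sPart x.2).comp f.symm.toMonoidHom,
    fun x => ⟨f.symm x, (f.symm x).2, rfl⟩, fun x => ?_⟩
  change clNorm K₀ K (clExt K₀ K (f.symm x : sPart S (Cl K₀))) = _
  rw [clNorm_clExt]
  exact congrArg Subtype.val (f.apply_symm_apply x)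

theorem map_clNorm_sPart : (sPart S (Cl K)).map (clNorm K₀ K) = sPart S (Cl K₀) := by
  obtain ⟨s, -, hs⟩ := exists_clNorm_section hn
  ext x
  constructor
  · rintro ⟨c, hc, rfl⟩
    exact (clNorm K₀ K).map_mem_sPart hc
  · exact fun hx => ⟨s ⟨x, hx⟩, (s ⟨x, hx⟩).2, hs ⟨x, hx⟩⟩

theorem eq_one_of_clNorm_clExt_eq_one {x : Cl K₀} (hx : x ∈ sPart S (Cl K₀))
    (h : clNorm K₀ K (clExt K₀ K x) = 1) : x = 1 :=
  eq_one_of_pow_eq_one_of_mem_sPart hn hx (by rw [← clNorm_clExt, h])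

theorem injOn_clExt_sPart : Set.InjOn (clExt K₀ K) (sPart S (Cl K₀) : Set (Cl K₀)) :=
  injOn_sPart_of_eq_one _ fun _ hx h =>
    eq_one_of_clNorm_clExt_eq_one hn hx (by rw [h, map_one])

theorem map_clExt_inf_relClS : (sPart S (Cl K₀)).map (clExt K₀ K) ⊓ relClS K₀ K S = ⊥ := by
  rw [eq_bot_iff, relClS_eq]
  rintro _ ⟨⟨x, hx, rfl⟩, -, h⟩
  rw [eq_one_of_clNorm_clExt_eq_one hn hx h, map_one]
  exact Subgroup.one_mem _

theorem map_clExt_sup_relClS :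
    (sPart S (Cl K₀)).map (clExt K₀ K) ⊔ relClS K₀ K S = sPart S (Cl K) := by
  obtain ⟨s, hs, hs'⟩ := exists_clNorm_section hn
  rw [relClS_eq]
  refine le_antisymm (sup_le ?_ inf_le_left) fun c hc => ?_
  · rintro _ ⟨x, hx, rfl⟩
    exact (clExt K₀ K).map_mem_sPart hx
  · set x : sPart S (Cl K₀) := ⟨clNorm K₀ K c, (clNorm K₀ K).map_mem_sPart hc⟩ with hx
    rw [← mul_inv_cancel_left (s x : Cl K) c]
    refine Subgroup.mul_mem_sup (hs x) ⟨Subgroup.mul_mem _ (Subgroup.inv_mem _ (s x).2) hc, ?_⟩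
    change clNorm K₀ K _ = 1
    rw [map_mul, map_inv, hs' x, inv_mul_cancel]

end RelativeClassGroup

theorem relClS_eq_sPart_of_finrank_eq_one {K₀ : Type*} (K : Type*) [Field K₀] [Field K]
    [NumberField K₀] [NumberField K] [Algebra K₀ K] (S : Set Nat.Primes)
    (h : Module.finrank ℚ K₀ = 1) : relClS K₀ K S = sPart S (Cl K) := by
  rw [relClS_eq, inf_eq_left]
  exact fun c _ => Cl.eq_one_of_finrank_eq_one h _

/-- By Cauchy's theorem the kernel would contain an element of order `p`, which lies in the
`S`-part. -/
theorem not_dvd_card_ker_of_injOn_sPart {S : Set Nat.Primes} {G G' : Type*} [CommGroup G]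
    [CommGroup G'] [Finite G] {f : G →* G'} (hf : Set.InjOn f (sPart S G : Set G))
    {p : Nat.Primes} (hp : p ∈ S) : ¬ (p : ℕ) ∣ Nat.card f.ker := by
  intro hd
  have : Fact (p : ℕ).Prime := ⟨p.2⟩
  obtain ⟨x, hx⟩ := exists_prime_orderOf_dvd_card' (p : ℕ) hd
  have hxS : (x : G) ∈ sPart S G := mem_sPart_iff.2 fun q hq => by
    rw [Subgroup.orderOf_coe, hx, Nat.prime_dvd_prime_iff_eq q.2 p.2] at hq
    rwa [Subtype.ext hq]
  have h1 : (x : G) = 1 := hf hxS (Subgroup.one_mem _) (by rw [MonoidHom.mem_ker.1 x.2, map_one])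
  rw [OneMemClass.coe_eq_one.1 h1, orderOf_one] at hx
  exact p.2.one_lt.ne hx

end

/-! ### The theorem. -/

theorem mainTheorem1 {K₀ K L : Type*} [Field K₀] [Field K] [Field L]
    [NumberField K₀] [NumberField K] [NumberField L]
    [Algebra K₀ K] [Algebra K L] [Algebra K₀ L] [IsScalarTower K₀ K L] [IsGalois K₀ L]
    (Γ' : Subgroup (L ≃ₐ[K₀] L))
    (hK : ∀ x : L, x ∈ Set.range (algebraMap K L) ↔ ∀ σ ∈ Γ', σ x = x)
    (S : Set Nat.Primes) (hS : ∀ p ∈ S, IsGoodPrime (augIdempotent Γ') p) :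
    -- (i) the degree is prime to `S`
    (∀ p ∈ S, ¬ (p : ℕ) ∣ Module.finrank K₀ K) ∧
    -- the sequence `1 → Cl_{K|K₀}^S → Cl_K^S → Cl_{K₀}^S → 1` is exact
    relClS K₀ K S = sPart S (Cl K) ⊓ (clNorm K₀ K).ker ∧
    (sPart S (Cl K)).map (clNorm K₀ K) = sPart S (Cl K₀) ∧
    -- and it splits
    (∃ s : sPart S (Cl K₀) →* sPart S (Cl K),
      ∀ x : sPart S (Cl K₀), clNorm K₀ K (s x : Cl K) = (x : Cl K₀)) ∧
    -- `Cl_K^S` is the internal direct product of (the image of) `Cl_{K₀}^S` and `Cl_{K|K₀}^S`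
    Set.InjOn (clExt K₀ K) (sPart S (Cl K₀) : Set (Cl K₀)) ∧
    (sPart S (Cl K₀)).map (clExt K₀ K) ⊓ relClS K₀ K S = ⊥ ∧
    (sPart S (Cl K₀)).map (clExt K₀ K) ⊔ relClS K₀ K S = sPart S (Cl K) ∧
    -- (ii) `e_{Γ/Γ'}` lies in `ℤ_S[Γ]`, and `i_*` maps `Cl_{K|K₀}^S` isomorphically onto
    -- the subgroup `(e_{Γ/Γ'} Cl_L^S)^{Γ'}` of `Cl_L`
    (∃ e : MonoidAlgebra (ZLoc S) (L ≃ₐ[K₀] L),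
      groupRingIncl (ZLoc S) (L ≃ₐ[K₀] L) e = augIdempotent Γ' ∧
      Set.InjOn (clExt K L) (relClS K₀ K S : Set (Cl K)) ∧
      (relClS K₀ K S).map (clExt K L) =
        smulSPart S (galCl K₀ L) e ⊓ fixedSubgroup (galCl K₀ L) Γ' ∧
      -- for `K₀ = ℚ`, `i_*` is an isomorphism from the whole of `Cl_K^S`
      (Module.finrank ℚ K₀ = 1 →
        Set.InjOn (clExt K L) (sPart S (Cl K) : Set (Cl K)) ∧
        (sPart S (Cl K)).map (clExt K L) =
          smulSPart S (galCl K₀ L) e ⊓ fixedSubgroup (galCl K₀ L) Γ')) ∧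
    -- for `K₀ = ℚ`, the order of the capitulation kernel is prime to `S`
    (Module.finrank ℚ K₀ = 1 → ∀ p ∈ S, ¬ (p : ℕ) ∣ Nat.card (clExt K L).ker) := by
  have hn := not_dvd_finrank_of_isGoodPrime hK hS
  have hinj : Set.InjOn (clExt K L) (relClS K₀ K S : Set (Cl K)) :=
    injOn_sPart_of_eq_one _ fun _ hc h => eq_one_of_clExt_eq_one hK hS hc h
  obtain ⟨e, he⟩ := exists_groupRingIncl_eq_augIdempotent hS
  have himg := map_clExt_relClS hK hS he
  obtain ⟨s, -, hs⟩ := exists_clNorm_section hn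
  refine ⟨hn, relClS_eq K₀ K S, map_clNorm_sPart hn, ⟨s, hs⟩, injOn_clExt_sPart hn,
    map_clExt_inf_relClS hn, map_clExt_sup_relClS hn, ⟨e, he, hinj, himg, fun h1 => ?_⟩,
    fun h1 p hp => not_dvd_card_ker_of_injOn_sPart ?_ hp⟩
  · rw [← relClS_eq_sPart_of_finrank_eq_one K S h1]
    exact ⟨hinj, himg⟩
  · rwa [← relClS_eq_sPart_of_finrank_eq_one K S h1]
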